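/- **Definitions.** Let $PSL(2,\mathbb C)=SL(2,\mathbb C)/\{\pm1\}$ act on $\widehat{\mathbb C}=\mathbb C\cup\{\infty\}$ by Möbius transformations and on the upper half-space $\mathbb H$ by their isometric extensions. A subgroup is *elementary* if it has a finite orbit in $\mathbb H\cup\widehat{\mathbb C}$. A hyperbolic line is given by its two ends on $\widehat{\mathbb C}$; it is *improper* if the ends coincide. The *axis* of $A\neq1$ is the line whose ends are the fixed points of $A$ on $\widehat{\mathbb C}$ (improper if $A$ is parabolic). For $x\ne y$, $H_{[x,y]}$ is the half-turn about the line $[x,y]$, the element of order two fixing $x$ and $y$. A proper line is perpendicular to an improper line $[u,u]$ if $u$ is one of its ends. If $\langle A,B\rangle$ is non-elementary, the axes of $A$ and $B$ have a common perpendicular $[n,n']$ with $n\neq n'$, and there are unique lines $[a,a']$, $[b,b']$ with $A=H_{[a,a']}H_{[n,n']}$, $B=H_{[b,b']}H_{[n,n']}$; the six-tuple $(a,a',n,n',b,b')$ is the *ortho-end* of $(A,B)$. The pair $(A,B)$ is *marked nsdc* if $\langle A,B\rangle$ is non-elementary and there are pairwise disjoint or tangent circles $C_A$, $C_N$, $C_B$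 on $\widehat{\mathbb C}$ (Euclidean circles, or lines together with $\infty$) passing through $a,a'$, through $n,n'$, and through $b,b'$ respectively, such that none of the three separates the other two. A subgroup $G\subset PSL(2,\mathbb C)$ is a *non-separating disjoint circle (nsdc) group* if $G=\langle A,B\rangle$ for some marked nsdc pair $(A,B)$. For $\lambda\in\mathbb C$ let $G_\lambda\subset PSL(2,\mathbb C)$ be the subgroup generated by the classes of $$S=\begin{pmatrix}1&0\\1&1\end{pmatrix},\qquad T_\lambda=\begin{pmatrix}1&2\lambda\\0&1\end{pmatrix}.$$ **Statement.** 1. For all $\lambda\in\mathbb C$ and $\omega\in\mathbb R$ with $\lambda=|\lambda|e^{i\omega}$, the group $G_\lambda$ is an nsdc group if and only if $|\lambda|\,(1+|\cos\omega|)\ge4$. 2. The topological boundary in $\mathbb C$ of $\{\lambda\in\mathbb C: G_\lambda\text{ is an nsdc group}\}$ is the set of all $\lambda=|\lambda|e^{i\omega}$ with $|\lambda|(1+|\cos\omega|)=4$; it is also the set of all $\lambda=x+iy$ with $y^2=16-8|x|$. 3. Let $S,T\in SL(2,\mathbb C)$ with $\operatorname{tr}S=\operatorname{tr}T=2$, and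 let $G\subset PSL(2,\mathbb C)$ be the subgroup generated by their classes. Then $G$ is an nsdc group if and only if $$|\operatorname{tr}(ST)-2|+|\operatorname{Re}(\operatorname{tr}(ST)-2)|\ge8,$$ and if this inequality holds, then $G$ is discrete. -/

import Mathlib

noncomputable section

namespace TwoParabolic

/-! ### Möbius transformations of the Riemann sphere -/

abbrev SL2C : Type := Matrix.SpecialLinearGroup (Fin 2) ℂ

abbrev PSL2C : Type := Matrix.ProjectiveSpecialLinearGroup (Fin 2) ℂ

/-- The class of a matrix in `PSL(2, ℂ) = SL(2, ℂ) / {± 1}`. -/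
def toPSL : SL2C →* PSL2C := QuotientGroup.mk' (Subgroup.center SL2C)

/-- The quotient topology on `PSL(2, ℂ)`. -/
instance instTopPSL2C : TopologicalSpace PSL2C :=
  inferInstanceAs (TopologicalSpace (SL2C ⧸ Subgroup.center SL2C))

/-- The Riemann sphere `ℂ ∪ {∞}`. -/
abbrev Sphere : Type := OnePoint ℂ

/-- `PSL(2, ℂ)` acts on the Riemann sphere by Möbius transformations: the action on the complex
projective line, transported along the identification of that line with `ℂ ∪ {∞}`. -/
instance instActPSL2C : MulAction PSL2C Sphere :=
  (OnePoint.equivProjectivization ℂ).mulAction PSL2C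

/-- The action is the usual one, the one which Mathlib has for `GL(2, ℂ)`. -/
theorem toPSL_smul (g : SL2C) (z : Sphere) :
    toPSL g • z = (g : Matrix.GeneralLinearGroup (Fin 2) ℂ) • z := rfl

/-- It sends `z` to `(a z + b) / (c z + d)`, and to `∞` where the denominator vanishes. -/
theorem toPSL_smul_coe (g : SL2C) (z : ℂ) :
    toPSL g • (z : Sphere) =
      if g 1 0 * z + g 1 1 = 0 then OnePoint.infty
      else (((g 0 0 * z + g 0 1) / (g 1 0 * z + g 1 1) : ℂ) : Sphere) := by
  rw [toPSL_smul, OnePoint.smul_some_eq_ite]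
  rfl

theorem toPSL_smul_infty (g : SL2C) :
    toPSL g • (OnePoint.infty : Sphere) =
      if g 1 0 = 0 then OnePoint.infty else ((g 0 0 / g 1 0 : ℂ) : Sphere) := by
  rw [toPSL_smul, OnePoint.smul_infty_eq_ite]
  rfl

/-! ### Elementary groups -/

/-- The extension of the Möbius transformation of a matrix in `SL(2, ℂ)` to the upper half-space
`{(z, t) | z ∈ ℂ, t > 0}`, the isometry with `g` as its action on the boundary. -/
def halfSpaceMap (g : SL2C) (p : ℂ × ℝ) : ℂ × ℝ :=
  let N : ℝ := ‖g 1 0 * p.1 + g 1 1‖ ^ 2 + ‖g 1 0‖ ^ 2 * p.2 ^ 2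
  (((g 0 0 * p.1 + g 0 1) * star (g 1 0 * p.1 + g 1 1)
      + g 0 0 * star (g 1 0) * ((p.2 : ℂ)) ^ 2) / (N : ℂ),
    p.2 / N)

/-- A subgroup of `PSL(2, ℂ)` is elementary if it has a finite orbit in the closed hyperbolic space,
that is, either on the sphere at infinity or in the upper half-space. -/
def IsElementary (G : Subgroup PSL2C) : Prop :=
  (∃ z : Sphere, {w : Sphere | ∃ g ∈ G, w = g • z}.Finite) ∨
  (∃ p : ℂ × ℝ, 0 < p.2 ∧ {q : ℂ × ℝ | ∃ g : SL2C, toPSL g ∈ G ∧ q = halfSpaceMap g p}.Finite)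

/-! ### Half-turns, axes, perpendiculars and ortho-ends

A hyperbolic line is given by its ends on the sphere; a line whose two ends coincide is improper. -/

/-- `h` is the half-turn about the proper line with ends `x` and `y`, the transformation
of order two which fixes `x` and `y`. -/
def IsHalfTurn (h : PSL2C) (x y : Sphere) : Prop :=
  x ≠ y ∧ h ≠ 1 ∧ h * h = 1 ∧ h • x = x ∧ h • y = y

/-- The line with ends `u`, `v` is the axis of `A`: its ends are the fixed points of `A`. It is
improper, `u = v`, when `A` is parabolic, and does not exist when `A = 1`. -/
def IsAxis (A : PSL2C) (u v : Sphere) : Prop :=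
  {z : Sphere | A • z = z} = {u, v}

/-- The proper line with ends `x`, `y` is perpendicular to the line with ends `u`, `v`: the half-turn
about the first reverses the second. When `u ≠ v` this says that the lines meet at a right angle;
when `u = v` it says that `u` is one of the ends `x`, `y`, which is what perpendicularity to an
improper line means. -/
def IsPerp (x y u v : Sphere) : Prop :=
  ∃ h : PSL2C, IsHalfTurn h x y ∧ h • u = v

/-- `(a, a', n, n', b, b')` is the ortho-end of the ordered pair `A`, `B`: the line `[n, n']` is the
common perpendicular of the axes of `A` and `B`, and `A`, `B` are the products of the half-turns
about `[a, a']`, respectively `[b, b']`, with the half-turn about `[n, n']`. -/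
structure IsOrthoEnd (A B : PSL2C) (a a' n n' b b' : Sphere) : Prop where
  perp_left : ∃ u v, IsAxis A u v ∧ IsPerp n n' u v
  perp_right : ∃ u v, IsAxis B u v ∧ IsPerp n n' u v
  factor : ∃ hA hN hB : PSL2C, IsHalfTurn hA a a' ∧ IsHalfTurn hN n n' ∧ IsHalfTurn hB b b' ∧
    A = hA * hN ∧ B = hB * hN

/-! ### Non-separating disjoint circles -/

/-- A circle on the Riemann sphere: a Euclidean circle of positive radius, or a Euclidean line
together with `∞`. -/
def IsCircle (C : Set Sphere) : Prop :=
  (∃ (c : ℂ) (r : ℝ), 0 < r ∧ C = (fun z : ℂ => (z : Sphere)) '' Metric.sphere c r) ∨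
  (∃ p v : ℂ, v ≠ 0 ∧
    C = insert OnePoint.infty ((fun z : ℂ => (z : Sphere)) '' {z | ∃ t : ℝ, z = p + t * v}))

/-- Two circles on the sphere are disjoint or tangent if they have at most one common point
(so a circle is not tangent to itself). -/
def DisjointOrTangent (C D : Set Sphere) : Prop := (C ∩ D).Subsingleton

/-- The circle `C` separates `D` from `E`: no connected subset of its complement meets both. -/
def Separates (C D E : Set Sphere) : Prop :=
  ¬ ∃ P : Set Sphere, IsPreconnected P ∧ P ⊆ Cᶜ ∧ (P ∩ D).Nonempty ∧ (P ∩ E).Nonempty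

/-- The non-separating disjoint circle property of six points on the sphere. -/
def HasNSDCProperty (a a' n n' b b' : Sphere) : Prop :=
  a ≠ a' ∧ n ≠ n' ∧ b ≠ b' ∧
  ∃ CA CN CB : Set Sphere, IsCircle CA ∧ IsCircle CN ∧ IsCircle CB ∧
    a ∈ CA ∧ a' ∈ CA ∧ n ∈ CN ∧ n' ∈ CN ∧ b ∈ CB ∧ b' ∈ CB ∧
    DisjointOrTangent CA CN ∧ DisjointOrTangent CN CB ∧ DisjointOrTangent CA CB ∧
    ¬ Separates CA CN CB ∧ ¬ Separates CN CA CB ∧ ¬ Separates CB CA CN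

/-- The ordered pair `A`, `B` generates a marked non-separating disjoint circle group. -/
def IsMarkedNSDC (A B : PSL2C) : Prop :=
  ¬ IsElementary (Subgroup.closure {A, B}) ∧
  ∃ a a' n n' b b' : Sphere, IsOrthoEnd A B a a' n n' b b' ∧ HasNSDCProperty a a' n n' b b'

/-- `G` is a non-separating disjoint circle group: it is one for some pair of generators. -/
def IsNSDC (G : Subgroup PSL2C) : Prop :=
  ∃ A B : PSL2C, Subgroup.closure {A, B} = G ∧ IsMarkedNSDC A B

/-! ### Groups with two parabolic generators -/

def matS : SL2C := ⟨!![1, 0; 1, 1], by simp [Matrix.det_fin_two]⟩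

def matT (lam : ℂ) : SL2C := ⟨!![1, 2 * lam; 0, 1], by simp [Matrix.det_fin_two]⟩

/-- The subgroup of `PSL(2, ℂ)` generated by the classes of two matrices. -/
def generatedBy (S T : SL2C) : Subgroup PSL2C := Subgroup.closure {toPSL S, toPSL T}

/-- The group `G_λ = ⟨S, T_λ⟩`. -/
def groupG (lam : ℂ) : Subgroup PSL2C := generatedBy matS (matT lam)

end TwoParabolic

end

/-!
Circles on the sphere are the null sets of indefinite Hermitian forms on `ℂ²`, and such a form
also chooses a side. For a marked nsdc pair the sides can be chosen so that the three circles
bound disjoint discs and the three half-turns play ping-pong with them: the half-turns generate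
a discrete free product of three groups of order two, and `⟨A, B⟩` is its subgroup of words of
even length.

Suppose that `⟨S, T⟩` is nsdc with `S`, `T` parabolic. A parabolic element of the even subgroup
is conjugate to a power of the product of two half-turns whose circles touch at its fixed point.
Algebra in the free product, with ping-pong once more, shows that two such elements which
generate the even subgroup are, up to inversion, simultaneously conjugate to `s_a s_n` and
`s_b s_n`. One may therefore take `S`, `T` themselves to be products of half-turns with one
common factor, and after conjugation `S = matS`, `T = matT λ` with `λ = (tr (S T) - 2) / 2`. Then
the three circles pass through `0` and `2`, `0` and `∞`, `λ` and `∞`, and they touch in pairs.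
The line through `0` has the circle through `0`, `2` on one side, and the parallel line through
`λ` must not meet this circle twice; for a suitable direction this is possible exactly when
`4 ≤ |λ| + Re λ`. Inverting a generator changes the sign of `λ`, which accounts for the absolute
value.
-/

noncomputable section

namespace TwoParabolic

/-! ### Free products of groups of order two -/

open Classical in
/-- The Coxeter matrix with no relations besides `i * i = 1`; the entry `0` stands for `∞`. -/
def freeCoxeterMatrix (ι : Type*) : CoxeterMatrix ι where
  M i j := if i = j then 1 else 0
  isSymm := Matrix.IsSymm.ext fun i j => by simp only [eq_comm]
  diagonal i := by simp
  off_diagonal i j h := by simp [h]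

/-- The free product of groups of order two, one for each element of `ι`. -/
abbrev FreeInvolutions (ι : Type*) : Type _ := (freeCoxeterMatrix ι).Group

/-- The free product of groups of order two as a Coxeter group. -/
def freeCoxeterSystem (ι : Type*) : CoxeterSystem (freeCoxeterMatrix ι) (FreeInvolutions ι) :=
  (freeCoxeterMatrix ι).toCoxeterSystem

local notation "σ" => CoxeterSystem.simple (freeCoxeterSystem _)
local notation "π" => CoxeterSystem.wordProd (freeCoxeterSystem _)

section FreeInvolutions

variable {ι G : Type*} [Group G]

/-- The homomorphism which sends the generators to given involutions. -/
def liftInvolutions (h : ι → G) (hh : ∀ i, h i * h i = 1) : FreeInvolutions ι →* G :=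
  (freeCoxeterSystem ι).lift ⟨h, fun i j => by
    by_cases hij : i = j <;> simp [freeCoxeterMatrix, hij, hh]⟩

@[simp] theorem liftInvolutions_simple (h : ι → G) (hh : ∀ i, h i * h i = 1) (i : ι) :
    liftInvolutions h hh (σ i) = h i :=
  (freeCoxeterSystem ι).lift_apply_simple _ i

theorem range_liftInvolutions (h : ι → G) (hh : ∀ i, h i * h i = 1) :
    (liftInvolutions h hh).range = Subgroup.closure (Set.range h) := by
  rw [MonoidHom.range_eq_map, ← (freeCoxeterSystem ι).subgroup_closure_range_simple,
    MonoidHom.map_closure, ← Set.range_comp]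
  congr 2
  ext i
  simp

theorem exists_isChain_wordProd_eq (w : FreeInvolutions ι) :
    ∃ l : List ι, l.IsChain (· ≠ ·) ∧ π l = w := by
  induction w using (freeCoxeterSystem ι).simple_induction_left with
  | one => exact ⟨[], .nil, CoxeterSystem.wordProd_nil _⟩
  | mul_simple_left w i ih =>
    obtain ⟨l, hl, rfl⟩ := ih
    rcases l with _ | ⟨j, l⟩
    · exact ⟨[i], .singleton i, CoxeterSystem.wordProd_cons _ _ _⟩
    · by_cases hij : i = j
      · refine ⟨l, (List.isChain_cons.1 hl).2, ?_⟩
        rw [CoxeterSystem.wordProd_cons, hij, CoxeterSystem.simple_mul_simple_cancel_left]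
      · exact ⟨i :: j :: l, List.isChain_cons_cons.2 ⟨hij, hl⟩, CoxeterSystem.wordProd_cons _ _ _⟩

theorem isChain_ne_reverse {l : List ι} (hl : l.IsChain (· ≠ ·)) : l.reverse.IsChain (· ≠ ·) :=
  List.isChain_reverse.2 (hl.imp fun _ _ => Ne.symm)

/-! ### Ping-pong -/

section PingPong

variable {X : Type*} [MulAction G X] {h : ι → G} {D E : ι → Set X} {z : X}

/-- Involutions `h i` play ping-pong on sets `D i`, `E i`, as half-turns do which map the outside
`E i` of a disc into the disc `D i`. -/
structure IsPingPong (h : ι → G) (D E : ι → Set X) (z : X) : Prop where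
  mul_self : ∀ i, h i * h i = 1
  smul_mem : ∀ i, ∀ x ∈ E i, h i • x ∈ D i
  subset : ∀ ⦃i j⦄, i ≠ j → D j ⊆ E i
  disjoint : ∀ i, Disjoint (D i) (E i)
  base_mem : ∀ i, z ∈ E i

namespace IsPingPong

theorem lift_wordProd_smul_mem (H : IsPingPong h D E z) {l : List ι} (hl : l.IsChain (· ≠ ·))
    (hne : l ≠ []) {x : X} (hx : x ∈ E (l.getLast hne)) :
    liftInvolutions h H.mul_self (π l) • x ∈ D (l.head hne) := by
  induction l with
  | nil => exact absurd rfl hne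
  | cons i l ih =>
    rw [CoxeterSystem.wordProd_cons, map_mul, mul_smul, liftInvolutions_simple]
    refine H.smul_mem i _ ?_
    rcases l with _ | ⟨j, l⟩
    · simpa using hx
    · rw [List.isChain_cons_cons] at hl
      exact H.subset hl.1 (ih hl.2 (by simp) (by simpa using hx))

theorem lift_injective (H : IsPingPong h D E z) :
    Function.Injective (liftInvolutions h H.mul_self) := by
  rw [injective_iff_map_eq_one]
  intro w hw
  obtain ⟨l, hl, rfl⟩ := exists_isChain_wordProd_eq w
  by_contra hne
  have hnil : l ≠ [] := fun h0 => hne (by simp [h0])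
  have hD := H.lift_wordProd_smul_mem hl hnil (H.base_mem _)
  rw [hw, one_smul] at hD
  exact Set.disjoint_left.1 (H.disjoint _) hD (H.base_mem _)

theorem exists_smul_mem (H : IsPingPong h D E z) {x : G}
    (hx : x ∈ Subgroup.closure (Set.range h)) (hx1 : x ≠ 1) : ∃ i, x • z ∈ D i := by
  rw [← range_liftInvolutions h H.mul_self] at hx
  obtain ⟨w, rfl⟩ := hx
  obtain ⟨l, hl, rfl⟩ := exists_isChain_wordProd_eq w
  have hnil : l ≠ [] := fun h0 => hx1 (by simp [h0])
  exact ⟨_, H.lift_wordProd_smul_mem hl hnil (H.base_mem _)⟩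

theorem lift_wordProd_inv_smul_mem (H : IsPingPong h D E z) {l : List ι}
    (hl : l.IsChain (· ≠ ·)) (hne : l ≠ []) {x : X} (hx : x ∈ E (l.head hne)) :
    (liftInvolutions h H.mul_self (π l))⁻¹ • x ∈ D (l.getLast hne) := by
  rw [← map_inv, ← CoxeterSystem.wordProd_reverse, ← List.head_reverse (by simpa using hne)]
  exact H.lift_wordProd_smul_mem (isChain_ne_reverse hl) _ (by simpa using hx)

theorem sumElim_conj (H : IsPingPong h D E z) {w : G} {a b : ι}
    (hw : ∀ x ∈ E a, w • x ∈ D b) (hw' : ∀ x ∈ E b, w⁻¹ • x ∈ D a)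
    (hz : ∀ c ≠ a, w⁻¹ • h b • z ∈ E c) :
    IsPingPong (Sum.elim (fun c : {c // c ≠ b} => h c) fun c : {c // c ≠ a} => w * h c * w⁻¹)
      (Sum.elim (fun c => D c) fun c => {x | w⁻¹ • x ∈ D c})
      (Sum.elim (fun c => E c) fun c => {x | w⁻¹ • x ∈ E c}) (h b • z) where
  mul_self := by
    rintro (c | c)
    · exact H.mul_self c
    · simp [mul_assoc, ← mul_assoc (h c), H.mul_self]
  smul_mem := by
    rintro (c | c) x hx
    · exact H.smul_mem c x hx
    · simpa [mul_smul] using H.smul_mem c _ hx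
  subset := by
    rintro (c | c) (d | d) hcd x hx
    · exact H.subset (by simpa [Subtype.coe_inj] using hcd) hx
    · have hxD : w • w⁻¹ • x ∈ D b := hw _ (H.subset d.2.symm hx)
      rw [smul_inv_smul] at hxD
      exact H.subset c.2 hxD
    · exact H.subset c.2 (hw' x (H.subset d.2.symm hx))
    · exact H.subset (by simpa [Subtype.coe_inj] using hcd) hx
  disjoint := by
    rintro (c | c)
    · exact H.disjoint c
    · exact (H.disjoint c).preimage _
  base_mem := by
    rintro (c | c)
    · exact H.subset c.2 (H.smul_mem b z (H.base_mem b))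
    · exact hz c c.2

/-- The involutions other than the first letter of a reduced word `w`, together with the conjugates
by `w` of those other than the last letter, play ping-pong themselves. -/
theorem notMem_closure_conj (H : IsPingPong h D E z) {l : List ι} (hl : l.IsChain (· ≠ ·))
    (hne : l ≠ []) {w : G} (hw : w = liftInvolutions h H.mul_self (π l)) :
    h (l.head hne) ∉ Subgroup.closure
      (h '' {l.head hne}ᶜ ∪ (fun c => w * h c * w⁻¹) '' {l.getLast hne}ᶜ) := by
  set b := l.head hne with hb
  set a := l.getLast hne with ha
  have hfwd : ∀ x ∈ E a, w • x ∈ D b := fun x hx => hw ▸ H.lift_wordProd_smul_mem hl hne hx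
  have hbwd : ∀ x ∈ E b, w⁻¹ • x ∈ D a := fun x hx => hw ▸ H.lift_wordProd_inv_smul_mem hl hne hx
  have hbase : ∀ c ≠ a, w⁻¹ • h b • z ∈ E c := by
    intro c hc
    obtain ⟨i, l, rfl⟩ := List.exists_cons_of_ne_nil hne
    have hcancel : w⁻¹ • h b • z = (liftInvolutions h H.mul_self (π l))⁻¹ • z := by
      rw [hw, CoxeterSystem.wordProd_cons, map_mul, liftInvolutions_simple, hb, List.head_cons,
        mul_inv_rev, mul_smul, inv_smul_smul]
    rw [hcancel]
    rcases eq_or_ne l [] with rfl | hl'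
    · simpa using H.base_mem c
    · have hD := H.lift_wordProd_inv_smul_mem (List.isChain_cons.1 hl).2 hl' (H.base_mem _)
      exact H.subset (by simpa [ha, List.getLast_cons hl'] using hc) hD
  have hzD {c : ι} : z ∉ D c := fun hz => Set.disjoint_left.1 (H.disjoint c) hz (H.base_mem c)
  have hb1 : h b ≠ 1 := fun h1 => by
    have hD := H.smul_mem b z (H.base_mem b)
    rw [h1, one_smul] at hD
    exact hzD hD
  intro hmem
  rw [Set.image_eq_range, Set.image_eq_range, ← Set.Sum.elim_range] at hmem
  obtain ⟨c | c, hc⟩ := (H.sumElim_conj hfwd hbwd hbase).exists_smul_mem hmem hb1 <;>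
    rw [← mul_smul, H.mul_self, one_smul] at hc
  · exact hzD hc
  · have hD := hfwd _ (H.subset (Ne.symm c.2) hc)
    rw [smul_inv_smul] at hD
    exact hzD hD

end IsPingPong

end PingPong

end FreeInvolutions

/-! ### Words of even length -/

section Even

variable {ι : Type*}

/-- The subgroup of products of an even number of generators. -/
def evenSubgroup (ι : Type*) : Subgroup (FreeInvolutions ι) :=
  (freeCoxeterSystem ι).lengthParity.ker

instance : (evenSubgroup ι).Normal := MonoidHom.normal_ker _

theorem simple_notMem_even (i : ι) : σ i ∉ evenSubgroup ι := by
  rw [evenSubgroup, MonoidHom.mem_ker, CoxeterSystem.lengthParity_simple]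
  decide

theorem simple_mul_simple_mem_even (i j : ι) : σ i * σ j ∈ evenSubgroup ι := by
  rw [evenSubgroup, MonoidHom.mem_ker, map_mul, CoxeterSystem.lengthParity_simple,
    CoxeterSystem.lengthParity_simple]
  decide

theorem mem_even_or_mul_simple_mem {K : Subgroup (FreeInvolutions ι)} {n : ι}
    (hK : ∀ i, σ i * σ n ∈ K) (w : FreeInvolutions ι) : w ∈ K ∨ w * σ n ∈ K := by
  induction w using (freeCoxeterSystem ι).simple_induction_right with
  | one => exact .inl (one_mem K)
  | mul_simple_right w i ih =>
    rcases ih with hw | hw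
    · exact .inr (by simpa only [mul_assoc] using mul_mem hw (hK i))
    · refine .inl ?_
      have h := mul_mem hw (inv_mem (hK i))
      rwa [mul_inv_rev, CoxeterSystem.inv_simple, CoxeterSystem.inv_simple, ← mul_assoc,
        CoxeterSystem.simple_mul_simple_cancel_right] at h

theorem closure_simple_mul_simple (n : ι) :
    Subgroup.closure (Set.range fun i => σ i * σ n) = evenSubgroup ι := by
  have hle : Subgroup.closure (Set.range fun i => σ i * σ n) ≤ evenSubgroup ι := by
    rw [Subgroup.closure_le]
    rintro _ ⟨i, rfl⟩
    exact simple_mul_simple_mem_even i n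
  refine le_antisymm hle fun w hw => ?_
  refine (mem_even_or_mul_simple_mem (n := n)
    (fun i => Subgroup.subset_closure (Set.mem_range_self i)) w).resolve_right fun hwn => ?_
  exact simple_notMem_even n ((Subgroup.mul_mem_cancel_left _ hw).1 (hle hwn))

/-- The homomorphism which counts the letters of a word modulo two, with weights `f`. -/
def weight (f : ι → ZMod 2) : FreeInvolutions ι →* Multiplicative (ZMod 2) :=
  liftInvolutions (fun i => Multiplicative.ofAdd (f i)) fun i => by
    rw [← ofAdd_add, CharTwo.add_self_eq_zero, ofAdd_zero]

@[simp] theorem weight_simple (f : ι → ZMod 2) (i : ι) :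
    weight f (σ i) = Multiplicative.ofAdd (f i) :=
  liftInvolutions_simple _ _ i

theorem eq_of_weight_eq_one {f : ι → ZMod 2} {S : Set (FreeInvolutions ι)}
    (hS : Subgroup.closure S = evenSubgroup ι) (hf : ∀ x ∈ S, weight f x = 1) (i j : ι) :
    f i = f j := by
  have hle : evenSubgroup ι ≤ (weight f).ker := hS ▸ (Subgroup.closure_le _).2 hf
  have hij := hle (simple_mul_simple_mem_even i j)
  rwa [MonoidHom.mem_ker, map_mul, weight_simple, weight_simple, ← ofAdd_add, ofAdd_eq_one,
    CharTwo.add_eq_zero] at hij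

theorem simple_mul_zpow (i j : ι) (m : ℤ) :
    σ i * (σ i * σ j) ^ m = (σ i * σ j) ^ (-m) * σ i := by
  have h : SemiconjBy (σ i) (σ i * σ j) (σ i * σ j)⁻¹ := by
    simp [SemiconjBy, mul_assoc]
  rw [(h.zpow_right m).eq, inv_zpow']

theorem exists_wordProd_eq_zpow {i j : ι} {l : List ι} (hl : ∀ c ∈ l, c = i ∨ c = j) :
    ∃ m : ℤ, π l = (σ i * σ j) ^ m ∨ π l = (σ i * σ j) ^ m * σ i := by
  induction l with
  | nil => exact ⟨0, by simp⟩
  | cons c l ih =>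
    obtain ⟨m, hm⟩ := ih fun d hd => hl d (List.mem_cons_of_mem _ hd)
    obtain ⟨k, hk⟩ : ∃ k : ℤ, σ c * (σ i * σ j) ^ m = (σ i * σ j) ^ k * σ i := by
      rcases hl c List.mem_cons_self with rfl | rfl
      · exact ⟨-m, simple_mul_zpow _ _ _⟩
      · refine ⟨-(1 + m), ?_⟩
        rw [← simple_mul_zpow, zpow_one_add]
        simp [mul_assoc]
    rcases hm with hm | hm <;> refine ⟨k, ?_⟩ <;> rw [CoxeterSystem.wordProd_cons, hm]
    · exact .inr hk
    · rw [← mul_assoc, hk, CoxeterSystem.simple_mul_simple_cancel_right]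
      exact .inl rfl

theorem exists_wordProd_eq_zpow_of_mem_even {i j : ι} {l : List ι}
    (hl : ∀ c ∈ l, c = i ∨ c = j) (heven : π l ∈ evenSubgroup ι) :
    ∃ m : ℤ, π l = (σ i * σ j) ^ m := by
  obtain ⟨m, hm | hm⟩ := exists_wordProd_eq_zpow hl
  · exact ⟨m, hm⟩
  · rw [hm, Subgroup.mul_mem_cancel_left _ (zpow_mem (simple_mul_simple_mem_even i j) m)] at heven
    exact absurd heven (simple_notMem_even i)

theorem exists_cycleChain_eq_conj {w : FreeInvolutions ι} (hw : w ∈ evenSubgroup ι) :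
    ∃ (u : FreeInvolutions ι) (l : List ι), (l : Cycle ι).Chain (· ≠ ·) ∧ w = u * π l * u⁻¹ := by
  classical
  obtain ⟨l, hl, rfl⟩ := exists_isChain_wordProd_eq w
  induction l using List.bidirectionalRec with
  | nil => exact ⟨1, [], .nil _, by simp⟩
  | singleton i => exact absurd (by simpa using hw) (simple_notMem_even i)
  | cons_append i l k ih =>
    by_cases hik : k = i
    · subst hik
      have hconj : π (k :: (l ++ [k])) = σ k * π l * (σ k)⁻¹ := by
        simp [CoxeterSystem.wordProd_cons, CoxeterSystem.wordProd_append, mul_assoc]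
      rw [hconj, (inferInstance : (evenSubgroup ι).Normal).mem_comm_iff] at hw
      obtain ⟨u, c, hc, h⟩ := ih hl.tail.left_of_append (by simpa using hw)
      exact ⟨σ k * u, c, hc, by rw [hconj, h]; group⟩
    · refine ⟨1, _, ?_, (by simp : _ = 1 * π (i :: (l ++ [k])) * 1⁻¹)⟩
      rw [Cycle.chain_coe_cons, ← List.cons_append]
      refine List.isChain_append.2 ⟨hl, .singleton i, ?_⟩
      rw [← List.cons_append, List.getLast?_concat]
      simpa using hik

end Even

/-! ### Pairs of conjugates which generate the even subgroup -/

section Conjugates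

variable {ι : Type*} {a n b : ι} {x y u v : FreeInvolutions ι}

/-- Killing all letters but `a`, up to identifying them, maps the group onto a dihedral group of
order `2 |m|` in which both generators become trivial. -/
theorem eq_one_or_eq_neg_one_of_closure_eq_even (han : a ≠ n) (hab : a ≠ b) {m k : ℤ}
    (hxy : Subgroup.closure {u * (σ a * σ n) ^ m * u⁻¹, v * (σ b * σ n) ^ k * v⁻¹} =
      evenSubgroup ι) : m = 1 ∨ m = -1 := by
  classical
  let δ : FreeInvolutions ι →* DihedralGroup m.natAbs :=
    liftInvolutions (fun i => DihedralGroup.sr (if i = a then 1 else 0)) fun i => by simp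
  have hδa : δ (σ a * σ n) = DihedralGroup.r (-1) := by simp [δ, han.symm]
  have hδb : δ (σ b * σ n) = 1 := by simp [δ, han.symm, hab.symm]
  have hm : ((m : ZMod m.natAbs)) = 0 := by
    rw [ZMod.intCast_zmod_eq_zero_iff_dvd, Int.natCast_natAbs, abs_dvd]
  have hker : evenSubgroup ι ≤ δ.ker := by
    rw [← hxy, Subgroup.closure_le]
    rintro _ (rfl | rfl)
    · simp [MonoidHom.mem_ker, hδa, hm]
    · simp [MonoidHom.mem_ker, hδb]
  have h1 : DihedralGroup.r (-1 : ZMod m.natAbs) = DihedralGroup.r 0 :=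
    hδa.symm.trans (hker (simple_mul_simple_mem_even a n))
  have hdvd : m ∣ 1 := by
    have h2 : ((-1 : ℤ) : ZMod m.natAbs) = 0 := by simpa using DihedralGroup.r.inj h1
    rw [ZMod.intCast_zmod_eq_zero_iff_dvd, Int.natCast_natAbs, abs_dvd] at h2
    simpa using h2
  exact Int.isUnit_iff.1 (isUnit_of_dvd_one hdvd)

theorem exists_suffix_wordProd_eq {P : Subgroup (FreeInvolutions ι)} (hP : ∀ i ≠ b, σ i ∈ P)
    (l : List ι) : ∃ m, m <:+ l ∧ (∀ hne : m ≠ [], m.head hne = b) ∧ ∃ α ∈ P, π l = α * π m := by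
  induction l with
  | nil => exact ⟨[], List.suffix_rfl, fun h => absurd rfl h, 1, one_mem P, by simp⟩
  | cons i l ih =>
    by_cases hib : i = b
    · exact ⟨i :: l, List.suffix_rfl, fun _ => hib, 1, one_mem P, by simp⟩
    · obtain ⟨m, hml, hm, α, hα, h⟩ := ih
      exact ⟨m, hml.trans (List.suffix_cons i l), hm, σ i * α, mul_mem (hP i hib) hα,
        by rw [CoxeterSystem.wordProd_cons, h, mul_assoc]⟩

theorem exists_prefix_wordProd_eq {Q : Subgroup (FreeInvolutions ι)} (hQ : ∀ i ≠ a, σ i ∈ Q)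
    (l : List ι) : ∃ m, m <+: l ∧ (∀ hne : m ≠ [], m.getLast hne = a) ∧ ∃ β ∈ Q, π l = π m * β := by
  obtain ⟨m, hml, hm, β, hβ, h⟩ := exists_suffix_wordProd_eq hQ l.reverse
  refine ⟨m.reverse, by simpa using hml.reverse, fun hne => ?_, β⁻¹, inv_mem hβ, ?_⟩
  · rw [List.getLast_reverse, hm]
  · rw [CoxeterSystem.wordProd_reverse] at h ⊢
    rw [← mul_inv_rev, ← h, inv_inv]

theorem exists_doubleCoset_wordProd_eq {P Q : Subgroup (FreeInvolutions ι)}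
    (hP : ∀ i ≠ b, σ i ∈ P) (hQ : ∀ i ≠ a, σ i ∈ Q) (w : FreeInvolutions ι) :
    ∃ m : List ι, m.IsChain (· ≠ ·) ∧ (∀ hne : m ≠ [], m.head hne = b ∧ m.getLast hne = a) ∧
      ∃ α ∈ P, ∃ β ∈ Q, w = α * π m * β := by
  obtain ⟨l, hl, rfl⟩ := exists_isChain_wordProd_eq w
  obtain ⟨l', hl', hhead, α, hα, h⟩ := exists_suffix_wordProd_eq hP l
  obtain ⟨m, hm, hlast, β, hβ, h'⟩ := exists_prefix_wordProd_eq hQ l'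
  have hchain : m.IsChain (· ≠ ·) := by
    obtain ⟨t, rfl⟩ := hm
    exact (hl.suffix hl').left_of_append
  refine ⟨m, hchain, fun hne => ⟨?_, hlast hne⟩, α, hα, β, hβ, ?_⟩
  · rw [hm.head hne, hhead]
  · rw [h, h', mul_assoc]

/-- The pairs `{z, z⁻¹}`, rather than the cyclic groups they generate, keep track of the fact that
generators are carried to generators. -/
theorem simple_mem_normalizer {i j c : ι} (hc : c = i ∨ c = j) :
    σ c ∈ Subgroup.normalizer ({σ i * σ j, (σ i * σ j)⁻¹} : Set (FreeInvolutions ι)) := by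
  have hswap : σ c * (σ i * σ j) * (σ c)⁻¹ = (σ i * σ j)⁻¹ := by
    rcases hc with rfl | rfl <;> simp [mul_assoc]
  have hswap' : σ c * (σ i * σ j)⁻¹ * (σ c)⁻¹ = σ i * σ j := by
    rw [← conj_inv, hswap, inv_inv]
  rw [Subgroup.mem_normalizer_iff_conj_image_eq, Set.image_pair, MulAut.conj_apply,
    MulAut.conj_apply, hswap, hswap', Set.pair_comm]

variable {G X : Type*} [Group G] [MulAction G X] {h : ι → G} {D E : ι → Set X} {z : X}

theorem IsPingPong.simple_notMem_closure_conj (H : IsPingPong h D E z) {l : List ι}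
    (hl : l.IsChain (· ≠ ·)) (hne : l ≠ []) :
    σ (l.head hne) ∉ Subgroup.closure
      (σ '' {l.head hne}ᶜ ∪ (fun c => π l * σ c * (π l)⁻¹) '' {l.getLast hne}ᶜ) := by
  intro hmem
  have hmap := Subgroup.mem_map_of_mem (liftInvolutions h H.mul_self) hmem
  rw [MonoidHom.map_closure, Set.image_union, Set.image_image, Set.image_image,
    liftInvolutions_simple] at hmap
  simp only [map_mul, map_inv, liftInvolutions_simple] at hmap
  exact H.notMem_closure_conj hl hne rfl hmap

theorem IsPingPong.eq_nil_of_closure_eq_even (H : IsPingPong h D E z)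
    (han : a ≠ n) (hnb : n ≠ b) (hab : a ≠ b) {l : List ι} (hl : l.IsChain (· ≠ ·))
    (hends : ∀ hne : l ≠ [], l.head hne = b ∧ l.getLast hne = a)
    (hx : x ∈ ({σ a * σ n, (σ a * σ n)⁻¹} : Set _))
    (hy : y ∈ ({σ b * σ n, (σ b * σ n)⁻¹} : Set _))
    (hxy : Subgroup.closure {x, π l * y * (π l)⁻¹} = evenSubgroup ι) : l = [] := by
  by_contra hne
  obtain ⟨hhead, hlast⟩ := hends hne
  refine H.simple_notMem_closure_conj hl hne ?_
  rw [hhead, hlast]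
  set K := Subgroup.closure (σ '' {b}ᶜ ∪ (fun c => π l * σ c * (π l)⁻¹) '' {a}ᶜ)
  have hσ {c : ι} (hc : c ≠ b) : σ c ∈ K := Subgroup.subset_closure (.inl ⟨c, hc, rfl⟩)
  have hπ {c : ι} (hc : c ≠ a) : σ c ∈ K.comap (MulAut.conj (π l)).toMonoidHom :=
    Subgroup.subset_closure (.inr ⟨c, hc, rfl⟩)
  have hxK : x ∈ K := Set.pair_subset (mul_mem (hσ hab) (hσ hnb))
    (inv_mem (mul_mem (hσ hab) (hσ hnb))) hx
  have hyK : π l * y * (π l)⁻¹ ∈ K := Set.pair_subset (mul_mem (hπ hab.symm) (hπ han.symm))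
    (inv_mem (mul_mem (hπ hab.symm) (hπ han.symm))) hy
  have hbn : σ b * σ n ∈ K := (Subgroup.closure_le K).2 (Set.pair_subset hxK hyK)
    (hxy ▸ simple_mul_simple_mem_even b n)
  exact (Subgroup.mul_mem_cancel_right _ (hσ hnb)).1 hbn

theorem IsPingPong.exists_conj_mem_pair (H : IsPingPong h D E z)
    (hι : ∀ i, i = a ∨ i = n ∨ i = b) (han : a ≠ n) (hnb : n ≠ b) (hab : a ≠ b)
    (hxy : Subgroup.closure {x, y} = evenSubgroup ι) {m k : ℤ}
    (hx : x = u * (σ a * σ n) ^ m * u⁻¹) (hy : y = v * (σ b * σ n) ^ k * v⁻¹) :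
    ∃ g, g⁻¹ * x * g ∈ ({σ a * σ n, (σ a * σ n)⁻¹} : Set _) ∧
      g⁻¹ * y * g ∈ ({σ b * σ n, (σ b * σ n)⁻¹} : Set _) := by
  set A : Set (FreeInvolutions ι) := {σ a * σ n, (σ a * σ n)⁻¹}
  set B : Set (FreeInvolutions ι) := {σ b * σ n, (σ b * σ n)⁻¹}
  have hxA : u⁻¹ * x * u ∈ A := by
    have hm := eq_one_or_eq_neg_one_of_closure_eq_even han hab (hx ▸ hy ▸ hxy)
    rcases hm with rfl | rfl <;> simp [A, hx, mul_assoc]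
  have hyB : v⁻¹ * y * v ∈ B := by
    rw [Set.pair_comm] at hxy
    have hk := eq_one_or_eq_neg_one_of_closure_eq_even hnb.symm hab.symm (hx ▸ hy ▸ hxy)
    rcases hk with rfl | rfl <;> simp [B, hy, mul_assoc]
  obtain ⟨l, hl, hends, α, hα, β, hβ, huv⟩ :=
    exists_doubleCoset_wordProd_eq (P := Subgroup.normalizer A) (Q := Subgroup.normalizer B)
      (fun i hi => simple_mem_normalizer ((or_assoc.2 (hι i)).resolve_right hi))
      (fun i hi => simple_mem_normalizer ((hι i).resolve_left hi).symm) (u⁻¹ * v)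
  have hxα : α⁻¹ * (u⁻¹ * x * u) * α ∈ A := (Subgroup.mem_set_normalizer_iff''.1 hα _).1 hxA
  have hyβ : β * (v⁻¹ * y * v) * β⁻¹ ∈ B := (Subgroup.mem_set_normalizer_iff.1 hβ _).1 hyB
  have hxg : (u * α)⁻¹ * x * (u * α) = α⁻¹ * (u⁻¹ * x * u) * α := by group
  have hyg : (u * α)⁻¹ * y * (u * α) = π l * (β * (v⁻¹ * y * v) * β⁻¹) * (π l)⁻¹ := by
    rw [eq_mul_of_inv_mul_eq huv]
    group
  have hl_nil : l = [] := by
    refine H.eq_nil_of_closure_eq_even han hnb hab hl hends hxα hyβ ?_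
    have hconj := Subgroup.Normal.map_conj_eq (H := evenSubgroup ι) (u * α)⁻¹
    rw [← hxy, MonoidHom.map_closure, Set.image_pair, hxy] at hconj
    rw [← hxg, ← hyg]
    simpa only [MonoidHom.coe_coe, MulAut.conj_apply, inv_inv] using hconj
  refine ⟨u * α, hxg ▸ hxα, ?_⟩
  rwa [hyg, hl_nil, CoxeterSystem.wordProd_nil, inv_one, mul_one, one_mul]

end Conjugates

open Complex Matrix Filter Topology
open scoped ComplexConjugate Pointwise

/-! ### Hermitian forms and circles -/

/-- The Hermitian form `a |x|² + 2 Re (b x ȳ) + c |y|²` on `ℂ²`. The indefinite ones are, up to a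
real factor, the circles on the sphere together with a choice of side. -/
@[ext] structure HermForm where
  a : ℝ
  c : ℝ
  b : ℂ

namespace HermForm

/-- The value `Q(v, v)` of a Hermitian form. -/
def eval (Q : HermForm) (v : Fin 2 → ℂ) : ℝ :=
  Q.a * normSq (v 0) + 2 * (Q.b * v 0 * conj (v 1)).re + Q.c * normSq (v 1)

/-- The sesquilinear form `Q(v, w)`, linear in `v`. -/
def polar (Q : HermForm) (v w : Fin 2 → ℂ) : ℂ :=
  Q.a * v 0 * conj (w 0) + Q.b * v 0 * conj (w 1) + conj Q.b * v 1 * conj (w 0)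
    + Q.c * v 1 * conj (w 1)

/-- Minus the determinant of a Hermitian form; the form is indefinite when this is positive. -/
def disc (Q : HermForm) : ℝ := normSq Q.b - Q.a * Q.c

/-- A real multiple of a Hermitian form. -/
def scale (t : ℝ) (Q : HermForm) : HermForm := ⟨t * Q.a, t * Q.c, t * Q.b⟩

/-- The pull-back of a Hermitian form by a matrix. -/
def comap (g : SL2C) (Q : HermForm) : HermForm :=
  ⟨Q.eval ![g 0 0, g 1 0], Q.eval ![g 0 1, g 1 1], Q.polar ![g 0 0, g 1 0] ![g 0 1, g 1 1]⟩

theorem eval_smul_add_smul (Q : HermForm) (x y : ℂ) (e f : Fin 2 → ℂ) :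
    Q.eval (x • e + y • f) =
      normSq x * Q.eval e + normSq y * Q.eval f + 2 * (x * conj y * Q.polar e f).re := by
  simp only [eval, polar, Pi.add_apply, Pi.smul_apply, smul_eq_mul, normSq_apply, mul_re, mul_im,
    add_re, add_im, conj_re, conj_im, ofReal_re, ofReal_im]
  ring

theorem eval_smul (Q : HermForm) (x : ℂ) (e : Fin 2 → ℂ) :
    Q.eval (x • e) = normSq x * Q.eval e := by
  simpa using Q.eval_smul_add_smul x 0 e e

theorem eval_add_smul (Q : HermForm) (t : ℝ) (e f : Fin 2 → ℂ) :
    Q.eval (e + (t : ℂ) • f) = Q.eval e + t ^ 2 * Q.eval f + 2 * t * (Q.polar e f).re := by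
  have h := Q.eval_smul_add_smul 1 t e f
  simp only [one_smul, map_one, normSq_ofReal, one_mul, conj_ofReal, re_ofReal_mul] at h
  rw [h]
  ring

theorem eval_scale (Q : HermForm) (t : ℝ) (e : Fin 2 → ℂ) :
    (Q.scale t).eval e = t * Q.eval e := by
  simp only [eval, scale, mul_re, mul_im, conj_re, conj_im, ofReal_re, ofReal_im]
  ring

theorem disc_scale (Q : HermForm) (t : ℝ) : (Q.scale t).disc = t ^ 2 * Q.disc := by
  simp only [disc, scale, normSq_apply, mul_re, mul_im, ofReal_re, ofReal_im]
  ring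

theorem continuous_eval (Q : HermForm) : Continuous Q.eval := by
  unfold eval
  have := continuous_normSq
  have := Complex.continuous_re
  have := Complex.continuous_conj
  fun_prop

end HermForm

theorem mulVec_zero_apply (g : SL2C) (v : Fin 2 → ℂ) :
    (g.1 *ᵥ v) 0 = g 0 0 * v 0 + g 0 1 * v 1 := by
  simp [Matrix.mulVec, dotProduct, Fin.sum_univ_two]

theorem mulVec_one_apply (g : SL2C) (v : Fin 2 → ℂ) :
    (g.1 *ᵥ v) 1 = g 1 0 * v 0 + g 1 1 * v 1 := by
  simp [Matrix.mulVec, dotProduct, Fin.sum_univ_two]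

theorem mul_sub_mul_eq_one (g : SL2C) : g 0 0 * g 1 1 - g 0 1 * g 1 0 = 1 := by
  rw [← Matrix.det_fin_two, g.2]

theorem mul_mulVec (g h : SL2C) (v : Fin 2 → ℂ) : (g * h).1 *ᵥ v = g.1 *ᵥ (h.1 *ᵥ v) := by
  rw [Matrix.mulVec_mulVec, ← Matrix.SpecialLinearGroup.coe_mul]

namespace HermForm

theorem eval_comap (g : SL2C) (Q : HermForm) (v : Fin 2 → ℂ) :
    (Q.comap g).eval v = Q.eval (g.1 *ᵥ v) := by
  have hv : g.1 *ᵥ v = v 0 • ![g 0 0, g 1 0] + v 1 • ![g 0 1, g 1 1] := by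
    ext i
    fin_cases i
    · simp [mulVec_zero_apply, mul_comm]
    · simp [mulVec_one_apply, mul_comm]
  rw [hv, eval_smul_add_smul, mul_comm (v 0 * _), ← mul_assoc]
  simp only [comap, eval]
  ring

theorem disc_comap (g : SL2C) (Q : HermForm) : (Q.comap g).disc = Q.disc := by
  have h : (Q.comap g).disc = Q.disc * normSq (g 0 0 * g 1 1 - g 0 1 * g 1 0) := by
    simp only [disc, comap, eval, polar, normSq_apply, mul_re, mul_im, add_re, add_im, sub_re,
      sub_im, conj_re, conj_im, ofReal_re, ofReal_im, Matrix.cons_val_zero, Matrix.cons_val_one]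
    ring
  rw [h, mul_sub_mul_eq_one, map_one, mul_one]

end HermForm

/-- The determinant of two vectors of `ℂ²`. -/
def cross (e f : Fin 2 → ℂ) : ℂ := e 0 * f 1 - e 1 * f 0

theorem cross_smul_right (e f : Fin 2 → ℂ) (x : ℂ) : cross e (x • f) = x * cross e f := by
  simp only [cross, Pi.smul_apply, smul_eq_mul]
  ring

theorem cross_self (e : Fin 2 → ℂ) : cross e e = 0 := by
  rw [cross, mul_comm, sub_self]

theorem cross_swap (e f : Fin 2 → ℂ) : cross f e = -cross e f := by
  simp only [cross]
  ring

theorem exists_eq_smul_add_smul {e f : Fin 2 → ℂ} (h : cross e f ≠ 0) (v : Fin 2 → ℂ) :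
    ∃ x y : ℂ, v = x • e + y • f := by
  refine ⟨cross v f / cross e f, cross e v / cross e f, ?_⟩
  have cramer : cross e f • v = cross v f • e + cross e v • f := by
    ext i
    fin_cases i <;> simp [cross] <;> ring
  rw [div_eq_inv_mul, div_eq_inv_mul, mul_smul, mul_smul, ← smul_add, ← cramer, smul_smul,
    inv_mul_cancel₀ h, one_smul]

theorem exists_eq_smul_of_cross_eq_zero {e v : Fin 2 → ℂ} (he : e ≠ 0) (h : cross e v = 0) :
    ∃ x : ℂ, v = x • e := by
  have key (i j : Fin 2) : e i * v j = v i * e j := by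
    have h' : e 0 * v 1 = e 1 * v 0 := sub_eq_zero.1 h
    fin_cases i <;> fin_cases j <;> simp [h', mul_comm]
  obtain ⟨i, hi⟩ := Function.ne_iff.1 he
  refine ⟨v i / e i, funext fun j => ?_⟩
  rw [Pi.smul_apply, smul_eq_mul, div_mul_eq_mul_div, eq_div_iff hi, ← key i j, mul_comm]

theorem HermForm.normSq_polar_sub (Q : HermForm) (v w : Fin 2 → ℂ) :
    normSq (Q.polar v w) - Q.eval v * Q.eval w = Q.disc * normSq (cross v w) := by
  simp only [polar, eval, disc, cross, normSq_apply, mul_re, mul_im, sub_re, sub_im, add_re,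
    add_im, conj_re, conj_im, ofReal_re, ofReal_im]
  ring

theorem HermForm.polar_ne_zero {Q : HermForm} (hQ : 0 < Q.disc) {v w : Fin 2 → ℂ}
    (hv : Q.eval v = 0) (hvw : cross v w ≠ 0) : Q.polar v w ≠ 0 := by
  intro h0
  have h := Q.normSq_polar_sub v w
  rw [h0, hv, map_zero, zero_mul, sub_zero] at h
  exact (mul_pos hQ (normSq_pos.2 hvw)).ne h

/-- A vector spanning the complex line which a point of the sphere stands for. -/
def vec : Sphere → Fin 2 → ℂ
  | none => ![1, 0]
  | some z => ![z, 1]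

@[simp] theorem vec_infty : vec OnePoint.infty = ![1, 0] := rfl

@[simp] theorem vec_coe (z : ℂ) : vec (z : Sphere) = ![z, 1] := rfl

theorem vec_ne_zero (z : Sphere) : vec z ≠ 0 := by
  induction z using OnePoint.rec with
  | infty => exact fun h => one_ne_zero (congrFun h 0)
  | coe z => exact fun h => one_ne_zero (congrFun h 1)

theorem cross_vec_eq_zero_iff {z w : Sphere} : cross (vec z) (vec w) = 0 ↔ z = w := by
  refine ⟨fun h => ?_, fun h => h ▸ cross_self _⟩
  induction z using OnePoint.rec <;> induction w using OnePoint.rec <;>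
    simp_all [cross, sub_eq_zero]

theorem exists_eq_smul_vec {v : Fin 2 → ℂ} (hv : v ≠ 0) :
    ∃ (z : Sphere) (c : ℂ), c ≠ 0 ∧ v = c • vec z := by
  by_cases h1 : v 1 = 0
  · refine ⟨OnePoint.infty, v 0, fun h0 => hv ?_, ?_⟩
    · ext i; fin_cases i <;> simp [h0, h1]
    · ext i; fin_cases i <;> simp [h1]
  · refine ⟨((v 0 / v 1 : ℂ) : Sphere), v 1, h1, ?_⟩
    ext i; fin_cases i <;> simp [mul_div_cancel₀ _ h1]

theorem mulVec_ne_zero (g : SL2C) {v : Fin 2 → ℂ} (hv : v ≠ 0) : g.1 *ᵥ v ≠ 0 := fun h => hv <| by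
  rw [← one_mulVec v, ← Matrix.SpecialLinearGroup.coe_one, ← inv_mul_cancel g, mul_mulVec, h,
    mulVec_zero]

theorem exists_mulVec_vec_eq (g : SL2C) (z : Sphere) :
    ∃ c : ℂ, c ≠ 0 ∧ g.1 *ᵥ vec z = c • vec (toPSL g • z) := by
  suffices h : ∃ c : ℂ, g.1 *ᵥ vec z = c • vec (toPSL g • z) by
    obtain ⟨c, hc⟩ := h
    refine ⟨c, fun h0 => mulVec_ne_zero g (vec_ne_zero z) ?_, hc⟩
    rw [hc, h0, zero_smul]
  induction z using OnePoint.rec with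
  | infty =>
    rw [toPSL_smul_infty]
    split_ifs with h
    · exact ⟨g 0 0, by ext i; fin_cases i <;> simp [mulVec_zero_apply, mulVec_one_apply, h]⟩
    · refine ⟨g 1 0, ?_⟩
      ext i; fin_cases i <;> simp [mulVec_zero_apply, mulVec_one_apply, mul_div_cancel₀ _ h]
  | coe z =>
    rw [toPSL_smul_coe]
    split_ifs with h
    · refine ⟨g 0 0 * z + g 0 1, ?_⟩
      ext i; fin_cases i <;> simp [mulVec_zero_apply, mulVec_one_apply, h]
    · refine ⟨g 1 0 * z + g 1 1, ?_⟩
      ext i; fin_cases i <;> simp [mulVec_zero_apply, mulVec_one_apply, mul_div_cancel₀ _ h]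

theorem toPSL_smul_eq_iff {g : SL2C} {z w : Sphere} :
    toPSL g • z = w ↔ ∃ c : ℂ, g.1 *ᵥ vec z = c • vec w := by
  obtain ⟨c, hc, h⟩ := exists_mulVec_vec_eq g z
  refine ⟨fun hz => ⟨c, hz ▸ h⟩, fun ⟨d, hd⟩ => cross_vec_eq_zero_iff.1 ?_⟩
  have h0 : c * cross (vec w) (vec (toPSL g • z)) = 0 := by
    rw [← cross_smul_right, ← h, hd, cross_smul_right, cross_self, mul_zero]
  rw [cross_swap, (mul_eq_zero.1 h0).resolve_left hc, neg_zero]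

theorem toPSL_surjective : Function.Surjective toPSL := QuotientGroup.mk'_surjective _

theorem toPSL_eq_one_iff (g : SL2C) : toPSL g = 1 ↔ g = 1 ∨ g = -1 := by
  have : toPSL g = 1 ↔ g ∈ Subgroup.center SL2C := QuotientGroup.eq_one_iff g
  rw [this, Matrix.SpecialLinearGroup.mem_center_iff]
  constructor
  · rintro ⟨r, hr, h⟩
    rcases sq_eq_one_iff.1 (by simpa only [Fintype.card_fin] using hr) with rfl | rfl
    · left; ext i j; rw [← h]; simp
    · right; ext i j; rw [← h]; fin_cases i <;> fin_cases j <;> simp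
  · rintro (rfl | rfl)
    · exact ⟨1, by simp, by simp⟩
    · exact ⟨-1, by simp, by ext i j; fin_cases i <;> fin_cases j <;> simp⟩

theorem toPSL_eq_iff (g h : SL2C) : toPSL g = toPSL h ↔ g = h ∨ g = -h := by
  rw [← mul_inv_eq_one, ← map_inv, ← map_mul, toPSL_eq_one_iff, mul_inv_eq_one,
    mul_inv_eq_iff_eq_mul, neg_one_mul]

namespace HermForm

/-- The value of a form at a point of the sphere; only its sign is independent of the vector chosen
to represent the point. -/
def evalAt (Q : HermForm) (z : Sphere) : ℝ := Q.eval (vec z)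

/-- The circle defined by a form, when the form is indefinite. -/
def zeros (Q : HermForm) : Set Sphere := {z | Q.evalAt z = 0}

theorem exists_eval_mulVec_eq (Q : HermForm) (g : SL2C) (z : Sphere) :
    ∃ r : ℝ, 0 < r ∧ Q.eval (g.1 *ᵥ vec z) = r * Q.evalAt (toPSL g • z) := by
  obtain ⟨c, hc, h⟩ := exists_mulVec_vec_eq g z
  exact ⟨normSq c, normSq_pos.2 hc, by rw [h, eval_smul, evalAt]⟩

theorem evalAt_coe (Q : HermForm) (z : ℂ) :
    Q.evalAt z = Q.a * normSq z + 2 * (Q.b * z).re + Q.c := by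
  simp [evalAt, eval]

theorem evalAt_infty (Q : HermForm) : Q.evalAt OnePoint.infty = Q.a := by
  simp [evalAt, eval]

theorem zeros_scale (Q : HermForm) {t : ℝ} (ht : t ≠ 0) : (Q.scale t).zeros = Q.zeros := by
  ext z
  simp [zeros, evalAt, eval_scale, ht]

/-- The form of the Euclidean circle with centre `z` and radius `r`. -/
def ofSphere (z : ℂ) (r : ℝ) : HermForm := ⟨1, normSq z - r ^ 2, -conj z⟩

/-- The form of the line through `p` in the direction of `v`. -/
def ofLine (p v : ℂ) : HermForm := ⟨0, -2 * (I * conj v * p).re, I * conj v⟩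

theorem disc_ofSphere (z : ℂ) (r : ℝ) : (ofSphere z r).disc = r ^ 2 := by
  simp [disc, ofSphere]

theorem disc_ofLine (p v : ℂ) : (ofLine p v).disc = normSq v := by
  simp [disc, ofLine]

theorem evalAt_ofSphere (c : ℂ) (r : ℝ) (z : ℂ) :
    (ofSphere c r).evalAt z = normSq (z - c) - r ^ 2 := by
  simp only [evalAt_coe, ofSphere, normSq_apply, neg_re, mul_re, neg_im, conj_re, conj_im,
    sub_re, sub_im]
  ring

theorem zeros_ofSphere (c : ℂ) {r : ℝ} (hr : 0 ≤ r) :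
    (ofSphere c r).zeros = (fun z : ℂ => (z : Sphere)) '' Metric.sphere c r := by
  ext z
  induction z using OnePoint.rec with
  | infty => simp [zeros, evalAt_infty, ofSphere]
  | coe z =>
    have hmem : (z : Sphere) ∈ (fun z : ℂ => (z : Sphere)) '' Metric.sphere c r ↔
        ‖z - c‖ = r := by
      simp
    rw [hmem, zeros, Set.mem_ofPred_eq, evalAt_ofSphere, sub_eq_zero, normSq_eq_norm_sq,
      sq_eq_sq₀ (norm_nonneg _) hr]

theorem zeros_ofLine (p : ℂ) {v : ℂ} (hv : v ≠ 0) :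
    (ofLine p v).zeros =
      insert OnePoint.infty ((fun z : ℂ => (z : Sphere)) '' {z | ∃ t : ℝ, z = p + t * v}) := by
  ext z
  induction z using OnePoint.rec with
  | infty => simp [zeros, evalAt_infty, ofLine]
  | coe z =>
    have hz : (ofLine p v).evalAt z = -2 * (conj v * (z - p)).im := by
      simp only [evalAt_coe, ofLine, mul_re, mul_im, I_re, I_im, conj_re, conj_im, sub_re, sub_im]
      ring
    have hmem : (z : Sphere) ∈ insert OnePoint.infty
        ((fun z : ℂ => (z : Sphere)) '' {z | ∃ t : ℝ, z = p + t * v}) ↔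
          ∃ t : ℝ, z = p + t * v := by
      simp
    have hv' : conj v ≠ 0 := (map_ne_zero _).2 hv
    rw [hmem, zeros, Set.mem_ofPred_eq, hz, mul_eq_zero, or_iff_right (by norm_num)]
    constructor
    · intro him
      refine ⟨(conj v * (z - p)).re / normSq v, ?_⟩
      have hre : ((conj v * (z - p)).re : ℂ) = conj v * (z - p) := by
        apply Complex.ext <;> simp only [ofReal_re, ofReal_im, him]
      rw [ofReal_div, hre, normSq_eq_conj_mul_self]
      field_simp
      ring
    · rintro ⟨t, rfl⟩
      rw [add_sub_cancel_left, mul_left_comm, ← normSq_eq_conj_mul_self, ← ofReal_mul, ofReal_im]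

theorem isCircle_zeros {Q : HermForm} (h : 0 < Q.disc) : IsCircle Q.zeros := by
  by_cases ha : Q.a = 0
  · have hb : Q.b ≠ 0 := fun hb => by simp [disc, ha, hb] at h
    have hQ : Q = ofLine (-(Q.c / 2 : ℝ) / Q.b) (I * conj Q.b) := by
      ext
      · exact ha
      · simp [ofLine, ← mul_assoc, mul_div_cancel₀ _ hb]
        ring
      · simp [ofLine, ← mul_assoc]
    refine Or.inr ⟨_, I * conj Q.b, by simpa using hb, hQ ▸ zeros_ofLine _ ?_⟩
    simpa using hb
  · have hr : 0 < √Q.disc / |Q.a| := by positivity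
    have hQ : Q = (ofSphere (-conj Q.b / Q.a) (√Q.disc / |Q.a|)).scale Q.a := by
      ext
      · simp [ofSphere, scale]
      · simp only [scale, ofSphere, div_pow, sq_abs, Real.sq_sqrt h.le, map_div₀, normSq_neg,
          normSq_conj, normSq_ofReal]
        field_simp
        rw [disc]
        ring
      · have : (Q.a : ℂ) ≠ 0 := ofReal_ne_zero.2 ha
        simp [ofSphere, scale, mul_div_cancel₀ _ this]
    refine Or.inl ⟨-conj Q.b / Q.a, _, hr, ?_⟩
    rw [← zeros_ofSphere _ hr.le, ← zeros_scale (ofSphere _ _) ha, ← hQ]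

end HermForm

theorem isCircle_iff_exists_zeros {C : Set Sphere} :
    IsCircle C ↔ ∃ Q : HermForm, 0 < Q.disc ∧ C = Q.zeros := by
  constructor
  · rintro (⟨c, r, hr, rfl⟩ | ⟨p, v, hv, rfl⟩)
    · exact ⟨.ofSphere c r, by rw [HermForm.disc_ofSphere]; positivity,
        (HermForm.zeros_ofSphere c hr.le).symm⟩
    · exact ⟨.ofLine p v, by rwa [HermForm.disc_ofLine, normSq_pos],
        (HermForm.zeros_ofLine p hv).symm⟩
  · rintro ⟨Q, hQ, rfl⟩
    exact HermForm.isCircle_zeros hQ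

/-! ### Parabolic transformations -/

section Parabolic

variable {M : SL2C}

theorem exists_cross_ne_zero {v : Fin 2 → ℂ} (hv : v ≠ 0) : ∃ w, cross v w ≠ 0 := by
  contrapose! hv
  have h0 := hv ![0, 1]
  have h1 := hv ![1, 0]
  simp only [cross, cons_val_zero, cons_val_one, mul_one, mul_zero, sub_zero, zero_sub,
    neg_eq_zero] at h0 h1
  ext i
  fin_cases i
  · exact h0
  · exact h1

theorem mulVec_sub_of_trace_eq_two (hM : M.1.trace = 2) (v : Fin 2 → ℂ) :
    M.1 *ᵥ (M.1 *ᵥ v - v) = M.1 *ᵥ v - v := by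
  have hdet := mul_sub_mul_eq_one M
  have h11 : M 1 1 = 2 - M 0 0 := by
    rw [trace_fin_two] at hM
    linear_combination hM
  rw [h11] at hdet
  ext i
  fin_cases i <;>
    simp only [Fin.zero_eta, Fin.mk_one, mulVec_zero_apply, mulVec_one_apply, Pi.sub_apply, h11]
  · linear_combination (-v 0) * hdet
  · linear_combination (-v 1) * hdet

theorem pow_mulVec_of_trace_eq_two (hM : M.1.trace = 2) (v : Fin 2 → ℂ) (n : ℕ) :
    (M ^ n).1 *ᵥ v = v + (n : ℂ) • (M.1 *ᵥ v - v) := by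
  induction n with
  | zero => simp
  | succ n ih =>
    rw [pow_succ', mul_mulVec, ih, mulVec_add, mulVec_smul, mulVec_sub_of_trace_eq_two hM]
    push_cast
    rw [add_smul, one_smul]
    abel

theorem eq_one_of_mulVec_eq {v w : Fin 2 → ℂ} (hv : M.1 *ᵥ v = v) (hw : M.1 *ᵥ w = w)
    (hvw : cross v w ≠ 0) : M = 1 := by
  refine Subtype.ext (Matrix.ext_of_mulVec_single fun i => ?_)
  obtain ⟨x, y, hxy⟩ := exists_eq_smul_add_smul hvw (Pi.single i 1)
  rw [hxy, mulVec_add, mulVec_smul, mulVec_smul, hv, hw]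
  exact (one_mulVec _).symm

theorem exists_mulVec_sub_ne_zero (h1 : M ≠ 1) : ∃ v, M.1 *ᵥ v - v ≠ 0 := by
  by_contra! h
  exact h1 (eq_one_of_mulVec_eq (sub_eq_zero.1 (h ![1, 0])) (sub_eq_zero.1 (h ![0, 1]))
    (by simp [cross]))

theorem mulVec_eq_of_trace_eq_two (hM : M.1.trace = 2) {v : Fin 2 → ℂ} (hv : v ≠ 0) {c : ℂ}
    (hc : M.1 *ᵥ v = c • v) : M.1 *ᵥ v = v := by
  have h : ((c - 1) * (c - 1)) • v = 0 := by
    have hsub : M.1 *ᵥ v - v = (c - 1) • v := by rw [hc, sub_smul, one_smul]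
    have h := mulVec_sub_of_trace_eq_two hM v
    rw [hsub, mulVec_smul, hc, smul_smul, ← sub_eq_zero, ← sub_smul] at h
    rwa [mul_sub_one]
  have hc1 : c = 1 := sub_eq_zero.1 (mul_self_eq_zero.1 ((smul_eq_zero_iff_left hv).1 h))
  rw [hc, hc1, one_smul]

/-- The element `g` of `PSL(2, ℂ)` is parabolic and fixes the point `p`. -/
def IsParabolicAt (g : PSL2C) (p : Sphere) : Prop :=
  ∃ M : SL2C, toPSL M = g ∧ M.1.trace = 2 ∧ M ≠ 1 ∧ g • p = p

theorem trace_mul_mul_inv (M g : SL2C) : (g * M * g⁻¹).1.trace = M.1.trace := by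
  calc (g * M * g⁻¹).1.trace = (g⁻¹ * (g * M)).1.trace := Matrix.trace_mul_comm (g * M).1 (g⁻¹).1
    _ = M.1.trace := by rw [inv_mul_cancel_left]

theorem trace_inv (M : SL2C) : (M⁻¹).1.trace = M.1.trace := by
  rw [SpecialLinearGroup.SL2_inv_expl, trace_fin_two, trace_fin_two]
  exact add_comm _ _

namespace IsParabolicAt

variable {g : PSL2C} {p : Sphere}

theorem smul_eq (h : IsParabolicAt g p) : g • p = p := h.choose_spec.2.2.2

theorem conj_smul (h : IsParabolicAt g p) (k : PSL2C) : IsParabolicAt (k * g * k⁻¹) (k • p) := by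
  obtain ⟨M, rfl, ht, h1, hp⟩ := h
  obtain ⟨K, rfl⟩ := toPSL_surjective k
  refine ⟨K * M * K⁻¹, by simp, by rw [trace_mul_mul_inv, ht], ?_, ?_⟩
  · rwa [Ne, conj_eq_one_iff]
  · rw [mul_smul, mul_smul, inv_smul_smul, hp]

theorem inv (h : IsParabolicAt g p) : IsParabolicAt g⁻¹ p := by
  obtain ⟨M, rfl, ht, h1, hp⟩ := h
  exact ⟨M⁻¹, map_inv _ _, (trace_inv M).trans ht, inv_ne_one.2 h1, inv_smul_eq_iff.2 hp.symm⟩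

theorem ne_one (h : IsParabolicAt g p) : g ≠ 1 := by
  obtain ⟨M, rfl, ht, h1, -⟩ := h
  intro h
  obtain rfl := ((toPSL_eq_one_iff M).1 h).resolve_left h1
  norm_num [trace_fin_two] at ht

theorem of_trace (ht : M.1.trace = 2) (h1 : M ≠ 1) : ∃ p, IsParabolicAt (toPSL M) p := by
  obtain ⟨v, hv⟩ := exists_mulVec_sub_ne_zero h1
  obtain ⟨p, c, hc, hp⟩ := exists_eq_smul_vec hv
  refine ⟨p, M, rfl, ht, h1, toPSL_smul_eq_iff.2 ⟨1, ?_⟩⟩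
  have hfix := mulVec_sub_of_trace_eq_two ht v
  rw [hp, mulVec_smul] at hfix
  rw [one_smul]
  exact smul_right_injective _ hc hfix

theorem evalAt_nonpos (hg : IsParabolicAt g p) (Q : HermForm) {z : Sphere} (hz : g • z ≠ z)
    (h : ∀ n : ℕ, Q.evalAt (g ^ (n + 1) • z) ≤ 0) : Q.evalAt p ≤ 0 := by
  obtain ⟨M, rfl, ht, h1, hp⟩ := hg
  set u := M.1 *ᵥ vec z - vec z with hu
  have hlim : Tendsto (fun n : ℕ => Q.eval (((n + 1 : ℕ) : ℂ)⁻¹ • vec z + u)) atTop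
      (𝓝 (Q.eval u)) := by
    have h0 : Tendsto (fun n : ℕ => ((n + 1 : ℕ) : ℂ)⁻¹ • vec z + u) atTop
        (𝓝 ((0 : ℂ) • vec z + u)) :=
      (((tendsto_inv_atTop_nhds_zero_nat (𝕜 := ℂ)).comp (tendsto_add_atTop_nat 1)).smul_const
        _).add_const _
    rw [zero_smul, zero_add] at h0
    exact (Q.continuous_eval.tendsto u).comp h0
  have hneg (n : ℕ) : Q.eval (((n + 1 : ℕ) : ℂ)⁻¹ • vec z + u) ≤ 0 := by
    have hn : ((n + 1 : ℕ) : ℂ) ≠ 0 := Nat.cast_ne_zero.2 n.succ_ne_zero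
    obtain ⟨r, hr, he⟩ := Q.exists_eval_mulVec_eq (M ^ (n + 1)) z
    have hle : Q.eval (vec z + ((n + 1 : ℕ) : ℂ) • u) ≤ 0 := by
      rw [hu, ← pow_mulVec_of_trace_eq_two ht, he, map_pow]
      exact mul_nonpos_of_nonneg_of_nonpos hr.le (h n)
    have hscale : ((n + 1 : ℕ) : ℂ)⁻¹ • vec z + u =
        ((n + 1 : ℕ) : ℂ)⁻¹ • (vec z + ((n + 1 : ℕ) : ℂ) • u) := by
      rw [smul_add, inv_smul_smul₀ hn]
    rw [hscale, HermForm.eval_smul]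
    exact mul_nonpos_of_nonneg_of_nonpos (normSq_nonneg _) hle
  rw [toPSL_smul_eq_iff] at hp
  obtain ⟨c, hc⟩ := hp
  have hcross : cross (vec p) u = 0 := by
    by_contra hne
    exact h1 (eq_one_of_mulVec_eq (mulVec_eq_of_trace_eq_two ht (vec_ne_zero p) hc)
      (mulVec_sub_of_trace_eq_two ht _) hne)
  obtain ⟨x, hx⟩ := exists_eq_smul_of_cross_eq_zero (vec_ne_zero p) hcross
  have hu0 : u ≠ 0 := fun h0 =>
    hz (toPSL_smul_eq_iff.2 ⟨1, by rw [one_smul]; exact sub_eq_zero.1 h0⟩)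
  have hx0 : x ≠ 0 := by
    rintro rfl
    exact hu0 (by rw [hx, zero_smul])
  have hle := le_of_tendsto' hlim hneg
  rw [hx, HermForm.eval_smul] at hle
  exact nonpos_of_mul_nonpos_right hle (normSq_pos.2 hx0)

end IsParabolicAt

end Parabolic

/-! ### Systems of half-turns -/

theorem IsCircle.infinite {C : Set Sphere} (hC : IsCircle C) : C.Infinite := by
  rcases hC with ⟨c, r, hr, rfl⟩ | ⟨p, v, hv, rfl⟩
  · have hconn : IsPreconnected (Metric.sphere c r) :=
      isPreconnected_sphere (by rw [Complex.rank_real_complex]; exact Nat.one_lt_ofNat) c r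
    refine (hconn.infinite_of_nontrivial ?_).image (OnePoint.coe_injective.injOn)
    refine ⟨c + r, by simp [hr.le], c - r, by simp [hr.le], fun h => hr.ne' ?_⟩
    have h2 : (2 * r : ℂ) = 0 := by linear_combination h
    simpa using h2
  · refine Set.Infinite.mono (Set.subset_insert _ _) (Set.Infinite.image
      OnePoint.coe_injective.injOn (Set.infinite_of_injective_forall_mem
        (f := fun t : ℝ => p + t * v) (fun s t hst => ?_) fun t => ⟨t, rfl⟩))
    simpa [hv] using hst

theorem HermForm.polar_smul_right (Q : HermForm) (v w : Fin 2 → ℂ) (c : ℂ) :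
    Q.polar v (c • w) = conj c * Q.polar v w := by
  simp only [polar, Pi.smul_apply, smul_eq_mul, map_mul]
  ring

theorem HermForm.eventually_pos_re_polar_mul_eval (Q : HermForm) {v w : Fin 2 → ℂ}
    (hv : Q.eval v = 0) (h : (Q.polar v w).re ≠ 0) :
    ∀ᶠ t : ℝ in 𝓝[>] 0, 0 < (Q.polar v w).re * Q.eval (v + (t : ℂ) • w) := by
  set m := (Q.polar v w).re with hm
  have hcont : Continuous fun t : ℝ => m * (t * Q.eval w + 2 * m) := by fun_prop
  have hlim : ∀ᶠ t : ℝ in 𝓝 0, 0 < m * (t * Q.eval w + 2 * m) :=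
    hcont.continuousAt.eventually (lt_mem_nhds (by
      have := mul_self_pos.2 h
      linarith))
  filter_upwards [nhdsWithin_le_nhds hlim, self_mem_nhdsWithin] with t ht ht0
  rw [Q.eval_add_smul, hv, ← hm]
  calc 0 < t * (m * (t * Q.eval w + 2 * m)) := mul_pos ht0 ht
    _ = _ := by ring

theorem exists_re_mul_neg {m n : ℂ} (h : ¬SameRay ℝ m (-n)) :
    ∃ c : ℂ, (c * m).re < 0 ∧ (c * n).re < 0 := by
  have hm : 0 < ‖m‖ := norm_pos_iff.2 fun h0 => h (h0 ▸ .zero_left _)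
  have hn : 0 < ‖n‖ := norm_pos_iff.2 fun h0 => h (by rw [h0, neg_zero]; exact .zero_right _)
  set s : ℂ := ‖n‖ * m + ‖m‖ * n with hs
  have hs0 : s ≠ 0 := by
    contrapose! h
    rw [sameRay_iff_norm_smul_eq, norm_neg, real_smul, real_smul]
    linear_combination -h
  have hm2 : m.re * m.re + m.im * m.im = ‖m‖ * ‖m‖ := by
    rw [← normSq_apply, normSq_eq_norm_sq, sq]
  have hn2 : n.re * n.re + n.im * n.im = ‖n‖ * ‖n‖ := by
    rw [← normSq_apply, normSq_eq_norm_sq, sq]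
  set d := ‖m‖ * ‖n‖ + (m.re * n.re + m.im * n.im) with hd
  have hpos : 0 < d := by
    have h2 : normSq s = 2 * (‖m‖ * ‖n‖) * d := by
      simp only [hs, hd, normSq_apply, add_re, add_im, re_ofReal_mul, im_ofReal_mul]
      linear_combination ‖n‖ ^ 2 * hm2 + ‖m‖ ^ 2 * hn2
    exact pos_of_mul_pos_right (h2 ▸ normSq_pos.2 hs0) (by positivity)
  refine ⟨-conj s, ?_, ?_⟩
  · have : (-conj s * m).re = -(‖m‖ * d) := by
      simp only [hs, hd, neg_mul, neg_re, mul_re, mul_im, conj_re, conj_im, add_re, add_im,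
        ofReal_re, ofReal_im]
      linear_combination -‖n‖ * hm2
    rw [this]
    exact neg_neg_of_pos (mul_pos hm hpos)
  · have : (-conj s * n).re = -(‖n‖ * d) := by
      simp only [hs, hd, neg_mul, neg_re, mul_re, mul_im, conj_re, conj_im, add_re, add_im,
        ofReal_re, ofReal_im]
      linear_combination -‖m‖ * hn2
    rw [this]
    exact neg_neg_of_pos (mul_pos hn hpos)

theorem HermForm.sameRay_polar_neg {P Q : HermForm}
    (hPQ : ∀ v, P.eval v < 0 → 0 ≤ Q.eval v) {v w : Fin 2 → ℂ} (hP : P.eval v = 0)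
    (hQ : Q.eval v = 0) : SameRay ℝ (P.polar v w) (-Q.polar v w) := by
  by_contra h
  obtain ⟨c, hcP, hcQ⟩ := exists_re_mul_neg h
  rw [← conj_conj c, ← HermForm.polar_smul_right] at hcP hcQ
  obtain ⟨t, htP, htQ⟩ := ((P.eventually_pos_re_polar_mul_eval hP hcP.ne).and
    (Q.eventually_pos_re_polar_mul_eval hQ hcQ.ne)).exists
  exact (neg_of_mul_pos_right htQ hcQ.le).not_ge (hPQ _ (neg_of_mul_pos_right htP hcP.le))

/-- A family of half-turns, each interchanging the two sides of a circle, such that the circles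
bound pairwise disjoint open discs and are pairwise disjoint or tangent. The disc of index `i` is
where `form i` is negative. -/
structure HalfTurnSystem (ι : Type*) where
  matrix : ι → SL2C
  form : ι → HermForm
  mul_self : ∀ i, matrix i * matrix i = -1
  eval_mulVec : ∀ i v, (form i).eval ((matrix i).1 *ᵥ v) = -(form i).eval v
  disc_pos : ∀ i, 0 < (form i).disc
  eval_pos : ∀ ⦃i j⦄, i ≠ j → ∀ v, (form i).eval v < 0 → 0 < (form j).eval v
  subsingleton_inter : ∀ ⦃i j⦄, i ≠ j → ((form i).zeros ∩ (form j).zeros).Subsingleton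

namespace HalfTurnSystem

variable {ι : Type*} (S : HalfTurnSystem ι)

/-- The half-turns of the system, as transformations of the sphere. -/
def halfTurn (i : ι) : PSL2C := toPSL (S.matrix i)

theorem halfTurn_mul_self (i : ι) : S.halfTurn i * S.halfTurn i = 1 := by
  rw [halfTurn, ← map_mul, S.mul_self, toPSL_eq_one_iff]
  exact Or.inr rfl

theorem halfTurn_smul_halfTurn_smul (i : ι) (z : Sphere) :
    S.halfTurn i • S.halfTurn i • z = z := by
  rw [← mul_smul, halfTurn_mul_self, one_smul]

/-- The open disc of index `i`. -/
def ball (i : ι) : Set Sphere := {z | (S.form i).evalAt z < 0}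

/-- The circle of index `i`. -/
def circle (i : ι) : Set Sphere := (S.form i).zeros

/-- The open disc complementary to that of index `i`. -/
def exterior (i : ι) : Set Sphere := {z | 0 < (S.form i).evalAt z}

theorem exists_evalAt_halfTurn_smul (i : ι) (z : Sphere) :
    ∃ r : ℝ, 0 < r ∧ r * (S.form i).evalAt (S.halfTurn i • z) = -(S.form i).evalAt z := by
  obtain ⟨r, hr, h⟩ := (S.form i).exists_eval_mulVec_eq (S.matrix i) z
  exact ⟨r, hr, h ▸ S.eval_mulVec i (vec z)⟩

theorem halfTurn_smul_mem_ball {i : ι} {z : Sphere} (hz : z ∈ S.exterior i) :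
    S.halfTurn i • z ∈ S.ball i := by
  obtain ⟨r, hr, h⟩ := S.exists_evalAt_halfTurn_smul i z
  exact neg_of_mul_neg_right (h ▸ neg_neg_of_pos hz) hr.le

theorem halfTurn_smul_mem_circle {i : ι} {z : Sphere} (hz : z ∈ S.circle i) :
    S.halfTurn i • z ∈ S.circle i := by
  obtain ⟨r, hr, h⟩ := S.exists_evalAt_halfTurn_smul i z
  rw [show (S.form i).evalAt z = 0 from hz, neg_zero] at h
  exact (mul_eq_zero.1 h).resolve_left hr.ne'

theorem isPingPong {z : Sphere} (hz : ∀ i, z ∈ S.exterior i) :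
    IsPingPong S.halfTurn S.ball S.exterior z where
  mul_self := S.halfTurn_mul_self
  smul_mem _ _ hx := S.halfTurn_smul_mem_ball hx
  subset _ _ hij _ hx := S.eval_pos hij.symm _ hx
  disjoint _ := Set.disjoint_left.2 fun _ => lt_asymm (α := ℝ)
  base_mem := hz

theorem nonneg_of_eval_eq_zero {i j : ι} (hij : i ≠ j) {v : Fin 2 → ℂ}
    (hv : (S.form i).eval v = 0) : 0 ≤ (S.form j).eval v :=
  le_of_not_gt fun h => (S.eval_pos hij.symm v h).ne' hv

theorem inter_circle_eq_empty {i j k : ι} (hij : i ≠ j) (hjk : j ≠ k) (hik : i ≠ k) :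
    S.circle i ∩ S.circle j ∩ S.circle k = ∅ := by
  rw [Set.eq_empty_iff_forall_notMem]
  rintro z ⟨⟨hi, hj⟩, hk⟩
  obtain ⟨w, hw⟩ := exists_cross_ne_zero (vec_ne_zero z)
  have hne {l : ι} (hl : z ∈ S.circle l) : (S.form l).polar (vec z) w ≠ 0 :=
    HermForm.polar_ne_zero (S.disc_pos l) hl hw
  have hray {l m : ι} (hlm : l ≠ m) (hl : z ∈ S.circle l) (hm : z ∈ S.circle m) :=
    HermForm.sameRay_polar_neg (w := w) (fun v hv => (S.eval_pos hlm v hv).le) hl hm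
  have hik' := (hray hij hi hj).trans (sameRay_neg_iff.1 (by simpa using hray hjk hj hk))
    fun h => absurd (neg_eq_zero.1 h) (hne hj)
  have hii := (hik'.trans (hray hik.symm hk hi)) fun h => absurd h (hne hk)
  exact hne hi (eq_zero_of_sameRay_self_neg hii)

section Finite

variable [Finite ι]

theorem exists_forall_mem_exterior : ∃ z, ∀ i, z ∈ S.exterior i := by
  cases isEmpty_or_nonempty ι
  · exact ⟨OnePoint.infty, isEmptyElim⟩
  obtain ⟨i⟩ := ‹Nonempty ι›
  have hfin : (⋃ j ∈ ({i}ᶜ : Set ι), S.circle i ∩ S.circle j).Finite :=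
    (Set.toFinite _).biUnion fun j hj => (S.subsingleton_inter (Ne.symm hj)).finite
  obtain ⟨p, hp, hpj⟩ :=
    ((HermForm.isCircle_zeros (S.disc_pos i)).infinite.sdiff hfin).nonempty
  obtain ⟨w, hw⟩ := exists_cross_ne_zero (vec_ne_zero p)
  set m := (S.form i).polar (vec p) w with hm
  have hre : 0 < ((S.form i).polar (vec p) (m • w)).re := by
    rw [HermForm.polar_smul_right, ← hm, ← normSq_eq_conj_mul_self, ofReal_re, normSq_pos]
    exact HermForm.polar_ne_zero (S.disc_pos i) hp hw
  have hi : ∀ᶠ t : ℝ in 𝓝[>] 0, 0 < (S.form i).eval (vec p + (t : ℂ) • m • w) := by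
    filter_upwards [(S.form i).eventually_pos_re_polar_mul_eval hp hre.ne'] with t ht
    exact pos_of_mul_pos_right ht hre.le
  have hj (j : ι) : ∀ᶠ t : ℝ in 𝓝[>] 0, 0 < (S.form j).eval (vec p + (t : ℂ) • m • w) := by
    rcases eq_or_ne j i with rfl | hji
    · exact hi
    have hpos : 0 < (S.form j).eval (vec p) :=
      (S.nonneg_of_eval_eq_zero hji.symm hp).lt_of_ne' fun h0 =>
        hpj (Set.mem_biUnion hji ⟨hp, h0⟩)
    have hcont : Continuous fun t : ℝ => (S.form j).eval (vec p + (t : ℂ) • m • w) :=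
      (S.form j).continuous_eval.comp (by fun_prop)
    exact nhdsWithin_le_nhds (hcont.continuousAt.eventually (lt_mem_nhds (by simpa using hpos)))
  obtain ⟨t, ht⟩ := (eventually_all.2 hj).exists
  obtain ⟨z, c, -, hz⟩ := exists_eq_smul_vec (v := vec p + (t : ℂ) • m • w) fun h0 => by
    have hpos := ht i
    rw [h0] at hpos
    simp [HermForm.eval] at hpos
  refine ⟨z, fun j => ?_⟩
  have hzj := ht j
  rw [hz, HermForm.eval_smul] at hzj
  exact pos_of_mul_pos_right hzj (normSq_nonneg c)

/-- If `z` lies outside all the discs, every nontrivial element moves `z` into one of them, while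
the elements close to `1` do not. -/
theorem discreteTopology {G : Subgroup PSL2C} (hG : G ≤ Subgroup.closure (Set.range S.halfTurn)) :
    DiscreteTopology G := by
  obtain ⟨z, hz⟩ := S.exists_forall_mem_exterior
  let U : Set SL2C := {g | ∀ i, 0 < (S.form i).eval (g.1 *ᵥ vec z)}
  have hU : IsOpen U := by
    simp only [U, Set.ofPred_forall]
    refine isOpen_iInter_of_finite fun i => isOpen_lt continuous_const ?_
    exact (S.form i).continuous_eval.comp
      ((continuous_subtype_val : Continuous fun g : SL2C => g.1).matrix_mulVec continuous_const)
  have h1U : (1 : SL2C) ∈ U := fun i => by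
    change 0 < (S.form i).eval ((1 : Matrix (Fin 2) (Fin 2) ℂ) *ᵥ vec z)
    rw [one_mulVec]
    exact hz i
  have hUG : ∀ M ∈ U, toPSL M ∈ G → toPSL M = 1 := fun M hM hMG => by
    by_contra hne
    obtain ⟨i, hi⟩ := (S.isPingPong hz).exists_smul_mem (hG hMG) hne
    obtain ⟨r, hr, h⟩ := (S.form i).exists_eval_mulVec_eq M z
    exact lt_asymm hi (pos_of_mul_pos_right (h ▸ hM i) hr.le)
  rw [discreteTopology_iff_isOpen_singleton_one]
  refine ⟨toPSL '' U, QuotientGroup.isOpenMap_coe U hU, Set.ext fun g => ⟨?_, ?_⟩⟩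
  · rintro ⟨M, hM, hMg⟩
    exact Subtype.ext (hMg ▸ hUG M hM (hMg ▸ g.2))
  · rintro rfl
    exact ⟨1, h1U, map_one _⟩

end Finite

end HalfTurnSystem

/-! ### Parabolic words -/

namespace HalfTurnSystem

section General

variable {ι : Type*} (S : HalfTurnSystem ι)

/-- The homomorphism from the free product which sends the generators to the half-turns. -/
def lift : FreeInvolutions ι →* PSL2C := liftInvolutions S.halfTurn S.halfTurn_mul_self

theorem lift_simple (i : ι) : S.lift (σ i) = S.halfTurn i := liftInvolutions_simple _ _ i

/-- A point lies on two of the circles; as the circles do not cross, they touch there. -/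
def IsTangencyPoint (p : Sphere) : Prop := ∃ i j, i ≠ j ∧ p ∈ S.circle i ∧ p ∈ S.circle j

/-- A cyclically reduced word represents a parabolic transformation with fixed point `p`. -/
def IsParabolicWord (p : Sphere) (l : List ι) : Prop :=
  (l : Cycle ι).Chain (· ≠ ·) ∧ IsParabolicAt (S.lift (π l)) p

variable {S} {p : Sphere} {i : ι} {l : List ι}

theorem IsParabolicWord.ne_nil (hl : S.IsParabolicWord p l) : l ≠ [] := by
  rintro rfl
  exact hl.2.ne_one (by rw [CoxeterSystem.wordProd_nil, map_one])

theorem IsParabolicWord.rotate (hl : S.IsParabolicWord p (i :: l)) :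
    S.IsParabolicWord (S.halfTurn i • p) (l ++ [i]) := by
  refine ⟨Cycle.coe_cons_eq_coe_append l i ▸ hl.1, ?_⟩
  have h := hl.2.conj_smul (S.halfTurn i)
  rwa [CoxeterSystem.wordProd_cons, map_mul, lift_simple, ← mul_assoc, S.halfTurn_mul_self,
    one_mul, inv_eq_of_mul_eq_one_right (S.halfTurn_mul_self i), ← S.lift_simple, ← map_mul,
    ← CoxeterSystem.wordProd_concat, List.concat_eq_append, lift_simple] at h

theorem exists_isParabolicWord {x : FreeInvolutions ι} (hx : x ∈ evenSubgroup ι)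
    (hp : IsParabolicAt (S.lift x) p) :
    ∃ u l q, S.IsParabolicWord q l ∧ x = u * π l * u⁻¹ := by
  obtain ⟨u, l, hl, rfl⟩ := exists_cycleChain_eq_conj hx
  have hq := hp.conj_smul (S.lift u)⁻¹
  rw [← map_inv, ← map_mul, ← map_inv, ← map_mul] at hq
  exact ⟨u, l, _, ⟨hl, by simpa [mul_assoc] using hq⟩, rfl⟩

theorem evalAt_head_nonpos [Finite ι] (hl : l.IsChain (· ≠ ·)) (hne : l ≠ [])
    (hhl : l.head hne ≠ l.getLast hne) (hp : IsParabolicAt (S.lift (π l)) p) :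
    (S.form (l.head hne)).evalAt p ≤ 0 := by
  obtain ⟨z, hz⟩ := S.exists_forall_mem_exterior
  have H := S.isPingPong hz
  have hball {x : Sphere} (hx : x ∈ S.exterior (l.getLast hne)) :
      S.lift (π l) • x ∈ S.ball (l.head hne) := H.lift_wordProd_smul_mem hl hne hx
  have hiter (n : ℕ) : S.lift (π l) ^ (n + 1) • z ∈ S.ball (l.head hne) := by
    induction n with
    | zero => simpa using hball (hz _)
    | succ n ih =>
      rw [pow_succ', mul_smul]
      exact hball (H.subset hhl.symm ih)
  refine hp.evalAt_nonpos _ (fun h => ?_) fun n => (hiter n).le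
  have hz0 := hball (hz _)
  rw [h] at hz0
  exact Set.disjoint_left.1 (H.disjoint _) hz0 (hz _)

theorem IsParabolicWord.mem_circle_and_isTangencyPoint [Finite ι]
    (hl : S.IsParabolicWord p (i :: l)) : p ∈ S.circle i ∧ S.IsTangencyPoint p := by
  obtain ⟨hchain, hp⟩ := hl
  rw [Cycle.chain_coe_cons, ← List.cons_append] at hchain
  obtain ⟨hchain, -, hne⟩ := List.isChain_append.1 hchain
  set j := (i :: l).getLast (List.cons_ne_nil i l)
  have hji : j ≠ i := hne j (List.getLast?_eq_getLast_of_ne_nil _) i rfl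
  have hi : (S.form i).evalAt p ≤ 0 := evalAt_head_nonpos hchain (by simp) hji.symm hp
  have hj : (S.form j).evalAt p ≤ 0 := by
    have hrev := hp.inv
    rw [← map_inv, ← CoxeterSystem.wordProd_reverse] at hrev
    have h := evalAt_head_nonpos (isChain_ne_reverse hchain) (by simp)
      (by rwa [List.head_reverse, List.getLast_reverse]) hrev
    rwa [List.head_reverse] at h
  have hi0 : p ∈ S.circle i := hi.antisymm (not_lt.1 fun h => (S.eval_pos hji.symm _ h).not_ge hj)
  have hj0 : p ∈ S.circle j := hj.antisymm (not_lt.1 fun h => (S.eval_pos hji _ h).not_ge hi)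
  exact ⟨hi0, i, j, hji.symm, hi0, hj0⟩

theorem IsParabolicWord.isTangencyPoint_halfTurn_smul [Finite ι]
    (hl : S.IsParabolicWord p (i :: l)) : S.IsTangencyPoint (S.halfTurn i • p) := by
  obtain ⟨j, l', h⟩ := List.exists_cons_of_ne_nil hl.rotate.ne_nil
  exact (h ▸ hl.rotate : S.IsParabolicWord _ (j :: l')).mem_circle_and_isTangencyPoint.2

theorem IsParabolicWord.weight_eq [Finite ι] {F : Sphere → ZMod 2} {f : ι → ZMod 2}
    (hF : ∀ i p, p ∈ S.circle i → S.IsTangencyPoint p → S.IsTangencyPoint (S.halfTurn i • p) →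
      F (S.halfTurn i • p) = F p + f i) {l' : List ι} (hl : S.IsParabolicWord p (l ++ l')) :
    weight f (π l) = .ofAdd (F ((S.lift (π l))⁻¹ • p) - F p) := by
  induction l generalizing p l' with
  | nil => simp
  | cons i l ih =>
    have htang := hl.mem_circle_and_isTangencyPoint
    rw [List.cons_append] at hl
    have hrot := hl.rotate
    rw [List.append_assoc] at hrot
    rw [CoxeterSystem.wordProd_cons, map_mul, weight_simple, ih hrot,
      hF i p htang.1 htang.2 hl.isTangencyPoint_halfTurn_smul, map_mul, _root_.mul_inv_rev,
      mul_smul, lift_simple, inv_eq_of_mul_eq_one_right (S.halfTurn_mul_self i), ← ofAdd_add]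
    congr 1
    ring

/-- Around a parabolic word the fixed points return to the start, hence so does a potential. -/
theorem IsParabolicWord.weight_eq_one [Finite ι] {F : Sphere → ZMod 2} {f : ι → ZMod 2}
    (hF : ∀ i p, p ∈ S.circle i → S.IsTangencyPoint p → S.IsTangencyPoint (S.halfTurn i • p) →
      F (S.halfTurn i • p) = F p + f i) (hl : S.IsParabolicWord p l) :
    weight f (π l) = 1 := by
  rw [IsParabolicWord.weight_eq hF (l' := []) (by simpa using hl),
    inv_smul_eq_iff.2 hl.2.smul_eq.symm, sub_self, ofAdd_zero]

theorem weight_eq_one_of_isParabolicAt [Finite ι] {F : Sphere → ZMod 2} {f : ι → ZMod 2}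
    (hF : ∀ i p, p ∈ S.circle i → S.IsTangencyPoint p → S.IsTangencyPoint (S.halfTurn i • p) →
      F (S.halfTurn i • p) = F p + f i) {x : FreeInvolutions ι} (hx : x ∈ evenSubgroup ι)
    (hp : IsParabolicAt (S.lift x) p) : weight f x = 1 := by
  obtain ⟨u, l, q, hl, rfl⟩ := exists_isParabolicWord hx hp
  rw [map_mul, map_mul, hl.weight_eq_one hF, mul_one, ← map_mul, mul_inv_cancel, map_one]

theorem IsParabolicWord.forall_mem_circle [Finite ι]
    (hstay : ∀ i p, p ∈ S.circle i → S.IsTangencyPoint p →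
      S.IsTangencyPoint (S.halfTurn i • p) → S.halfTurn i • p = p)
    {l' : List ι} (hl : S.IsParabolicWord p (l ++ l')) : ∀ i ∈ l, p ∈ S.circle i := by
  induction l generalizing l' with
  | nil => simp
  | cons i l ih =>
    have htang := hl.mem_circle_and_isTangencyPoint
    rw [List.cons_append] at hl
    have hrot := hl.rotate
    rw [hstay i p htang.1 htang.2 hl.isTangencyPoint_halfTurn_smul, List.append_assoc] at hrot
    exact List.forall_mem_cons.2 ⟨htang.1, ih hrot⟩

end General

section Three

theorem fin_three_eq_or {i j k : Fin 3} (hij : i ≠ j) (hik : i ≠ k) (hjk : j ≠ k) (l : Fin 3) :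
    l = i ∨ l = j ∨ l = k := by
  omega

variable {S : HalfTurnSystem (Fin 3)} {p q z : Sphere} {i : Fin 3} {l : List (Fin 3)}
  {x y : FreeInvolutions (Fin 3)}

theorem eq_or_eq_of_isTangencyPoint (hp : p ∈ S.circle i) (hq : q ∈ S.circle i)
    (hz : z ∈ S.circle i) (hp' : S.IsTangencyPoint p) (hq' : S.IsTangencyPoint q)
    (hz' : S.IsTangencyPoint z) (hpq : p ≠ q) : z = p ∨ z = q := by
  have other {t : Sphere} (ht : S.IsTangencyPoint t) : ∃ j, i ≠ j ∧ t ∈ S.circle j := by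
    obtain ⟨j, k, hjk, hj, hk⟩ := ht
    rcases eq_or_ne i j with rfl | hij
    · exact ⟨k, hjk, hk⟩
    · exact ⟨j, hij, hj⟩
  obtain ⟨a, ha, hpa⟩ := other hp'
  obtain ⟨b, hb, hqb⟩ := other hq'
  obtain ⟨c, hc, hzc⟩ := other hz'
  have hab : a ≠ b := by
    rintro rfl
    exact hpq (S.subsingleton_inter ha ⟨hp, hpa⟩ ⟨hq, hqb⟩)
  rcases (fin_three_eq_or ha hb hab c).resolve_left hc.symm with rfl | rfl
  · exact .inl (S.subsingleton_inter hc ⟨hz, hzc⟩ ⟨hp, hpa⟩)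
  · exact .inr (S.subsingleton_inter hc ⟨hz, hzc⟩ ⟨hq, hqb⟩)

theorem exists_notMem_circle (hp : S.IsTangencyPoint p) : ∃ k, p ∉ S.circle k := by
  obtain ⟨i, j, hij, hi, hj⟩ := hp
  have : ∀ i j : Fin 3, ∃ k, i ≠ k ∧ j ≠ k := by decide
  obtain ⟨k, hik, hjk⟩ := this i j
  exact ⟨k, fun hk => (S.inter_circle_eq_empty hij hjk hik).subset ⟨⟨hi, hj⟩, hk⟩⟩

/-- If the half-turn of index `v` moved a tangency point `p` to another one, then the indicator of
`p` would be a potential for a function on the letters which is not constant. -/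
theorem halfTurn_smul_eq (hxy : Subgroup.closure {x, y} = evenSubgroup (Fin 3))
    {r s : Sphere} (hx : IsParabolicAt (S.lift x) r) (hy : IsParabolicAt (S.lift y) s)
    (i : Fin 3) (p : Sphere) (hp : p ∈ S.circle i) (hpT : S.IsTangencyPoint p)
    (hpT' : S.IsTangencyPoint (S.halfTurn i • p)) : S.halfTurn i • p = p := by
  classical
  let Moves (j : Fin 3) : Prop :=
    p ∈ S.circle j ∧ S.IsTangencyPoint (S.halfTurn j • p) ∧ S.halfTurn j • p ≠ p
  let F (z : Sphere) : ZMod 2 := if z = p then 1 else 0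
  let f (j : Fin 3) : ZMod 2 := if Moves j then 1 else 0
  have hF (j : Fin 3) (z : Sphere) (hz : z ∈ S.circle j) (hzT : S.IsTangencyPoint z)
      (hzT' : S.IsTangencyPoint (S.halfTurn j • z)) : F (S.halfTurn j • z) = F z + f j := by
    by_cases hj : Moves j
    · obtain ⟨hpj, hpjT, hne⟩ := hj
      rcases eq_or_eq_of_isTangencyPoint hpj (S.halfTurn_smul_mem_circle hpj) hz hpT hpjT hzT
        hne.symm with rfl | rfl
      · simp only [F, f, if_pos (show Moves j from ⟨hpj, hpjT, hne⟩), if_neg hne, if_true]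
        rfl
      · simp only [F, f, if_pos (show Moves j from ⟨hpj, hpjT, hne⟩), if_neg hne,
          S.halfTurn_smul_halfTurn_smul, if_true, zero_add]
    · have hiff : S.halfTurn j • z = p ↔ z = p := by
        constructor
        · rintro rfl
          by_contra hne
          have hz' := S.halfTurn_smul_halfTurn_smul j z
          exact hj ⟨S.halfTurn_smul_mem_circle hz, hz'.symm ▸ hzT, hz'.symm ▸ hne⟩
        · rintro rfl
          exact not_not.1 fun hne => hj ⟨hz, hzT', hne⟩
      simp only [F, f, if_neg hj, add_zero, hiff]
  have hconst : ∀ j k, f j = f k := eq_of_weight_eq_one hxy <| by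
    rintro w (rfl | rfl)
    · exact weight_eq_one_of_isParabolicAt hF (hxy ▸ Subgroup.subset_closure (.inl rfl)) hx
    · exact weight_eq_one_of_isParabolicAt hF (hxy ▸ Subgroup.subset_closure (.inr rfl)) hy
  by_contra hne
  obtain ⟨k, hk⟩ := exists_notMem_circle hpT
  have hik := hconst i k
  simp only [f, if_pos (show Moves i from ⟨hp, hpT', hne⟩),
    if_neg (show ¬Moves k from fun h => hk h.1)] at hik
  exact one_ne_zero hik

theorem exists_eq_conj_zpow_of_isParabolicAt
    (hstay : ∀ i p, p ∈ S.circle i → S.IsTangencyPoint p →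
      S.IsTangencyPoint (S.halfTurn i • p) → S.halfTurn i • p = p)
    (hx : x ∈ evenSubgroup (Fin 3)) {r : Sphere} (hr : IsParabolicAt (S.lift x) r) :
    ∃ i j, i ≠ j ∧ ∃ u, ∃ m : ℤ, x = u * (σ i * σ j) ^ m * u⁻¹ := by
  obtain ⟨u, l, p, hl, rfl⟩ := exists_isParabolicWord hx hr
  have hcircle := IsParabolicWord.forall_mem_circle hstay (l' := []) (by rwa [List.append_nil])
  obtain ⟨i, l', rfl⟩ := List.exists_cons_of_ne_nil hl.ne_nil
  obtain ⟨j, k, hjk, hj, hk⟩ := hl.mem_circle_and_isTangencyPoint.2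
  have hletters : ∀ c ∈ i :: l', c = j ∨ c = k := fun c hc => by
    by_contra! h
    exact (S.inter_circle_eq_empty hjk h.2.symm h.1.symm).subset ⟨⟨hj, hk⟩, hcircle c hc⟩
  rw [Subgroup.Normal.mem_comm_iff inferInstance, ← mul_assoc, inv_mul_cancel, one_mul] at hx
  obtain ⟨m, hm⟩ := exists_wordProd_eq_zpow_of_mem_even hletters hx
  exact ⟨j, k, hjk, u, m, by rw [hm]⟩

theorem exists_eq_conj_zpow_swap {i j : Fin 3}
    (h : ∃ u, ∃ m : ℤ, x = u * (σ i * σ j) ^ m * u⁻¹) :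
    ∃ u, ∃ m : ℤ, x = u * (σ j * σ i) ^ m * u⁻¹ := by
  obtain ⟨u, m, rfl⟩ := h
  refine ⟨u, -m, ?_⟩
  rw [_root_.zpow_neg, ← _root_.inv_zpow, _root_.mul_inv_rev, CoxeterSystem.inv_simple,
    CoxeterSystem.inv_simple]

/-- A letter occurring in neither of the two pairs would have to have weight zero. -/
theorem eq_or_eq_of_closure_eq_even {i j i' j' : Fin 3} {u v : FreeInvolutions (Fin 3)} {m k : ℤ}
    (hxy : Subgroup.closure {x, y} = evenSubgroup (Fin 3))
    (hx : x = u * (σ i * σ j) ^ m * u⁻¹) (hy : y = v * (σ i' * σ j') ^ k * v⁻¹) (c : Fin 3) :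
    (c = i ∨ c = j) ∨ c = i' ∨ c = j' := by
  by_contra! h
  obtain ⟨⟨hi, hj⟩, hi', hj'⟩ := h
  have hweight : ∀ w ∈ ({x, y} : Set _), weight (Pi.single c 1) w = 1 := by
    rintro w (rfl | rfl) <;> simp [*, Ne.symm]
  have := eq_of_weight_eq_one hxy hweight c i
  simp [hi.symm] at this

theorem exists_conj_mem_pair (hxy : Subgroup.closure {x, y} = evenSubgroup (Fin 3))
    {r s : Sphere} (hx : IsParabolicAt (S.lift x) r) (hy : IsParabolicAt (S.lift y) s) :
    ∃ a n b, a ≠ n ∧ n ≠ b ∧ a ≠ b ∧ ∃ g,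
      g⁻¹ * x * g ∈ ({σ a * σ n, (σ a * σ n)⁻¹} : Set _) ∧
      g⁻¹ * y * g ∈ ({σ b * σ n, (σ b * σ n)⁻¹} : Set _) := by
  have hstay := halfTurn_smul_eq hxy hx hy
  obtain ⟨i, j, hij, hxij⟩ := exists_eq_conj_zpow_of_isParabolicAt hstay
    (hxy ▸ Subgroup.subset_closure (.inl rfl)) hx
  obtain ⟨i', j', hij', hyij⟩ := exists_eq_conj_zpow_of_isParabolicAt hstay
    (hxy ▸ Subgroup.subset_closure (.inr rfl)) hy
  have hcover (c : Fin 3) : (c = i ∨ c = j) ∨ c = i' ∨ c = j' :=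
    hxij.elim fun _ ⟨_, hu⟩ => hyij.elim fun _ ⟨_, hv⟩ => eq_or_eq_of_closure_eq_even hxy hu hv c
  have hshare : ∀ i j i' j' : Fin 3, i ≠ j → i' ≠ j' →
      (∀ c, (c = i ∨ c = j) ∨ c = i' ∨ c = j') → ∃ a n b, a ≠ n ∧ n ≠ b ∧ a ≠ b ∧
        ((a = i ∧ n = j) ∨ (a = j ∧ n = i)) ∧ ((b = i' ∧ n = j') ∨ (b = j' ∧ n = i')) := by
    decide
  obtain ⟨a, n, b, han, hnb, hab, hai, hbi⟩ := hshare i j i' j' hij hij' hcover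
  have hxan : ∃ u, ∃ m : ℤ, x = u * (σ a * σ n) ^ m * u⁻¹ := by
    rcases hai with ⟨rfl, rfl⟩ | ⟨rfl, rfl⟩
    · exact hxij
    · exact exists_eq_conj_zpow_swap hxij
  have hybn : ∃ u, ∃ m : ℤ, y = u * (σ b * σ n) ^ m * u⁻¹ := by
    rcases hbi with ⟨rfl, rfl⟩ | ⟨rfl, rfl⟩
    · exact hyij
    · exact exists_eq_conj_zpow_swap hyij
  obtain ⟨u, m, hu⟩ := hxan
  obtain ⟨v, k, hv⟩ := hybn
  obtain ⟨z, hz⟩ := S.exists_forall_mem_exterior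
  exact ⟨a, n, b, han, hnb, hab,
    (S.isPingPong hz).exists_conj_mem_pair (fin_three_eq_or han hab hnb) han hnb hab hxy hu hv⟩

end Three

end HalfTurnSystem

/-! ### The mutual position of two circles -/

namespace HermForm

variable {Q R : HermForm}

instance : Add HermForm := ⟨fun Q R => ⟨Q.a + R.a, Q.c + R.c, Q.b + R.b⟩⟩

theorem add_def (Q R : HermForm) : Q + R = ⟨Q.a + R.a, Q.c + R.c, Q.b + R.b⟩ := rfl

theorem eval_add (Q R : HermForm) (v : Fin 2 → ℂ) : (Q + R).eval v = Q.eval v + R.eval v := by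
  simp only [add_def, eval, add_mul, add_re]
  ring

theorem polar_add (Q R : HermForm) (v w : Fin 2 → ℂ) :
    (Q + R).polar v w = Q.polar v w + R.polar v w := by
  simp only [add_def, polar, ofReal_add, map_add]
  ring

theorem polar_scale (Q : HermForm) (t : ℝ) (v w : Fin 2 → ℂ) :
    (Q.scale t).polar v w = t * Q.polar v w := by
  simp only [polar, scale, ofReal_mul, map_mul, conj_ofReal]
  ring

theorem nonneg_or_nonpos_of_disc_nonpos (hQ : Q.disc ≤ 0) :
    (∀ v, 0 ≤ Q.eval v) ∨ ∀ v, Q.eval v ≤ 0 := by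
  by_contra! ⟨⟨v, hv⟩, w, hw⟩
  have h := Q.normSq_polar_sub v w
  have h1 := mul_neg_of_neg_of_pos hv hw
  have h2 := mul_nonpos_of_nonpos_of_nonneg hQ (normSq_nonneg (cross v w))
  linarith [normSq_nonneg (Q.polar v w)]

theorem exists_isotropic_basis (hQ : 0 < Q.disc) :
    ∃ e f, cross e f ≠ 0 ∧ Q.eval e = 0 ∧ Q.eval f = 0 ∧ (Q.polar e f).re = 0 := by
  obtain ⟨z, hz, w, hw, hzw⟩ := (isCircle_zeros hQ).infinite.nontrivial
  have hcr : cross (vec z) (vec w) ≠ 0 := cross_vec_eq_zero_iff.not.2 hzw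
  have hm := polar_ne_zero hQ hz hcr
  refine ⟨vec z, (I * Q.polar (vec z) (vec w)) • vec w, ?_, hz, ?_, ?_⟩
  · rw [cross_smul_right]
    exact mul_ne_zero (mul_ne_zero I_ne_zero hm) hcr
  · rw [eval_smul, show Q.eval (vec w) = 0 from hw, mul_zero]
  · rw [polar_smul_right, map_mul, mul_assoc, ← normSq_eq_conj_mul_self, conj_I]
    simp

theorem sq_le_mul_of_forall_eq_zero {a b c : ℝ}
    (h : ∀ x y x' y', a * x ^ 2 + 2 * b * x * y + c * y ^ 2 = 0 →
      a * x' ^ 2 + 2 * b * x' * y' + c * y' ^ 2 = 0 → x * y' = y * x') :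
    b ^ 2 ≤ a * c := by
  by_contra! hlt
  rcases eq_or_ne a 0 with rfl | ha
  · have hb : b ≠ 0 := by
      rintro rfl
      simp at hlt
    have := h 1 0 (-c) (2 * b) (by ring) (by ring)
    exact hb (by linarith)
  · have hD := Real.sq_sqrt (sub_nonneg.2 hlt.le)
    have hr := Real.sqrt_pos.2 (sub_pos.2 hlt)
    set r := √(b ^ 2 - a * c)
    have := h (-b + r) a (-b - r) a (by linear_combination a * hD) (by linear_combination a * hD)
    exact mul_ne_zero ha hr.ne' (by linarith)

theorem cross_eq_zero_of_subsingleton (h : (Q.zeros ∩ R.zeros).Subsingleton) {v w : Fin 2 → ℂ}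
    (hQv : Q.eval v = 0) (hRv : R.eval v = 0) (hQw : Q.eval w = 0) (hRw : R.eval w = 0) :
    cross v w = 0 := by
  by_cases hv : v = 0
  · simp [cross, hv]
  by_cases hw : w = 0
  · simp [cross, hw]
  obtain ⟨z, c, hc, rfl⟩ := exists_eq_smul_vec hv
  obtain ⟨z', c', hc', rfl⟩ := exists_eq_smul_vec hw
  rw [eval_smul, mul_eq_zero, or_iff_right (normSq_pos.2 ‹_›).ne'] at hQv hRv hQw hRw
  rw [h ⟨hQv, hRv⟩ ⟨hQw, hRw⟩, cross_smul_right, cross_swap, cross_smul_right, cross_self]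
  ring

theorem sq_re_polar_le (h : (Q.zeros ∩ R.zeros).Subsingleton) {e f : Fin 2 → ℂ}
    (hef : cross e f ≠ 0) (he : R.eval e = 0) (hf : R.eval f = 0) (hre : (R.polar e f).re = 0) :
    (Q.polar e f).re ^ 2 ≤ Q.eval e * Q.eval f := by
  -- the real combinations of `e` and `f` represent the points of the circle of `R`
  have hRz (x y : ℝ) : R.eval ((x : ℂ) • e + (y : ℂ) • f) = 0 := by
    rw [R.eval_smul_add_smul, he, hf, conj_ofReal, ← ofReal_mul, re_ofReal_mul, hre]
    ring
  have hQz (x y : ℝ) : Q.eval ((x : ℂ) • e + (y : ℂ) • f) =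
      Q.eval e * x ^ 2 + 2 * (Q.polar e f).re * x * y + Q.eval f * y ^ 2 := by
    rw [Q.eval_smul_add_smul, conj_ofReal, ← ofReal_mul, re_ofReal_mul, normSq_ofReal,
      normSq_ofReal]
    ring
  refine sq_le_mul_of_forall_eq_zero fun x y x' y' hv hw => ?_
  have hcr : cross ((x : ℂ) • e + (y : ℂ) • f) ((x' : ℂ) • e + (y' : ℂ) • f) =
      ((x * y' - y * x' : ℝ) : ℂ) * cross e f := by
    simp [cross]
    ring
  have h0 := cross_eq_zero_of_subsingleton h ((hQz x y).trans hv) (hRz x y)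
    ((hQz x' y').trans hw) (hRz x' y')
  rw [hcr] at h0
  exact sub_eq_zero.1 (ofReal_eq_zero.1 ((mul_eq_zero.1 h0).resolve_right hef))

theorem exists_disc_add_scale_nonpos (hR : 0 < R.disc) (h : (Q.zeros ∩ R.zeros).Subsingleton) :
    ∃ t : ℝ, (Q + R.scale t).disc ≤ 0 := by
  obtain ⟨e, f, hef, he, hf, hre⟩ := R.exists_isotropic_basis hR
  have him : (R.polar e f).im ≠ 0 := fun him => polar_ne_zero hR he hef (Complex.ext hre him)
  refine ⟨-(Q.polar e f).im / (R.polar e f).im, ?_⟩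
  have hpolar : (Q + R.scale (-(Q.polar e f).im / (R.polar e f).im)).polar e f =
      ((Q.polar e f).re : ℂ) := by
    rw [polar_add, polar_scale]
    apply Complex.ext
    · simp [hre]
    · simp [him]
  refine nonpos_of_mul_nonpos_left ?_ (normSq_pos.2 hef)
  rw [← normSq_polar_sub, hpolar, normSq_ofReal, eval_add, eval_add, eval_scale, eval_scale, he, hf]
  linarith [sq_re_polar_le h hef he hf hre]

theorem exists_sign (hR : 0 < R.disc) (h : (Q.zeros ∩ R.zeros).Subsingleton) :
    ∃ ε : ℝ, (ε = 1 ∨ ε = -1) ∧ ∀ z ∈ R.zeros, 0 ≤ ε * Q.evalAt z := by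
  obtain ⟨t, ht⟩ := exists_disc_add_scale_nonpos hR h
  have hQ : ∀ z ∈ R.zeros, (Q + R.scale t).eval (vec z) = Q.evalAt z := fun z hz => by
    rw [eval_add, eval_scale, show R.eval (vec z) = 0 from hz, mul_zero, add_zero, evalAt]
  rcases nonneg_or_nonpos_of_disc_nonpos ht with hs | hs
  · exact ⟨1, .inl rfl, fun z hz => by simpa [← hQ z hz] using hs _⟩
  · exact ⟨-1, .inr rfl, fun z hz => by simpa [← hQ z hz] using hs _⟩

theorem exists_mem_zeros_evalAt_ne_zero (hQ : 0 < Q.disc)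
    (h : (Q.zeros ∩ R.zeros).Subsingleton) : ∃ z ∈ Q.zeros, R.evalAt z ≠ 0 := by
  by_contra! hz
  exact (isCircle_zeros hQ).infinite.nontrivial.not_subsingleton
    (h.anti fun z hzQ => ⟨hzQ, hz z hzQ⟩)

theorem eval_pos_of_eval_neg (hQ : 0 < Q.disc) (hR : 0 < R.disc)
    (h : (Q.zeros ∩ R.zeros).Subsingleton) (hQR : ∀ z ∈ R.zeros, 0 ≤ Q.evalAt z)
    (hRQ : ∀ z ∈ Q.zeros, 0 ≤ R.evalAt z) {v : Fin 2 → ℂ} (hv : Q.eval v < 0) :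
    0 < R.eval v := by
  have h' : (R.zeros ∩ Q.zeros).Subsingleton := by rwa [Set.inter_comm]
  obtain ⟨t, ht⟩ := exists_disc_add_scale_nonpos hQ h'
  have hnonneg : ∀ v, 0 ≤ R.eval v + t * Q.eval v := by
    obtain ⟨z, hz, hRz⟩ := exists_mem_zeros_evalAt_ne_zero hQ h
    simp only [← eval_scale, ← eval_add]
    refine (nonneg_or_nonpos_of_disc_nonpos ht).resolve_right fun hs => ?_
    have := hs (vec z)
    rw [eval_add, eval_scale, show Q.eval (vec z) = 0 from hz, mul_zero, add_zero] at this
    exact hRz (this.antisymm (hRQ z hz))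
  suffices 0 < t by nlinarith [hnonneg v]
  by_contra! ht0
  rcases ht0.eq_or_lt with rfl | ht0
  · rw [show R + Q.scale 0 = R by simp [add_def, scale]] at ht
    exact ht.not_gt hR
  · obtain ⟨z, hz, hQz⟩ := exists_mem_zeros_evalAt_ne_zero hR h'
    have h1 := hnonneg (vec z)
    rw [show R.eval (vec z) = 0 from hz, zero_add] at h1
    exact hQz ((nonpos_of_mul_nonneg_right h1 ht0).antisymm (hQR z hz))

theorem isOpen_setOf_evalAt_pos (Q : HermForm) : IsOpen {z : Sphere | 0 < Q.evalAt z} := by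
  refine isOpen_iff_mem_nhds.2 fun z hz => ?_
  induction z using OnePoint.rec with
  | infty =>
    rw [OnePoint.nhds_infty_eq, mem_sup, coclosedCompact_eq_cocompact,
      ← Metric.cobounded_eq_cocompact]
    refine ⟨?_, hz⟩
    have hlim : Tendsto (fun z : ℂ => Q.eval ![1, z⁻¹]) (Bornology.cobounded ℂ)
        (𝓝 (Q.eval ![1, 0])) := by
      have hcont : Continuous fun w : ℂ => Q.eval ![1, w] := Q.continuous_eval.comp (by fun_prop)
      exact (hcont.tendsto 0).comp tendsto_inv₀_cobounded
    rw [mem_map]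
    filter_upwards [hlim.eventually (lt_mem_nhds hz), Bornology.eventually_ne_cobounded 0]
      with w hw hw0
    have : vec w = w • ![1, w⁻¹] := by
      ext i
      fin_cases i <;> simp [hw0]
    change 0 < Q.eval (vec w)
    rw [this, eval_smul]
    exact mul_pos (normSq_pos.2 hw0) hw
  | coe z =>
    have hcont : Continuous fun w : ℂ => Q.eval ![w, 1] := Q.continuous_eval.comp (by fun_prop)
    rw [OnePoint.nhds_coe_eq]
    exact hcont.continuousAt.eventually (lt_mem_nhds hz)

theorem evalAt_pos_of_isPreconnected {P : Set Sphere} (hP : IsPreconnected P)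
    (hQ : P ⊆ Q.zerosᶜ) {z w : Sphere} (hz : z ∈ P) (hw : w ∈ P) (h : 0 < Q.evalAt z) :
    0 < Q.evalAt w := by
  have hscale (z : Sphere) : (Q.scale (-1)).evalAt z = -Q.evalAt z := by
    rw [evalAt, eval_scale, neg_one_mul, evalAt]
  have hsub := hP.subset_left_of_subset_union (isOpen_setOf_evalAt_pos Q)
    (isOpen_setOf_evalAt_pos (Q.scale (-1)))
    (Set.disjoint_left.2 fun z h1 h2 => by
      simp only [Set.mem_ofPred_eq, hscale] at h1 h2
      linarith)
    (fun z hz => by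
      simp only [Set.mem_union, Set.mem_ofPred_eq, hscale, neg_pos]
      exact (lt_or_gt_of_ne (hQ hz)).symm)
    ⟨z, hz, h⟩
  exact hsub hw

theorem exists_sign_of_not_separates {T : HermForm} (hR : 0 < R.disc) (hT : 0 < T.disc)
    (hQR : (Q.zeros ∩ R.zeros).Subsingleton) (hQT : (Q.zeros ∩ T.zeros).Subsingleton)
    (h : ¬Separates Q.zeros R.zeros T.zeros) :
    ∃ ε : ℝ, (ε = 1 ∨ ε = -1) ∧ ∀ z ∈ R.zeros ∪ T.zeros, 0 ≤ ε * Q.evalAt z := by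
  obtain ⟨ε, hε, hεR⟩ := exists_sign hR hQR
  obtain ⟨δ, hδ, hδT⟩ := exists_sign hT hQT
  suffices hεδ : ε = δ by
    subst hεδ
    exact ⟨ε, hε, fun z hz => hz.elim (hεR z) (hδT z)⟩
  obtain ⟨P, hP, hPQ, ⟨z, hzP, hz⟩, w, hwP, hw⟩ := not_not.1 h
  have hzQ := (hεR z hz).lt_of_ne' (mul_ne_zero (by rcases hε with rfl | rfl <;> simp) (hPQ hzP))
  have hwQ := (hδT w hw).lt_of_ne' (mul_ne_zero (by rcases hδ with rfl | rfl <;> simp) (hPQ hwP))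
  have hzw : 0 < Q.evalAt z ↔ 0 < Q.evalAt w :=
    ⟨evalAt_pos_of_isPreconnected hP hPQ hzP hwP, evalAt_pos_of_isPreconnected hP hPQ hwP hzP⟩
  rcases hε with rfl | rfl <;> rcases hδ with rfl | rfl <;> grind

end HermForm

theorem Separates.symm {C D E : Set Sphere} (h : Separates C D E) : Separates C E D :=
  fun ⟨P, hP, hPC, hPE, hPD⟩ => h ⟨P, hP, hPC, hPD, hPE⟩

theorem cross_mulVec (g : SL2C) (v w : Fin 2 → ℂ) :
    cross (g.1 *ᵥ v) (g.1 *ᵥ w) = cross v w := by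
  simp only [cross, mulVec_zero_apply, mulVec_one_apply]
  linear_combination (v 0 * w 1 - v 1 * w 0) * mul_sub_mul_eq_one g

theorem mul_self_eq_neg_one {H : SL2C} (h : toPSL H * toPSL H = 1) (h1 : toPSL H ≠ 1) :
    H * H = -1 := by
  rw [← map_mul, toPSL_eq_one_iff] at h
  refine h.resolve_left fun hH => h1 ((toPSL_eq_one_iff H).2 ?_)
  have hinv : H.1 = H.1.adjugate := by
    rw [← Matrix.SpecialLinearGroup.coe_inv, inv_eq_of_mul_eq_one_right hH]
  have h01 : H 0 1 = 0 := by simpa [adjugate_fin_two, self_eq_neg] using congrFun₂ hinv 0 1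
  have h10 : H 1 0 = 0 := by simpa [adjugate_fin_two, self_eq_neg] using congrFun₂ hinv 1 0
  have h00 : H 0 0 = H 1 1 := by simpa [adjugate_fin_two] using congrFun₂ hinv 0 0
  have hdet := mul_sub_mul_eq_one H
  rw [h01, h00, zero_mul, sub_zero] at hdet
  refine (mul_self_eq_one_iff.1 hdet).imp (fun h11 => ?_) fun h11 => ?_ <;>
  · ext i j
    fin_cases i <;> fin_cases j <;> simp [h00, h01, h10, h11]

theorem IsHalfTurn.exists_mulVec_eq {h : PSL2C} {x y : Sphere} (hh : IsHalfTurn h x y) :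
    ∃ (H : SL2C) (c : ℂ), toPSL H = h ∧ H * H = -1 ∧ normSq c = 1 ∧
      H.1 *ᵥ vec x = c • vec x ∧ H.1 *ᵥ vec y = (-c) • vec y := by
  obtain ⟨hxy, h1, hsq, hfx, hfy⟩ := hh
  obtain ⟨H, rfl⟩ := toPSL_surjective h
  have hH := mul_self_eq_neg_one hsq h1
  obtain ⟨c, hc⟩ := toPSL_smul_eq_iff.1 hfx
  obtain ⟨d, hd⟩ := toPSL_smul_eq_iff.1 hfy
  have hcc : c * c = -1 := by
    have h2 : (H * H).1 *ᵥ vec x = (c * c) • vec x := by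
      rw [mul_mulVec, hc, mulVec_smul, hc, smul_smul]
    rw [hH, Matrix.SpecialLinearGroup.coe_neg, Matrix.SpecialLinearGroup.coe_one, neg_mulVec,
      one_mulVec, ← neg_one_smul ℂ] at h2
    exact (smul_left_injective ℂ (vec_ne_zero x) h2).symm
  have hdc : d * c = 1 := by
    have h2 := cross_mulVec H (vec x) (vec y)
    rw [hc, hd, cross_smul_right, cross_swap, cross_smul_right, cross_swap (vec x)] at h2
    exact mul_right_cancel₀ (cross_vec_eq_zero_iff.not.2 hxy) (by linear_combination h2)
  have hn := congrArg normSq hcc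
  rw [normSq_mul, normSq_neg, normSq_one, mul_self_eq_one_iff] at hn
  refine ⟨H, c, rfl, hH, hn.resolve_right fun h3 => ?_, hc, ?_⟩
  · linarith [normSq_nonneg c]
  · rw [hd, show d = -c by linear_combination d * hcc - c * hdc]

theorem IsHalfTurn.exists_matrix {h : PSL2C} {x y : Sphere} (hh : IsHalfTurn h x y) {Q : HermForm}
    (hx : x ∈ Q.zeros) (hy : y ∈ Q.zeros) :
    ∃ H : SL2C, toPSL H = h ∧ H * H = -1 ∧ ∀ v, Q.eval (H.1 *ᵥ v) = -Q.eval v := by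
  obtain ⟨H, c, hH, hsq, hc, hHx, hHy⟩ := hh.exists_mulVec_eq
  refine ⟨H, hH, hsq, fun v => ?_⟩
  obtain ⟨a, b, rfl⟩ := exists_eq_smul_add_smul (cross_vec_eq_zero_iff.not.2 hh.1) v
  rw [mulVec_add, mulVec_smul, mulVec_smul, hHx, hHy, smul_smul, smul_smul, Q.eval_smul_add_smul,
    Q.eval_smul_add_smul, show Q.eval (vec x) = 0 from hx, show Q.eval (vec y) = 0 from hy]
  have hc' : c * conj c = 1 := by rw [mul_conj, hc, ofReal_one]
  have : a * c * conj (b * -c) * Q.polar (vec x) (vec y) =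
      -(a * conj b * Q.polar (vec x) (vec y)) := by
    rw [map_mul, map_neg]
    linear_combination (-a * conj b * Q.polar (vec x) (vec y)) * hc'
  rw [this, neg_re]
  ring

theorem HermForm.exists_oriented {Q : Fin 3 → HermForm} (hd : ∀ i, 0 < (Q i).disc)
    (htang : ∀ i j, i ≠ j → ((Q i).zeros ∩ (Q j).zeros).Subsingleton)
    (hsep : ∀ i, ¬Separates (Q i).zeros (Q (i + 1)).zeros (Q (i + 2)).zeros) :
    ∃ ε : Fin 3 → ℝ, (∀ i, ε i = 1 ∨ ε i = -1) ∧ ∀ i j, i ≠ j →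
      ∀ v, ((Q i).scale (ε i)).eval v < 0 → 0 < ((Q j).scale (ε j)).eval v := by
  have hne : ∀ i : Fin 3, i ≠ i + 1 ∧ i ≠ i + 2 := by decide
  have hcases : ∀ i j : Fin 3, i ≠ j → j = i + 1 ∨ j = i + 2 := by decide
  choose ε hε hnonneg using fun i => exists_sign_of_not_separates (hd (i + 1)) (hd (i + 2))
    (htang i _ (hne i).1) (htang i _ (hne i).2) (hsep i)
  have hε0 (i) : ε i ≠ 0 := by rcases hε i with h | h <;> simp [h]
  have hdisc (i) : 0 < ((Q i).scale (ε i)).disc := by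
    rw [disc_scale]
    exact mul_pos (by have := hε0 i; positivity) (hd i)
  have hside {i j} (hij : i ≠ j) : ∀ z ∈ ((Q j).scale (ε j)).zeros,
      0 ≤ ((Q i).scale (ε i)).evalAt z := fun z hz => by
    rw [zeros_scale _ (hε0 j)] at hz
    rw [evalAt, eval_scale]
    exact hnonneg i z (by rcases hcases i j hij with rfl | rfl <;> simp [hz])
  refine ⟨ε, hε, fun i j hij v hv => eval_pos_of_eval_neg (hdisc i) (hdisc j) ?_ (hside hij)
    (hside hij.symm) hv⟩
  rw [zeros_scale _ (hε0 i), zeros_scale _ (hε0 j)]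
  exact htang i j hij

theorem exists_halfTurnSystem {Q : Fin 3 → HermForm} (hd : ∀ i, 0 < (Q i).disc)
    (htang : ∀ i j, i ≠ j → ((Q i).zeros ∩ (Q j).zeros).Subsingleton)
    (hsep : ∀ i, ¬Separates (Q i).zeros (Q (i + 1)).zeros (Q (i + 2)).zeros)
    {h : Fin 3 → PSL2C} (hh : ∀ i, ∃ x ∈ (Q i).zeros, ∃ y ∈ (Q i).zeros, IsHalfTurn (h i) x y) :
    ∃ S : HalfTurnSystem (Fin 3), S.halfTurn = h := by
  obtain ⟨ε, hε, hpos⟩ := HermForm.exists_oriented hd htang hsep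
  have hmatrix (i) : ∃ H : SL2C, toPSL H = h i ∧ H * H = -1 ∧
      ∀ v, (Q i).eval (H.1 *ᵥ v) = -(Q i).eval v := by
    obtain ⟨x, hx, y, hy, hi⟩ := hh i
    exact hi.exists_matrix hx hy
  choose H hH hsq heval using hmatrix
  have hε0 (i) : ε i ≠ 0 := by rcases hε i with h | h <;> simp [h]
  exact ⟨{
    matrix := H
    form := fun i => (Q i).scale (ε i)
    mul_self := hsq
    eval_mulVec := fun i v => by rw [HermForm.eval_scale, HermForm.eval_scale, heval, mul_neg]
    disc_pos := fun i => by
      rw [HermForm.disc_scale]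
      exact mul_pos (by have := hε0 i; positivity) (hd i)
    eval_pos := fun i j hij => hpos i j hij
    subsingleton_inter := fun i j hij => by
      rw [HermForm.zeros_scale _ (hε0 i), HermForm.zeros_scale _ (hε0 j)]
      exact htang i j hij }, funext hH⟩

theorem IsMarkedNSDC.exists_halfTurnSystem {A B : PSL2C} (h : IsMarkedNSDC A B) :
    ∃ S : HalfTurnSystem (Fin 3),
      A = S.halfTurn 0 * S.halfTurn 1 ∧ B = S.halfTurn 2 * S.halfTurn 1 := by
  obtain ⟨-, a, a', n, n', b, b', ⟨-, -, hA, hN, hB, tA, tN, tB, rfl, rfl⟩,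
    -, -, -, CA, CN, CB, cA, cN, cB, ma, ma', mn, mn', mb, mb', dAN, dNB, dAB, sA, sN, sB⟩ := h
  obtain ⟨QA, dA, rfl⟩ := isCircle_iff_exists_zeros.1 cA
  obtain ⟨QN, dN, rfl⟩ := isCircle_iff_exists_zeros.1 cN
  obtain ⟨QB, dB, rfl⟩ := isCircle_iff_exists_zeros.1 cB
  have htang : ∀ i j, i ≠ j →
      ((![QA, QN, QB] i).zeros ∩ (![QA, QN, QB] j).zeros).Subsingleton := by
    have hcyclic : ∀ i, ((![QA, QN, QB] i).zeros ∩ (![QA, QN, QB] (i + 1)).zeros).Subsingleton := by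
      intro i
      fin_cases i
      exacts [dAN, dNB, dAB.anti (Set.inter_comm _ _).subset]
    have hcases : ∀ i j : Fin 3, i ≠ j → j = i + 1 ∨ i = j + 1 := by decide
    intro i j hij
    rcases hcases i j hij with rfl | rfl
    · exact hcyclic i
    · rw [Set.inter_comm]
      exact hcyclic j
  obtain ⟨S, hS⟩ : ∃ S : HalfTurnSystem (Fin 3), S.halfTurn = ![hA, hN, hB] := by
    refine TwoParabolic.exists_halfTurnSystem (Q := ![QA, QN, QB]) ?_ htang ?_ ?_ <;> intro i
    · fin_cases i
      exacts [dA, dN, dB]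
    · fin_cases i
      exacts [sA, fun h => sN h.symm, sB]
    · fin_cases i
      exacts [⟨a, ma, a', ma', tA⟩, ⟨n, mn, n', mn', tN⟩, ⟨b, mb, b', mb', tB⟩]
  exact ⟨S, by simp [hS], by simp [hS]⟩

/-! ### The inequality for three circles in normal position -/

theorem HermForm.exists_polar_eq_neg_mul {P Q : HermForm} (hP : 0 < P.disc) (hQ : 0 < Q.disc)
    (hPQ : ∀ v, P.eval v < 0 → 0 ≤ Q.eval v) {v w : Fin 2 → ℂ} (hPv : P.eval v = 0)
    (hQv : Q.eval v = 0) (hvw : cross v w ≠ 0) :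
    ∃ k : ℝ, 0 < k ∧ Q.polar v w = -(k * P.polar v w) := by
  obtain ⟨k, hk, h⟩ := (sameRay_polar_neg (w := w) hPQ hPv hQv).exists_pos_left
    (P.polar_ne_zero hP hPv hvw) (neg_ne_zero.2 (Q.polar_ne_zero hQ hQv hvw))
  exact ⟨k, hk, by rw [← real_smul, h, neg_neg]⟩

theorem HermForm.polar_one_zero (Q : HermForm) : Q.polar ![1, 0] ![0, 1] = Q.b := by
  simp [polar]

theorem HermForm.polar_zero_one (Q : HermForm) : Q.polar ![0, 1] ![1, 0] = conj Q.b := by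
  simp [polar]

theorem HermForm.eval_one (Q : HermForm) (z : ℂ) :
    Q.eval ![z, 1] = Q.a * normSq z + 2 * (Q.b * z).re + Q.c := by
  simp [eval]

theorem four_le_norm_add_re {ν lam : ℂ} (hν : ν ≠ 0)
    (h : ∀ s : ℝ, 0 < s → s * ν.re < 2 → s * normSq ν < (ν * lam).re) : 4 ≤ ‖lam‖ + lam.re := by
  have hn := normSq_pos.2 hν
  have h' (s : ℝ) (hs : 0 < s) (hs2 : s * ν.re < 2) : s < (ν * lam).re / normSq ν :=
    (lt_div_iff₀ hn).2 (h s hs hs2)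
  have hre : 0 < ν.re := by
    by_contra! hre
    have hs : 0 < |(ν * lam).re / normSq ν| + 1 := by positivity
    have := h' _ hs ((mul_nonpos_of_nonneg_of_nonpos hs.le hre).trans_lt two_pos)
    linarith [le_abs_self ((ν * lam).re / normSq ν)]
  have hmain : 2 / ν.re ≤ (ν * lam).re / normSq ν := by
    by_contra! hlt
    obtain ⟨s, hs, hs2⟩ := exists_between (max_lt hlt (div_pos two_pos hre))
    exact (h' s ((le_max_right _ _).trans_lt hs) ((lt_div_iff₀ hre).1 hs2)).not_gt
      ((le_max_left _ _).trans_lt hs)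
  rw [div_le_div_iff₀ hre hn] at hmain
  refine le_of_mul_le_mul_left ?_ hn
  calc normSq ν * 4 ≤ 2 * ((ν * lam).re * ν.re) := by linarith
    _ = (ν ^ 2 * lam).re + normSq ν * lam.re := by
      simp only [normSq_apply, mul_re, mul_im, pow_two]
      ring
    _ ≤ ‖ν ^ 2 * lam‖ + normSq ν * lam.re := by gcongr; exact re_le_norm _
    _ = normSq ν * (‖lam‖ + lam.re) := by rw [norm_mul, norm_pow, normSq_eq_norm_sq]; ring

theorem four_le_norm_add_re_of_forms {lam : ℂ} {A N B : HermForm} (dA : 0 < A.disc)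
    (dN : 0 < N.disc) (dB : 0 < B.disc) (hN1 : N.eval ![1, 0] = 0) (hN2 : N.eval ![0, 1] = 0)
    (hA1 : A.eval ![0, 1] = 0) (hA2 : A.eval ![2, 1] = 0) (hB1 : B.eval ![1, 0] = 0)
    (hB2 : B.eval ![lam, 1] = 0) (hNA : ∀ v, N.eval v < 0 → 0 ≤ A.eval v)
    (hNB : ∀ v, N.eval v < 0 → 0 ≤ B.eval v) (hAB : ∀ v, A.eval v < 0 → 0 < B.eval v) :
    4 ≤ ‖lam‖ + lam.re := by
  obtain ⟨k, hk, hAk⟩ := HermForm.exists_polar_eq_neg_mul dN dA hNA hN2 hA1 (w := ![1, 0])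
    (by simp [cross])
  obtain ⟨l, hl, hBl⟩ := HermForm.exists_polar_eq_neg_mul dN dB hNB hN1 hB1 (w := ![0, 1])
    (by simp [cross])
  have hν : N.b ≠ 0 := by
    rw [← N.polar_one_zero]
    exact N.polar_ne_zero dN hN1 (by simp [cross])
  set ν := N.b
  have hAb : A.b = -(k * ν) := by
    rw [HermForm.polar_zero_one, HermForm.polar_zero_one, ← conj_ofReal, ← map_mul,
      ← map_neg] at hAk
    exact star_injective hAk
  have hBb : B.b = -(l * ν) := by rw [← B.polar_one_zero, hBl, N.polar_one_zero]
  have hAc : A.c = 0 := by simpa [HermForm.eval_one] using hA1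
  have hAa : A.a = k * ν.re := by
    rw [HermForm.eval_one, hAc, hAb] at hA2
    simp at hA2
    linarith
  have hBa : B.a = 0 := by simpa [HermForm.eval] using hB1
  have hBc : B.c = 2 * (l * (ν * lam).re) := by
    rw [HermForm.eval_one, hBa, hBb, neg_mul, mul_assoc, neg_re, re_ofReal_mul] at hB2
    linarith
  have hre (t s : ℝ) : (-(t * ν) * (s * conj ν)).re = -(t * s * normSq ν) := by
    rw [neg_mul, mul_mul_mul_comm, mul_conj, ← ofReal_mul, ← ofReal_mul, neg_re, ofReal_re]
  refine four_le_norm_add_re hν fun s hs hs2 => ?_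
  have hA : A.eval ![s * conj ν, 1] < 0 := by
    have : k * s * normSq ν * (s * ν.re - 2) < 0 :=
      mul_neg_of_pos_of_neg (mul_pos (mul_pos hk hs) (normSq_pos.2 hν)) (by linarith)
    rw [HermForm.eval_one, hAa, hAb, hAc, hre, normSq_mul, normSq_conj, normSq_ofReal]
    linarith
  have hB := hAB _ hA
  rw [HermForm.eval_one, hBa, hBb, hBc, hre] at hB
  exact lt_of_mul_lt_mul_left (by linarith : l * _ < l * _) hl.le

/-! ### Normal form of two parabolic matrices -/

theorem mul_apply (S T : SL2C) (i j : Fin 2) :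
    (S * T) i j = S i 0 * T 0 j + S i 1 * T 1 j := by
  rw [Matrix.SpecialLinearGroup.coe_mul, Matrix.mul_apply, Fin.sum_univ_two]

theorem trace_mul (S T : SL2C) : (S * T).1.trace =
    S 0 0 * T 0 0 + S 0 1 * T 1 0 + (S 1 0 * T 0 1 + S 1 1 * T 1 1) := by
  rw [trace_fin_two]
  exact congrArg₂ (· + ·) (mul_apply S T 0 0) (mul_apply S T 1 1)

theorem exists_eq_conj_matS {M : SL2C} (hM : M.1.trace = 2) (h1 : M ≠ 1) :
    ∃ P : SL2C, M = P * matS * P⁻¹ := by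
  obtain ⟨w, hw⟩ := exists_mulVec_sub_ne_zero h1
  obtain ⟨v, hv⟩ : ∃ v, M.1 *ᵥ w - w = v := ⟨_, rfl⟩
  have hMv : M.1 *ᵥ v = v := by rw [← hv, mulVec_sub_of_trace_eq_two hM]
  have hMw : M.1 *ᵥ w = w + v := by rw [← hv, add_sub_cancel]
  have hcross : cross w v ≠ 0 := by
    intro h
    rw [cross_swap, neg_eq_zero] at h
    obtain ⟨x, rfl⟩ := exists_eq_smul_of_cross_eq_zero (hv ▸ hw) h
    exact hw (sub_eq_zero.2 (by rw [mulVec_smul, hMv]))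
  obtain ⟨s, hs⟩ := IsAlgClosed.exists_eq_mul_self (cross w v)
  let P : SL2C := ⟨!![w 0 / s, v 0 / s; w 1 / s, v 1 / s], by
    rw [det_fin_two_of, div_mul_div_comm, div_mul_div_comm, ← sub_div, ← hs, mul_comm (v 0)]
    exact div_self hcross⟩
  refine ⟨P, eq_mul_inv_of_mul_eq ?_⟩
  have hw0 := congrFun hMw 0
  have hw1 := congrFun hMw 1
  have hv0 := congrFun hMv 0
  have hv1 := congrFun hMv 1
  rw [mulVec_zero_apply] at hw0 hv0
  rw [mulVec_one_apply] at hw1 hv1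
  rw [Pi.add_apply] at hw0 hw1
  ext i j
  rw [mul_apply, mul_apply]
  fin_cases i <;> fin_cases j <;> simp [P, matS]
  · linear_combination hw0 / s
  · linear_combination hv0 / s
  · linear_combination hw1 / s
  · linear_combination hv1 / s

theorem exists_eq_conj_matT {M : SL2C} (hM : M.1.trace = 2) (h : M 0 1 ≠ 0) :
    ∃ P : SL2C, P * matS = matS * P ∧ M = P * matT (M 0 1 / 2) * P⁻¹ := by
  rw [trace_fin_two] at hM
  have hdet := mul_sub_mul_eq_one M
  let P : SL2C := ⟨!![1, 0; (1 - M 0 0) / M 0 1, 1], by simp⟩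
  refine ⟨P, ?_, eq_mul_inv_of_mul_eq ?_⟩
  · ext i j
    rw [mul_apply, mul_apply]
    fin_cases i <;> fin_cases j <;> simp [P, matS, add_comm]
  · ext i j
    rw [mul_apply, mul_apply]
    fin_cases i <;> fin_cases j <;> simp [P, matT] <;> field_simp
    · ring
    · linear_combination hM - hdet
    · linear_combination hM

theorem exists_conj_standard {S T : SL2C} (hS : S.1.trace = 2) (hT : T.1.trace = 2) {lam : ℂ}
    (h : (S * T).1.trace - 2 = 2 * lam) (hlam : lam ≠ 0) :
    ∃ P : SL2C, S = P * matS * P⁻¹ ∧ T = P * matT lam * P⁻¹ := by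
  obtain ⟨P, hP⟩ := exists_eq_conj_matS hS fun h1 => hlam (by
    rw [h1, one_mul, hT, sub_self] at h
    linear_combination -h / 2)
  obtain ⟨T', hT'⟩ : ∃ T', T' = P⁻¹ * T * P := ⟨_, rfl⟩
  have htr : T'.1.trace = 2 := by rw [← hT, hT', ← trace_mul_mul_inv T P⁻¹, inv_inv]
  have h01 : T' 0 1 = 2 * lam := by
    rw [← h, ← htr, ← trace_mul_mul_inv (S * T) P⁻¹, inv_inv,
      show P⁻¹ * (S * T) * P = matS * T' by rw [hP, hT']; group, trace_mul, trace_fin_two]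
    simp [matS]
  obtain ⟨R, hRS, hRT⟩ := exists_eq_conj_matT htr (h01 ▸ mul_ne_zero two_ne_zero hlam)
  rw [h01, mul_div_cancel_left₀ _ two_ne_zero] at hRT
  refine ⟨P * R, ?_, ?_⟩
  · calc S = P * (matS * R) * R⁻¹ * P⁻¹ := by rw [hP]; group
      _ = P * R * matS * (P * R)⁻¹ := by rw [← hRS]; group
  · calc T = P * T' * P⁻¹ := by rw [hT']; group
      _ = P * R * matT lam * (P * R)⁻¹ := by rw [hRT]; group

/-! ### Necessity of the inequality -/

theorem HermForm.zeros_comap (g : SL2C) (Q : HermForm) :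
    (Q.comap g).zeros = (toPSL g • ·) ⁻¹' Q.zeros := by
  ext z
  obtain ⟨r, hr, h⟩ := Q.exists_eval_mulVec_eq g z
  rw [Set.mem_preimage, zeros, zeros, Set.mem_ofPred_eq, Set.mem_ofPred_eq, evalAt, eval_comap, h,
    mul_eq_zero, or_iff_right hr.ne']

theorem HermForm.eval_eq_zero_of_mulVec_eq {Q : HermForm} {M : SL2C}
    (h : ∀ v, Q.eval (M.1 *ᵥ v) = -Q.eval v) {v : Fin 2 → ℂ} {c : ℂ} (hc : M.1 *ᵥ v = c • v) :
    Q.eval v = 0 := by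
  have hv := h v
  rw [hc, eval_smul] at hv
  have hpos : 0 < normSq c + 1 := add_pos_of_nonneg_of_pos (normSq_nonneg c) one_pos
  exact (mul_eq_zero.1 (by linarith : (normSq c + 1) * Q.eval v = 0)).resolve_left hpos.ne'

theorem apply_one_one_of_mul_self {M : SL2C} (h : M * M = -1) : M 1 1 = -M 0 0 := by
  have hdet := mul_sub_mul_eq_one M
  have h00 : M 0 0 * M 0 0 + M 0 1 * M 1 0 = -1 := by rw [← mul_apply, h]; simp
  have h11 : M 1 0 * M 0 1 + M 1 1 * M 1 1 = -1 := by rw [← mul_apply, h]; simp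
  have hsq : (M 0 0 + M 1 1) ^ 2 = 0 := by linear_combination h00 + h11 + 2 * hdet
  linear_combination pow_eq_zero_iff two_ne_zero |>.1 hsq

theorem neg_mulVec_eq (M : SL2C) (v : Fin 2 → ℂ) : (-M).1 *ᵥ v = -(M.1 *ᵥ v) := by
  rw [Matrix.SpecialLinearGroup.coe_neg, neg_mulVec]

namespace HalfTurnSystem

variable {ι : Type*} (S : HalfTurnSystem ι)

/-- The image of a system of half-turns under a Möbius transformation. -/
def map (g : SL2C) : HalfTurnSystem ι where
  matrix i := g * S.matrix i * g⁻¹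
  form i := (S.form i).comap g⁻¹
  mul_self i := by
    calc g * S.matrix i * g⁻¹ * (g * S.matrix i * g⁻¹) = g * (S.matrix i * S.matrix i) * g⁻¹ := by
          group
      _ = -1 := by rw [S.mul_self, mul_neg_one, neg_mul, mul_inv_cancel]
  eval_mulVec i v := by
    rw [HermForm.eval_comap, HermForm.eval_comap, ← S.eval_mulVec, ← mul_mulVec, ← mul_mulVec,
      mul_assoc, inv_mul_cancel_left]
  disc_pos i := (HermForm.disc_comap g⁻¹ (S.form i)).symm ▸ S.disc_pos i
  eval_pos i j hij v hv := by
    rw [HermForm.eval_comap] at hv ⊢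
    exact S.eval_pos hij _ hv
  subsingleton_inter i j hij := by
    rw [HermForm.zeros_comap, HermForm.zeros_comap, ← Set.preimage_inter]
    exact (S.subsingleton_inter hij).preimage (MulAction.injective _)

theorem halfTurn_map (g : SL2C) (i : ι) :
    (S.map g).halfTurn i = toPSL g * S.halfTurn i * (toPSL g)⁻¹ := by
  rw [halfTurn, map, map_mul, map_mul, map_inv, halfTurn]

theorem halfTurn_map_mul (g : SL2C) (i j : ι) : (S.map g).halfTurn i * (S.map g).halfTurn j =
    toPSL g * (S.halfTurn i * S.halfTurn j) * (toPSL g)⁻¹ := by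
  rw [halfTurn_map, halfTurn_map]
  group

variable {S}

theorem mul_matrix_of_halfTurn_mul_eq {a n : ι} {X : SL2C}
    (h : S.halfTurn a * S.halfTurn n = toPSL X) :
    X * S.matrix n * (X * S.matrix n) = -1 ∧
      ∀ v, (S.form a).eval ((X * S.matrix n).1 *ᵥ v) = -(S.form a).eval v := by
  have ha : toPSL (S.matrix a) = toPSL (X * S.matrix n) := by
    rw [map_mul, ← h, mul_assoc]
    exact (mul_one _).symm.trans (congrArg (S.halfTurn a * ·) (S.halfTurn_mul_self n).symm)
  obtain ha | ha := (toPSL_eq_iff _ _).1 ha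
  · exact ⟨ha ▸ S.mul_self a, fun v => ha ▸ S.eval_mulVec a v⟩
  · rw [← neg_eq_iff_eq_neg] at ha
    refine ⟨by rw [← ha, neg_mul_neg, S.mul_self], fun v => ?_⟩
    rw [← ha, neg_mulVec_eq, ← neg_one_smul ℂ, HermForm.eval_smul, S.eval_mulVec, normSq_neg,
      map_one, one_mul]

theorem four_le_norm_add_re {a n b : ι} (han : a ≠ n) (hab : a ≠ b) (hnb : n ≠ b) {lam : ℂ}
    (hlam : lam ≠ 0) (hs : S.halfTurn a * S.halfTurn n = toPSL matS)
    (ht : S.halfTurn b * S.halfTurn n = toPSL (matT lam)) : 4 ≤ ‖lam‖ + lam.re := by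
  obtain ⟨hA2, hA⟩ := mul_matrix_of_halfTurn_mul_eq hs
  obtain ⟨hB2, hB⟩ := mul_matrix_of_halfTurn_mul_eq ht
  have hN := S.eval_mulVec n
  have h11 := apply_one_one_of_mul_self (S.mul_self n)
  have hA11 := apply_one_one_of_mul_self hA2
  have hB11 := apply_one_one_of_mul_self hB2
  rw [mul_apply, mul_apply] at hA11 hB11
  set N := S.matrix n
  have h01 : N 0 1 = 0 := by simpa [matS, h11] using hA11
  have h10 : N 1 0 = 0 := by simpa [matT, h11, hlam] using hB11
  refine four_le_norm_add_re_of_forms (S.disc_pos a) (S.disc_pos n) (S.disc_pos b)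
    (HermForm.eval_eq_zero_of_mulVec_eq hN (c := N 0 0) ?_)
    (HermForm.eval_eq_zero_of_mulVec_eq hN (c := -N 0 0) ?_)
    (HermForm.eval_eq_zero_of_mulVec_eq hA (c := -N 0 0) ?_)
    (HermForm.eval_eq_zero_of_mulVec_eq hA (c := N 0 0) ?_)
    (HermForm.eval_eq_zero_of_mulVec_eq hB (c := N 0 0) ?_)
    (HermForm.eval_eq_zero_of_mulVec_eq hB (c := -N 0 0) ?_)
    (fun v hv => (S.eval_pos han.symm v hv).le) (fun v hv => (S.eval_pos hnb v hv).le)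
    (S.eval_pos hab)
  all_goals
    ext i
    fin_cases i <;> simp only [mulVec_zero_apply, mulVec_one_apply, mul_apply, Fin.zero_eta,
      Fin.mk_one] <;> simp [matS, matT, h01, h10, h11] <;> ring

theorem eight_le {a n b : ι} (han : a ≠ n) (hab : a ≠ b) (hnb : n ≠ b) {X Y : SL2C}
    (hX : X.1.trace = 2) (hY : Y.1.trace = 2) (hXY : (X * Y).1.trace ≠ 2)
    (hs : S.halfTurn a * S.halfTurn n = toPSL X) (ht : S.halfTurn b * S.halfTurn n = toPSL Y) :
    8 ≤ ‖(X * Y).1.trace - 2‖ + ((X * Y).1.trace - 2).re := by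
  set τ := (X * Y).1.trace - 2 with hτ
  have hτ0 : τ / 2 ≠ 0 := div_ne_zero (sub_ne_zero.2 hXY) two_ne_zero
  obtain ⟨P, hPX, hPY⟩ := exists_conj_standard hX hY (lam := τ / 2) (by rw [← hτ]; ring) hτ0
  have hconj (i : ι) (Z W : SL2C) (h : S.halfTurn i * S.halfTurn n = toPSL Z)
      (hZ : Z = P * W * P⁻¹) : (S.map P⁻¹).halfTurn i * (S.map P⁻¹).halfTurn n = toPSL W := by
    rw [halfTurn_map_mul, h, hZ, ← map_inv, ← map_mul, ← map_mul]
    group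
  have h4 := four_le_norm_add_re han hab hnb hτ0 (hconj a X _ hs hPX) (hconj b Y _ ht hPY)
  rw [norm_div, Complex.norm_ofNat, Complex.div_ofNat_re] at h4
  linarith

variable (S) in
theorem lift_injective [Finite ι] : Function.Injective S.lift :=
  (S.isPingPong S.exists_forall_mem_exterior.choose_spec).lift_injective

variable (S) in
theorem map_lift_evenSubgroup (n : ι) : (evenSubgroup ι).map S.lift =
    Subgroup.closure (Set.range fun i => S.halfTurn i * S.halfTurn n) := by
  rw [← closure_simple_mul_simple n, MonoidHom.map_closure, ← Set.range_comp]
  simp only [Function.comp_def, map_mul, lift_simple]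

end HalfTurnSystem

theorem IsMarkedNSDC.exists_map_lift_eq {A B : PSL2C} (h : IsMarkedNSDC A B) :
    ∃ S : HalfTurnSystem (Fin 3), (evenSubgroup (Fin 3)).map S.lift = Subgroup.closure {A, B} := by
  obtain ⟨S, rfl, rfl⟩ := h.exists_halfTurnSystem
  refine ⟨S, (S.map_lift_evenSubgroup 1).trans (le_antisymm ?_ ?_)⟩
  · rw [Subgroup.closure_le]
    rintro _ ⟨i, rfl⟩
    fin_cases i
    · exact Subgroup.subset_closure (.inl rfl)
    · simp [S.halfTurn_mul_self]
    · exact Subgroup.subset_closure (.inr rfl)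
  · refine Subgroup.closure_mono ?_
    rintro _ (rfl | rfl)
    exacts [⟨0, rfl⟩, ⟨2, rfl⟩]

theorem IsNSDC.exists_halfTurnSystem {X Y : SL2C} (h : IsNSDC (generatedBy X Y)) {p q : Sphere}
    (hX : IsParabolicAt (toPSL X) p) (hY : IsParabolicAt (toPSL Y) q) :
    ∃ (S : HalfTurnSystem (Fin 3)) (a n b : Fin 3), a ≠ n ∧ n ≠ b ∧ a ≠ b ∧
      ∃ X' ∈ ({X, X⁻¹} : Set SL2C), ∃ Y' ∈ ({Y, Y⁻¹} : Set SL2C),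
        S.halfTurn a * S.halfTurn n = toPSL X' ∧ S.halfTurn b * S.halfTurn n = toPSL Y' := by
  obtain ⟨A, B, hAB, hm⟩ := h
  obtain ⟨S, hS⟩ := hm.exists_map_lift_eq
  rw [hAB] at hS
  have hmem (Z : SL2C) (hZ : toPSL Z = toPSL X ∨ toPSL Z = toPSL Y) :
      toPSL Z ∈ (evenSubgroup (Fin 3)).map S.lift := hS ▸ Subgroup.subset_closure hZ
  obtain ⟨x, -, hx⟩ := hmem X (.inl rfl)
  obtain ⟨y, -, hy⟩ := hmem Y (.inr rfl)
  have hxy : Subgroup.closure {x, y} = evenSubgroup (Fin 3) :=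
    Subgroup.map_injective S.lift_injective (by
      rw [hS, MonoidHom.map_closure, Set.image_pair, hx, hy, generatedBy])
  obtain ⟨a, n, b, han, hnb, hab, g, hxg, hyg⟩ :=
    HalfTurnSystem.exists_conj_mem_pair hxy (hx ▸ hX) (hy ▸ hY)
  obtain ⟨G, hG⟩ := toPSL_surjective (S.lift g)
  have hconj_mem (i : Fin 3) (z : FreeInvolutions (Fin 3)) (Z : SL2C) (hz : S.lift z = toPSL Z)
      (hg : g⁻¹ * z * g ∈ ({σ i * σ n, (σ i * σ n)⁻¹} : Set _)) :
      ∃ Z' ∈ ({Z, Z⁻¹} : Set SL2C), (S.map G).halfTurn i * (S.map G).halfTurn n = toPSL Z' := by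
    have hconj : (S.map G).halfTurn i * (S.map G).halfTurn n =
        S.lift (g * (σ i * σ n) * g⁻¹) := by
      simp only [HalfTurnSystem.halfTurn_map_mul, hG, map_mul, map_inv, HalfTurnSystem.lift_simple]
    obtain hg | hg := hg
    · exact ⟨Z, .inl rfl, by rw [hconj, ← hg, ← hz]; group⟩
    · refine ⟨Z⁻¹, .inr rfl, ?_⟩
      rw [hconj, ← inv_inv (σ i * σ n), ← hg, map_inv, ← hz, ← map_inv]
      group
  obtain ⟨X', hX', hs⟩ := hconj_mem a x X hx hxg
  obtain ⟨Y', hY', ht⟩ := hconj_mem b y Y hy hyg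
  exact ⟨S.map G, a, n, b, han, hnb, hab, X', hX', Y', hY', hs, ht⟩

theorem trace_inv_mul (X Y : SL2C) :
    (X⁻¹ * Y).1.trace = X.1.trace * Y.1.trace - (X * Y).1.trace := by
  rw [trace_mul, trace_mul, trace_fin_two, trace_fin_two, SpecialLinearGroup.SL2_inv_expl]
  simp
  ring

theorem trace_mul_sub_two_eq_or_eq_neg {X Y X' Y' : SL2C} (hX : X.1.trace = 2)
    (hY : Y.1.trace = 2) (hX' : X' ∈ ({X, X⁻¹} : Set SL2C)) (hY' : Y' ∈ ({Y, Y⁻¹} : Set SL2C)) :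
    (X' * Y').1.trace - 2 = (X * Y).1.trace - 2 ∨
      (X' * Y').1.trace - 2 = -((X * Y).1.trace - 2) := by
  have hcomm (Z W : SL2C) : (Z * W).1.trace = (W * Z).1.trace := Matrix.trace_mul_comm Z.1 W.1
  obtain rfl | rfl := hX' <;> obtain rfl | rfl := hY'
  · exact .inl rfl
  · right
    rw [hcomm, trace_inv_mul, hcomm, hX, hY]
    ring
  · right
    rw [trace_inv_mul, hX, hY]
    ring
  · left
    rw [← _root_.mul_inv_rev, trace_inv, hcomm]

theorem eight_le_of_isNSDC {X Y : SL2C} (hX : X.1.trace = 2) (hY : Y.1.trace = 2)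
    (hXY : (X * Y).1.trace ≠ 2) (h : IsNSDC (generatedBy X Y)) :
    8 ≤ ‖(X * Y).1.trace - 2‖ + |((X * Y).1.trace - 2).re| := by
  obtain ⟨p, hp⟩ := IsParabolicAt.of_trace hX fun h1 => hXY (by rw [h1, one_mul, hY])
  obtain ⟨q, hq⟩ := IsParabolicAt.of_trace hY fun h1 => hXY (by rw [h1, mul_one, hX])
  obtain ⟨S, a, n, b, han, hnb, hab, X', hX', Y', hY', hs, ht⟩ := h.exists_halfTurnSystem hp hq
  have htrace {Z Z' : SL2C} (hZ : Z.1.trace = 2) (hZ' : Z' ∈ ({Z, Z⁻¹} : Set SL2C)) :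
      Z'.1.trace = 2 := by
    obtain rfl | rfl := hZ'
    exacts [hZ, (trace_inv Z).trans hZ]
  have hτ := trace_mul_sub_two_eq_or_eq_neg hX hY hX' hY'
  have h8 := HalfTurnSystem.eight_le han hab hnb (htrace hX hX') (htrace hY hY')
    (by
      rw [← sub_ne_zero] at hXY ⊢
      obtain h | h := hτ <;> rw [h]
      exacts [hXY, neg_ne_zero.2 hXY]) hs ht
  refine (h8.trans (add_le_add_right (le_abs_self _) _)).trans_eq ?_
  obtain h | h := hτ
  · rw [h]
  · rw [h, norm_neg, neg_re, abs_neg]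

/-! ### Invariance under Möbius transformations -/

theorem HermForm.exists_evalAt_pos_subset {U : Set Sphere} (hU : IsOpen U) {x : Sphere}
    (hx : x ∈ U) : ∃ Q : HermForm, 0 < Q.evalAt x ∧ {z | 0 < Q.evalAt z} ⊆ U := by
  induction x using OnePoint.rec with
  | infty =>
    obtain ⟨-, hK⟩ := (OnePoint.isOpen_iff_of_mem hx).1 hU
    obtain ⟨R, hR0, hR⟩ := hK.isBounded.subset_closedBall_lt 0 0
    refine ⟨ofSphere 0 R, by simp [evalAt_infty, ofSphere], fun z hz => ?_⟩
    induction z using OnePoint.rec with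
    | infty => exact hx
    | coe z =>
      by_contra hzU
      rw [Set.mem_ofPred_eq, evalAt_ofSphere, sub_pos, normSq_eq_norm_sq,
        pow_lt_pow_iff_left₀ hR0.le (norm_nonneg _) two_ne_zero] at hz
      exact hz.not_ge (mem_closedBall_iff_norm.1 (hR hzU))
  | coe x =>
    obtain ⟨r, hr, hball⟩ := Metric.isOpen_iff.1 (hU.preimage OnePoint.continuous_coe) x hx
    refine ⟨(ofSphere x r).scale (-1), ?_, fun z hz => ?_⟩
    · rw [evalAt, eval_scale, ← evalAt, evalAt_ofSphere]
      simpa using pow_pos hr 2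
    · rw [Set.mem_ofPred_eq, evalAt, eval_scale, ← evalAt] at hz
      induction z using OnePoint.rec with
      | infty => norm_num [evalAt_infty, ofSphere] at hz
      | coe z =>
        rw [evalAt_ofSphere, normSq_eq_norm_sq] at hz
        exact hball (mem_ball_iff_norm.2 (lt_of_pow_lt_pow_left₀ 2 hr.le (by linarith)))

theorem continuous_smul_sphere (g : PSL2C) : Continuous fun z : Sphere => g • z := by
  obtain ⟨g, rfl⟩ := toPSL_surjective g
  refine continuous_def.2 fun U hU => isOpen_iff_forall_mem_open.2 fun x hx => ?_
  obtain ⟨Q, hQx, hQ⟩ := HermForm.exists_evalAt_pos_subset hU hx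
  have hpos (z : Sphere) : 0 < (Q.comap g).evalAt z ↔ 0 < Q.evalAt (toPSL g • z) := by
    obtain ⟨r, hr, h⟩ := Q.exists_eval_mulVec_eq g z
    rw [HermForm.evalAt, HermForm.eval_comap, h, mul_pos_iff_of_pos_left hr]
  exact ⟨_, fun z hz => hQ ((hpos z).1 hz), HermForm.isOpen_setOf_evalAt_pos (Q.comap g),
    (hpos x).2 hQx⟩

theorem IsCircle.smul {C : Set Sphere} (h : IsCircle C) (g : PSL2C) : IsCircle (g • C) := by
  obtain ⟨g, rfl⟩ := toPSL_surjective g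
  obtain ⟨Q, hQ, rfl⟩ := isCircle_iff_exists_zeros.1 h
  have hzeros : toPSL g • Q.zeros = (Q.comap g⁻¹).zeros := by
    rw [HermForm.zeros_comap, map_inv, Set.preimage_smul, inv_inv]
  rw [hzeros]
  exact HermForm.isCircle_zeros (by rwa [HermForm.disc_comap])

theorem DisjointOrTangent.smul {C D : Set Sphere} (h : DisjointOrTangent C D) (g : PSL2C) :
    DisjointOrTangent (g • C) (g • D) := by
  rw [DisjointOrTangent, ← Set.smul_set_inter]
  exact Set.Subsingleton.image h _

theorem not_separates_smul {C D E : Set Sphere} (h : ¬Separates C D E) (g : PSL2C) :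
    ¬Separates (g • C) (g • D) (g • E) := by
  rw [Separates, not_not] at h ⊢
  obtain ⟨P, hP, hPC, hD, hE⟩ := h
  refine ⟨g • P, hP.image _ (continuous_smul_sphere g).continuousOn, ?_, ?_, ?_⟩
  · rw [← Set.smul_set_compl]
    exact Set.smul_set_mono hPC
  · rw [← Set.smul_set_inter]
    exact hD.smul_set
  · rw [← Set.smul_set_inter]
    exact hE.smul_set

theorem HasNSDCProperty.smul {a a' n n' b b' : Sphere} (h : HasNSDCProperty a a' n n' b b')
    (g : PSL2C) : HasNSDCProperty (g • a) (g • a') (g • n) (g • n') (g • b) (g • b') := by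
  obtain ⟨ha, hn, hb, CA, CN, CB, hA, hN, hB, haA, haA', hnN, hnN', hbB, hbB', hAN, hNB, hAB,
    sA, sN, sB⟩ := h
  have hinj := MulAction.injective (β := Sphere) g
  have hmem {x : Sphere} {C : Set Sphere} : x ∈ C → g • x ∈ g • C := Set.smul_mem_smul_set
  exact ⟨hinj.ne ha, hinj.ne hn, hinj.ne hb, g • CA, g • CN, g • CB, hA.smul g, hN.smul g,
    hB.smul g, hmem haA, hmem haA', hmem hnN, hmem hnN', hmem hbB, hmem hbB', hAN.smul g,
    hNB.smul g, hAB.smul g, not_separates_smul sA g, not_separates_smul sN g,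
    not_separates_smul sB g⟩

theorem conj_smul_smul (g h : PSL2C) (z : Sphere) : (g * h * g⁻¹) • g • z = g • h • z := by
  rw [← mul_smul, ← mul_smul, inv_mul_cancel_right]

theorem IsHalfTurn.conj_smul {h : PSL2C} {x y : Sphere} (H : IsHalfTurn h x y) (g : PSL2C) :
    IsHalfTurn (g * h * g⁻¹) (g • x) (g • y) := by
  obtain ⟨hxy, h1, hsq, hx, hy⟩ := H
  refine ⟨(MulAction.injective g).ne hxy, ?_, ?_, ?_, ?_⟩
  · rwa [Ne, conj_eq_one_iff]
  · rw [conj_mul, hsq, mul_one, mul_inv_cancel]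
  · rw [conj_smul_smul, hx]
  · rw [conj_smul_smul, hy]

theorem IsAxis.conj_smul {A : PSL2C} {u v : Sphere} (h : IsAxis A u v) (g : PSL2C) :
    IsAxis (g * A * g⁻¹) (g • u) (g • v) := by
  have hfix : {z : Sphere | (g * A * g⁻¹) • z = z} = g • {z : Sphere | A • z = z} := by
    ext z
    rw [Set.mem_smul_set_iff_inv_smul_mem, Set.mem_ofPred_eq, Set.mem_ofPred_eq, eq_inv_smul_iff,
      mul_assoc, mul_smul, mul_smul]
  rw [IsAxis, hfix, h, Set.smul_set_insert, Set.smul_set_singleton]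

theorem IsPerp.smul {x y u v : Sphere} (h : IsPerp x y u v) (g : PSL2C) :
    IsPerp (g • x) (g • y) (g • u) (g • v) := by
  obtain ⟨t, ht, huv⟩ := h
  exact ⟨g * t * g⁻¹, ht.conj_smul g, by rw [conj_smul_smul, huv]⟩

theorem IsOrthoEnd.conj_smul {A B : PSL2C} {a a' n n' b b' : Sphere}
    (h : IsOrthoEnd A B a a' n n' b b') (g : PSL2C) :
    IsOrthoEnd (g * A * g⁻¹) (g * B * g⁻¹) (g • a) (g • a') (g • n) (g • n') (g • b) (g • b') := by
  obtain ⟨⟨u, v, hu, hn⟩, ⟨u', v', hu', hn'⟩, ⟨hA, hN, hB, ha, hn'', hb, rfl, rfl⟩⟩ := h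
  exact ⟨⟨_, _, hu.conj_smul g, hn.smul g⟩, ⟨_, _, hu'.conj_smul g, hn'.smul g⟩,
    ⟨_, _, _, ha.conj_smul g, hn''.conj_smul g, hb.conj_smul g, conj_mul.symm, conj_mul.symm⟩⟩

/-! ### Elementary groups with two parabolic generators -/

theorem cross_mulVec_add_cross_mulVec (M : Matrix (Fin 2) (Fin 2) ℂ) (v w : Fin 2 → ℂ) :
    cross (M *ᵥ v) w + cross v (M *ᵥ w) = M.trace * cross v w := by
  simp only [cross, mulVec_fin_two, cons_val_zero, cons_val_one, trace_fin_two]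
  ring

theorem trace_eq_two_of_mulVec_eq {M : SL2C} {v : Fin 2 → ℂ} (hv : v ≠ 0)
    (h : M.1 *ᵥ v = v) : M.1.trace = 2 := by
  obtain ⟨w, hw⟩ := exists_cross_ne_zero hv
  have hdet := cross_mulVec M v w
  rw [h] at hdet
  have htr := cross_mulVec_add_cross_mulVec M.1 v w
  rw [h, hdet, ← two_mul] at htr
  exact (mul_right_cancel₀ hw htr).symm

theorem exists_mulVec_eq_of_trace_mul_eq_two {S T : SL2C} (hS : S.1.trace = 2)
    (hT : T.1.trace = 2) (hST : (S * T).1.trace = 2) :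
    ∃ u ≠ 0, S.1 *ᵥ u = u ∧ T.1 *ᵥ u = u := by
  by_cases hS1 : S = 1
  · by_cases hT1 : T = 1
    · exact ⟨vec OnePoint.infty, vec_ne_zero _, by simp [hS1], by simp [hT1]⟩
    · obtain ⟨v, hv⟩ := exists_mulVec_sub_ne_zero hT1
      exact ⟨_, hv, by simp [hS1], mulVec_sub_of_trace_eq_two hT v⟩
  obtain ⟨v, hv⟩ := exists_mulVec_sub_ne_zero hS1
  obtain ⟨u, hu⟩ : ∃ u, S.1 *ᵥ v - v = u := ⟨_, rfl⟩
  have hSu : S.1 *ᵥ u = u := by rw [← hu, mulVec_sub_of_trace_eq_two hS]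
  have hSv : S.1 *ᵥ v = v + u := by rw [← hu, add_sub_cancel]
  rw [hu] at hv
  -- In a basis `u, v` with `S u = u` and `S v = v + u`, the trace of `T * S` exceeds that of `T` by
  -- a multiple of `cross u (T u)`.
  have hcross : cross u (T.1 *ᵥ u) = 0 := by
    have h1 := cross_mulVec_add_cross_mulVec T.1 u v
    have h2 := cross_mulVec_add_cross_mulVec (T * S).1 u v
    have hTS : (T * S).1.trace = 2 := (Matrix.trace_mul_comm T.1 S.1).trans hST
    rw [hTS, mul_mulVec, mul_mulVec, hSu, hSv, mulVec_add] at h2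
    rw [hT] at h1
    simp only [cross, Pi.add_apply] at h1 h2 ⊢
    linear_combination h2 - h1
  obtain ⟨c, hc⟩ := exists_eq_smul_of_cross_eq_zero hv hcross
  exact ⟨u, hv, hSu, mulVec_eq_of_trace_eq_two hT hv hc⟩

theorem exists_forall_smul_eq_of_trace_mul_eq_two {S T : SL2C} (hS : S.1.trace = 2)
    (hT : T.1.trace = 2) (hST : (S * T).1.trace = 2) :
    ∃ z : Sphere, ∀ g ∈ generatedBy S T, g • z = z := by
  obtain ⟨u, hu, hSu, hTu⟩ := exists_mulVec_eq_of_trace_mul_eq_two hS hT hST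
  obtain ⟨z, c, hc, rfl⟩ := exists_eq_smul_vec hu
  have hfix {X : SL2C} (hX : X.1 *ᵥ (c • vec z) = c • vec z) : toPSL X • z = z := by
    rw [mulVec_smul] at hX
    exact toPSL_smul_eq_iff.2 ⟨1, (smul_right_injective _ hc hX).trans (one_smul ℂ _).symm⟩
  have hle : generatedBy S T ≤ MulAction.stabilizer PSL2C z := by
    rw [generatedBy, Subgroup.closure_le]
    rintro g (rfl | rfl)
    exacts [hfix hSu, hfix hTu]
  exact ⟨z, fun g hg => hle hg⟩

theorem mulVec_vec_eq_of_finite_range {X : SL2C} (hX : X.1.trace = 2) {z : Sphere}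
    (h : (Set.range fun n : ℕ => toPSL X ^ n • z).Finite) : X.1 *ᵥ vec z = vec z := by
  obtain ⟨m, n, hmn, heq⟩ := h.exists_lt_map_eq_of_forall_mem fun n : ℕ => Set.mem_range_self n
  obtain ⟨d, rfl⟩ := exists_add_of_le hmn.le
  have hd : (d : ℂ) ≠ 0 := Nat.cast_ne_zero.2 (by omega)
  have hfix : toPSL (X ^ d) • z = z := by
    rw [map_pow]
    exact MulAction.injective (toPSL X ^ m) (by simpa only [pow_add, mul_smul] using heq.symm)
  obtain ⟨c, hc⟩ := toPSL_smul_eq_iff.1 hfix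
  refine mulVec_eq_of_trace_eq_two hX (vec_ne_zero z) (c := 1 + (d : ℂ)⁻¹ * (c - 1)) ?_
  rw [pow_mulVec_of_trace_eq_two hX, ← eq_sub_iff_add_eq'] at hc
  rw [add_smul, one_smul, mul_smul, sub_smul, one_smul, ← hc, inv_smul_smul₀ hd, add_sub_cancel]

theorem coe_pow_of_trace_eq_two {X : SL2C} (hX : X.1.trace = 2) (n : ℕ) :
    (X ^ n).1 = 1 + (n : ℂ) • (X.1 - 1) := by
  refine Matrix.ext_of_mulVec_single fun i => ?_
  rw [pow_mulVec_of_trace_eq_two hX, add_mulVec, smul_mulVec, sub_mulVec, one_mulVec]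

theorem infinite_range_halfSpaceMap_of_apply_one_zero_eq_zero {X : SL2C} (hX : X.1.trace = 2)
    (hX1 : X ≠ 1) (hc : X 1 0 = 0) (p : ℂ × ℝ) :
    (Set.range fun n : ℕ => halfSpaceMap (X ^ n) p).Infinite := by
  have h00 : X 0 0 = 1 := by
    have h := mulVec_eq_of_trace_eq_two hX (vec_ne_zero OnePoint.infty) (c := X 0 0)
      (by ext i; fin_cases i <;> simp [mulVec_zero_apply, mulVec_one_apply, hc])
    simpa [mulVec_zero_apply] using congrFun h 0
  have h11 : X 1 1 = 1 := by
    rw [trace_fin_two] at hX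
    linear_combination hX - h00
  have h01 : X 0 1 ≠ 0 := fun hb => hX1 (by
    ext i j
    fin_cases i <;> fin_cases j <;> simp [h00, h11, hb, hc])
  have hpow (n : ℕ) : (X ^ n) 0 0 = 1 ∧ (X ^ n) 0 1 = n * X 0 1 ∧ (X ^ n) 1 0 = 0 ∧
      (X ^ n) 1 1 = 1 := by
    have h (i j : Fin 2) := congrFun (congrFun (coe_pow_of_trace_eq_two hX n) i) j
    refine ⟨(h 0 0).trans ?_, (h 0 1).trans ?_, (h 1 0).trans ?_, (h 1 1).trans ?_⟩ <;>
      simp [h00, h11, hc]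
  refine Set.infinite_range_of_injective fun m n hmn => ?_
  have hfst := congrArg Prod.fst hmn
  simp only [halfSpaceMap, hpow] at hfst
  simpa [h01] using hfst

theorem infinite_range_halfSpaceMap_of_apply_one_zero_ne_zero {X : SL2C} (hX : X.1.trace = 2)
    (hc : X 1 0 ≠ 0) {p : ℂ × ℝ} (hp : 0 < p.2) :
    (Set.range fun n : ℕ => halfSpaceMap (X ^ n) p).Infinite := by
  intro hfin
  have hle (n : ℕ) : (n : ℝ) * (‖X 1 0‖ ^ 2 * p.2 ^ 2) ≤ p.2 / (halfSpaceMap (X ^ n) p).2 := by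
    have h10 : (X ^ n) 1 0 = n * X 1 0 := by
      refine (congrFun (congrFun (coe_pow_of_trace_eq_two hX n) 1) 0).trans ?_
      simp
    have hn : (n : ℝ) ≤ n ^ 2 := mod_cast Nat.le_self_pow two_ne_zero n
    simp only [halfSpaceMap]
    rw [div_div_cancel₀ hp.ne', h10, norm_mul, Complex.norm_natCast, mul_pow, mul_assoc (_ ^ 2)]
    exact (mul_le_mul_of_nonneg_right hn (by positivity)).trans
      (le_add_of_nonneg_left (sq_nonneg _))
  have htop : Tendsto (fun n : ℕ => p.2 / (halfSpaceMap (X ^ n) p).2) atTop atTop :=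
    tendsto_atTop_mono hle (tendsto_natCast_atTop_atTop.atTop_mul_const (by positivity))
  refine not_bddAbove_of_tendsto_atTop htop ?_
  have := (hfin.image fun q : ℂ × ℝ => p.2 / q.2).bddAbove
  rwa [← Set.range_comp] at this

theorem isElementary_generatedBy_iff {S T : SL2C} (hS : S.1.trace = 2) (hT : T.1.trace = 2) :
    IsElementary (generatedBy S T) ↔ (S * T).1.trace = 2 := by
  have hmem {X : SL2C} (hX : X = S ∨ X = T) (n : ℕ) : toPSL (X ^ n) ∈ generatedBy S T := by
    rw [map_pow]
    refine Subgroup.pow_mem _ (Subgroup.subset_closure ?_) n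
    exact hX.imp (congrArg toPSL) (congrArg toPSL)
  constructor
  · rintro (⟨z, hz⟩ | ⟨p, hp, hfin⟩)
    · have hfix {X : SL2C} (hX : X = S ∨ X = T) (htr : X.1.trace = 2) :
          X.1 *ᵥ vec z = vec z :=
        mulVec_vec_eq_of_finite_range htr (hz.subset (by
          rintro _ ⟨n, rfl⟩
          exact ⟨_, hmem hX n, by rw [map_pow]⟩))
      refine trace_eq_two_of_mulVec_eq (vec_ne_zero z) ?_
      rw [mul_mulVec, hfix (.inr rfl) hT, hfix (.inl rfl) hS]
    · by_contra hST
      have hS1 : S ≠ 1 := fun h1 => hST (by rw [h1, one_mul, hT])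
      have hsub : (Set.range fun n : ℕ => halfSpaceMap (S ^ n) p).Finite :=
        hfin.subset (by
          rintro _ ⟨n, rfl⟩
          exact ⟨_, hmem (.inl rfl) n, rfl⟩)
      by_cases hc : S 1 0 = 0
      · exact infinite_range_halfSpaceMap_of_apply_one_zero_eq_zero hS hS1 hc p hsub
      · exact infinite_range_halfSpaceMap_of_apply_one_zero_ne_zero hS hc hp hsub
  · intro hST
    obtain ⟨z, hz⟩ := exists_forall_smul_eq_of_trace_mul_eq_two hS hT hST
    refine .inl ⟨z, (Set.finite_singleton z).subset ?_⟩
    rintro _ ⟨g, hg, rfl⟩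
    exact hz g hg

/-! ### The standard pair of parabolics -/

theorem IsParabolicAt.isAxis {g : PSL2C} {p : Sphere} (h : IsParabolicAt g p) : IsAxis g p p := by
  obtain ⟨M, rfl, ht, h1, hp⟩ := h
  rw [IsAxis, Set.pair_eq_singleton]
  refine Set.eq_singleton_iff_unique_mem.2 ⟨hp, fun z hz => ?_⟩
  have hfix {w : Sphere} (hw : toPSL M • w = w) : M.1 *ᵥ vec w = vec w := by
    obtain ⟨c, hc⟩ := toPSL_smul_eq_iff.1 hw
    exact mulVec_eq_of_trace_eq_two ht (vec_ne_zero w) hc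
  by_contra hne
  exact h1 (eq_one_of_mulVec_eq (hfix hz) (hfix hp) (cross_vec_eq_zero_iff.not.2 hne))

theorem trace_matS : matS.1.trace = 2 := by
  norm_num [trace_fin_two, matS]

theorem trace_matT (lam : ℂ) : (matT lam).1.trace = 2 := by
  norm_num [trace_fin_two, matT]

theorem trace_matS_mul_matT (lam : ℂ) : (matS * matT lam).1.trace - 2 = 2 * lam := by
  rw [trace_mul]
  simp [matS, matT]
  ring

theorem isParabolicAt_matS : IsParabolicAt (toPSL matS) ((0 : ℂ) : Sphere) := by
  refine ⟨matS, rfl, trace_matS, fun h => ?_, ?_⟩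
  · simpa [matS] using congrArg (fun M : SL2C => M 1 0) h
  · rw [toPSL_smul_coe]
    simp [matS]

theorem isParabolicAt_matT {lam : ℂ} (hlam : lam ≠ 0) :
    IsParabolicAt (toPSL (matT lam)) OnePoint.infty := by
  refine ⟨matT lam, rfl, trace_matT lam, fun h => hlam ?_, ?_⟩
  · simpa [matT] using congrArg (fun M : SL2C => M 0 1) h
  · rw [toPSL_smul_infty]
    simp [matT]

theorem isHalfTurn_toPSL {X : SL2C} (h : X * X = -1) {x y : Sphere} (hxy : x ≠ y)
    (hx : toPSL X • x = x) (hy : toPSL X • y = y) : IsHalfTurn (toPSL X) x y := by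
  refine ⟨hxy, fun h1 => ?_, ?_, hx, hy⟩
  · have hsq : X * X = 1 := by
      obtain rfl | rfl := (toPSL_eq_one_iff X).1 h1 <;> simp
    have h00 := congrArg (fun M : SL2C => M 0 0) (hsq.symm.trans h)
    norm_num at h00
  · rw [← map_mul, h, toPSL_eq_one_iff]
    exact Or.inr rfl

/-- The matrix of the half-turn about the line with ends `0` and `∞`. -/
def matN : SL2C := ⟨!![I, 0; 0, -I], by simp⟩

theorem matN_mul_self : matN * matN = -1 := by
  ext i j
  rw [mul_apply]
  fin_cases i <;> fin_cases j <;> simp [matN]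

theorem isHalfTurn_matN : IsHalfTurn (toPSL matN) ((0 : ℂ) : Sphere) OnePoint.infty := by
  refine isHalfTurn_toPSL matN_mul_self (OnePoint.coe_ne_infty _) ?_ ?_
  · rw [toPSL_smul_coe]
    simp [matN]
  · rw [toPSL_smul_infty]
    simp [matN]

theorem isHalfTurn_matS_mul_matN :
    IsHalfTurn (toPSL (matS * matN)) ((0 : ℂ) : Sphere) ((2 : ℂ) : Sphere) := by
  refine isHalfTurn_toPSL ?_ (by simp) (toPSL_smul_eq_iff.2 ⟨-I, ?_⟩) (toPSL_smul_eq_iff.2 ⟨I, ?_⟩)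
  · ext i j
    fin_cases i <;> fin_cases j <;> simp only [Fin.zero_eta, Fin.mk_one, mul_apply] <;>
      simp [matN, matS]
  all_goals
    ext i
    fin_cases i <;>
      simp only [Fin.zero_eta, Fin.mk_one, mulVec_zero_apply, mulVec_one_apply, mul_apply] <;>
      simp [matN, matS]
  ring

theorem isHalfTurn_matT_mul_matN (lam : ℂ) :
    IsHalfTurn (toPSL (matT lam * matN)) (lam : Sphere) OnePoint.infty := by
  refine isHalfTurn_toPSL ?_ (OnePoint.coe_ne_infty _) (toPSL_smul_eq_iff.2 ⟨-I, ?_⟩)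
    (toPSL_smul_eq_iff.2 ⟨I, ?_⟩)
  · ext i j
    fin_cases i <;> fin_cases j <;> simp only [Fin.zero_eta, Fin.mk_one, mul_apply] <;>
      simp [matN, matT]
    ring
  all_goals
    ext i
    fin_cases i <;>
      simp only [Fin.zero_eta, Fin.mk_one, mulVec_zero_apply, mulVec_one_apply, mul_apply] <;>
      simp [matN, matT]
  ring

theorem isOrthoEnd_matS_matT {lam : ℂ} (hlam : lam ≠ 0) :
    IsOrthoEnd (toPSL matS) (toPSL (matT lam)) ((0 : ℂ) : Sphere) ((2 : ℂ) : Sphere)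
      ((0 : ℂ) : Sphere) OnePoint.infty (lam : Sphere) OnePoint.infty := by
  have hN := isHalfTurn_matN
  have hfactor (X : SL2C) : toPSL X = toPSL (X * matN) * toPSL matN := by
    rw [map_mul, mul_assoc, hN.2.2.1, mul_one]
  exact ⟨⟨_, _, isParabolicAt_matS.isAxis, _, hN, hN.2.2.2.1⟩,
    ⟨_, _, (isParabolicAt_matT hlam).isAxis, _, hN, hN.2.2.2.2⟩,
    ⟨_, _, _, isHalfTurn_matS_mul_matN, hN, isHalfTurn_matT_mul_matN lam, hfactor _, hfactor _⟩⟩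

theorem not_separates_of_mem {C D E : Set Sphere} {x : Sphere} (hC : x ∉ C) (hD : x ∈ D)
    (hE : x ∈ E) : ¬Separates C D E := by
  rw [Separates, not_not]
  exact ⟨{x}, isPreconnected_singleton, Set.singleton_subset_iff.2 hC, ⟨x, rfl, hD⟩, ⟨x, rfl, hE⟩⟩

/-- The form of the circle `|z|² = Re (u z)` through `0`. -/
def HermForm.circleAtZero (u : ℂ) : HermForm := ⟨1, 0, -u / 2⟩

/-- The form of the line `Re (u z) = s`. -/
def HermForm.line (u : ℂ) (s : ℝ) : HermForm := ⟨0, -s, u / 2⟩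

theorem coe_mem_zeros_circleAtZero {u z : ℂ} :
    (z : Sphere) ∈ (HermForm.circleAtZero u).zeros ↔ normSq z = (u * z).re := by
  rw [HermForm.zeros, Set.mem_ofPred_eq, HermForm.evalAt_coe, ← sub_eq_zero (a := normSq z)]
  simp only [HermForm.circleAtZero, div_mul_eq_mul_div, neg_mul, div_ofNat_re, neg_re]
  ring_nf

theorem infty_notMem_zeros_circleAtZero (u : ℂ) :
    OnePoint.infty ∉ (HermForm.circleAtZero u).zeros := by
  simp [HermForm.zeros, HermForm.evalAt_infty, HermForm.circleAtZero]

theorem coe_mem_zeros_line {u z : ℂ} {s : ℝ} :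
    (z : Sphere) ∈ (HermForm.line u s).zeros ↔ (u * z).re = s := by
  rw [HermForm.zeros, Set.mem_ofPred_eq, HermForm.evalAt_coe, ← sub_eq_zero (b := s)]
  simp only [HermForm.line, div_mul_eq_mul_div, div_ofNat_re]
  ring_nf

theorem infty_mem_zeros_line (u : ℂ) (s : ℝ) : OnePoint.infty ∈ (HermForm.line u s).zeros := by
  simp [HermForm.zeros, HermForm.evalAt_infty, HermForm.line]

theorem isCircle_zeros_circleAtZero {u : ℂ} (hu : u ≠ 0) :
    IsCircle (HermForm.circleAtZero u).zeros :=
  HermForm.isCircle_zeros (by simpa [HermForm.disc, HermForm.circleAtZero] using hu)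

theorem isCircle_zeros_line {u : ℂ} (hu : u ≠ 0) (s : ℝ) : IsCircle (HermForm.line u s).zeros :=
  HermForm.isCircle_zeros (by simpa [HermForm.disc, HermForm.line] using hu)

theorem disjointOrTangent_circleAtZero_line {u : ℂ} {s : ℝ} (h : s = 0 ∨ normSq u ≤ s) :
    DisjointOrTangent (HermForm.circleAtZero u).zeros (HermForm.line u s).zeros := by
  suffices hz : ∀ z : ℂ, normSq z = (u * z).re → (u * z).re = s →
      z = if s = 0 then 0 else conj u by
    refine Set.subsingleton_of_subset_singleton
      (a := ((if s = 0 then 0 else conj u : ℂ) : Sphere)) fun z ⟨hz1, hz2⟩ => ?_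
    induction z using OnePoint.rec with
    | infty => exact absurd hz1 (infty_notMem_zeros_circleAtZero u)
    | coe z =>
      exact congrArg _ (hz z (coe_mem_zeros_circleAtZero.1 hz1) (coe_mem_zeros_line.1 hz2))
  intro z hz1 hz2
  split_ifs with hs
  · rw [← normSq_eq_zero, hz1, hz2, hs]
  · have hsub : normSq (z - conj u) = normSq u - s := by
      rw [normSq_sub, hz1, normSq_conj, conj_conj, mul_comm z, hz2]
      ring
    have hle := h.resolve_left hs
    exact sub_eq_zero.1 (normSq_eq_zero.1 (le_antisymm (by linarith) (normSq_nonneg _)))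

theorem disjointOrTangent_line_line {u : ℂ} {s t : ℝ} (h : s ≠ t) :
    DisjointOrTangent (HermForm.line u s).zeros (HermForm.line u t).zeros := by
  refine Set.subsingleton_of_subset_singleton (a := OnePoint.infty) fun z ⟨hs, ht⟩ => ?_
  induction z using OnePoint.rec with
  | infty => rfl
  | coe z => exact absurd ((coe_mem_zeros_line.1 hs).symm.trans (coe_mem_zeros_line.1 ht)) h

theorem not_separates_line {u a b : ℂ} {s : ℝ} {D E : Set Sphere} (haD : (a : Sphere) ∈ D)
    (hbE : (b : Sphere) ∈ E) (ha : s < (u * a).re) (hb : s < (u * b).re) :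
    ¬Separates (HermForm.line u s).zeros D E := by
  have hconv : Convex ℝ {z : ℂ | s < (u * z).re} :=
    convex_halfSpace_gt ((reLm.comp (LinearMap.mulLeft ℝ u)).isLinear) s
  rw [Separates, not_not]
  refine ⟨_, hconv.isPreconnected.image _ OnePoint.continuous_coe.continuousOn, ?_,
    ⟨a, ⟨a, ha, rfl⟩, haD⟩, ⟨b, ⟨b, hb, rfl⟩, hbE⟩⟩
  rintro _ ⟨z, hz, rfl⟩ h
  exact hz.ne' (coe_mem_zeros_line.1 h)

theorem hasNSDCProperty_of_le {u a b : ℂ} (ha0 : a ≠ 0) (ha : (u * a).re = normSq a)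
    (hb : normSq u ≤ (u * b).re) :
    HasNSDCProperty ((0 : ℂ) : Sphere) (a : Sphere) ((0 : ℂ) : Sphere) OnePoint.infty
      (b : Sphere) OnePoint.infty := by
  have ha_pos : 0 < (u * a).re := ha ▸ normSq_pos.2 ha0
  have hu : u ≠ 0 := by
    rintro rfl
    simp at ha_pos
  have hb_pos : 0 < (u * b).re := (normSq_pos.2 hu).trans_le hb
  have ha_mem := coe_mem_zeros_circleAtZero.2 ha.symm
  have hb_mem := (coe_mem_zeros_line (u := u)).2 (rfl : (u * b).re = _)
  have h0A : ((0 : ℂ) : Sphere) ∈ (HermForm.circleAtZero u).zeros :=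
    coe_mem_zeros_circleAtZero.2 (by simp)
  have h0N : ((0 : ℂ) : Sphere) ∈ (HermForm.line u 0).zeros := coe_mem_zeros_line.2 (by simp)
  have h0B : ((0 : ℂ) : Sphere) ∉ (HermForm.line u (u * b).re).zeros := fun h =>
    hb_pos.ne (by simpa using coe_mem_zeros_line.1 h)
  exact ⟨by simpa using ha0.symm, OnePoint.coe_ne_infty _, OnePoint.coe_ne_infty _, _, _, _,
    isCircle_zeros_circleAtZero hu, isCircle_zeros_line hu 0, isCircle_zeros_line hu (u * b).re,
    h0A, ha_mem, h0N, infty_mem_zeros_line u 0, hb_mem, infty_mem_zeros_line u _,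
    disjointOrTangent_circleAtZero_line (Or.inl rfl), disjointOrTangent_line_line hb_pos.ne,
    disjointOrTangent_circleAtZero_line (Or.inr hb),
    not_separates_of_mem (infty_notMem_zeros_circleAtZero u) (infty_mem_zeros_line u 0)
      (infty_mem_zeros_line u _),
    not_separates_line ha_mem hb_mem ha_pos hb_pos, not_separates_of_mem h0B h0A h0N⟩

theorem hasNSDCProperty_standard {lam : ℂ} (h : 4 ≤ ‖lam‖ + lam.re) :
    HasNSDCProperty ((0 : ℂ) : Sphere) ((2 : ℂ) : Sphere) ((0 : ℂ) : Sphere) OnePoint.infty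
      (lam : Sphere) OnePoint.infty := by
  have hsq : ‖lam‖ ^ 2 = lam.re ^ 2 + lam.im ^ 2 := by
    rw [← normSq_eq_norm_sq, normSq_apply]
    ring
  have him : 16 ≤ 8 * lam.re + lam.im ^ 2 := by
    nlinarith [re_le_norm lam]
  -- The circle passes through `2` when `u = 2 + t i`; `Re (u λ) - |u|²` is largest at this `t`.
  refine hasNSDCProperty_of_le (u := ⟨2, -lam.im / 2⟩) two_ne_zero ?_ ?_
  · simp
  · simp only [normSq_apply, mul_re]
    linarith

/-! ### The criterion -/

theorem isMarkedNSDC_of_eight_le {S T : SL2C} (hS : S.1.trace = 2) (hT : T.1.trace = 2)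
    (h : 8 ≤ ‖(S * T).1.trace - 2‖ + ((S * T).1.trace - 2).re) :
    IsMarkedNSDC (toPSL S) (toPSL T) := by
  have hne : (S * T).1.trace ≠ 2 := fun h2 => by
    rw [h2] at h
    norm_num at h
  set lam : ℂ := ((S * T).1.trace - 2) / 2 with hlam
  have hlam0 : lam ≠ 0 := div_ne_zero (sub_ne_zero.2 hne) two_ne_zero
  obtain ⟨P, hPS, hPT⟩ :=
    exists_conj_standard hS hT (mul_div_cancel₀ _ two_ne_zero).symm hlam0
  have h4 : 4 ≤ ‖lam‖ + lam.re := by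
    rw [hlam, norm_div, Complex.norm_ofNat, Complex.div_ofNat_re]
    linarith
  refine ⟨fun he => hne ((isElementary_generatedBy_iff hS hT).1 he), _, _, _, _, _, _, ?_,
    (hasNSDCProperty_standard h4).smul (toPSL P)⟩
  rw [hPS, hPT]
  simpa only [map_mul, map_inv] using (isOrthoEnd_matS_matT hlam0).conj_smul (toPSL P)

theorem generatedBy_inv_left (S T : SL2C) : generatedBy S⁻¹ T = generatedBy S T := by
  have hle (X : SL2C) : generatedBy X⁻¹ T ≤ generatedBy X T := by
    rw [generatedBy, Subgroup.closure_le, Set.pair_subset_iff, map_inv]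
    exact ⟨inv_mem (Subgroup.subset_closure (by simp)), Subgroup.subset_closure (by simp)⟩
  exact (hle S).antisymm (by simpa using hle S⁻¹)

theorem isNSDC_of_eight_le {S T : SL2C} (hS : S.1.trace = 2) (hT : T.1.trace = 2)
    (h : 8 ≤ ‖(S * T).1.trace - 2‖ + |((S * T).1.trace - 2).re|) : IsNSDC (generatedBy S T) := by
  rcases abs_choice ((S * T).1.trace - 2).re with habs | habs <;> rw [habs] at h
  · exact ⟨_, _, rfl, isMarkedNSDC_of_eight_le hS hT h⟩
  · have htrace : (S⁻¹ * T).1.trace - 2 = -((S * T).1.trace - 2) := by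
      rw [trace_inv_mul, hS, hT]
      ring
    rw [← generatedBy_inv_left]
    refine ⟨_, _, rfl, isMarkedNSDC_of_eight_le (by rwa [trace_inv]) hT ?_⟩
    rwa [htrace, norm_neg, neg_re]

theorem isNSDC_generatedBy_iff {S T : SL2C} (hS : S.1.trace = 2) (hT : T.1.trace = 2) :
    IsNSDC (generatedBy S T) ↔ 8 ≤ ‖(S * T).1.trace - 2‖ + |((S * T).1.trace - 2).re| := by
  refine ⟨fun h => eight_le_of_isNSDC hS hT (fun h2 => ?_) h, isNSDC_of_eight_le hS hT⟩
  obtain ⟨A, B, hAB, hne, -⟩ := h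
  exact hne (hAB ▸ (isElementary_generatedBy_iff hS hT).2 h2)

theorem discreteTopology_of_isNSDC {G : Subgroup PSL2C} (h : IsNSDC G) : DiscreteTopology G := by
  obtain ⟨A, B, rfl, hm⟩ := h
  obtain ⟨S, rfl, rfl⟩ := hm.exists_halfTurnSystem
  have hmem (i) : S.halfTurn i ∈ Subgroup.closure (Set.range S.halfTurn) :=
    Subgroup.subset_closure ⟨i, rfl⟩
  refine S.discreteTopology ?_
  rw [Subgroup.closure_le, Set.pair_subset_iff]
  exact ⟨mul_mem (hmem 0) (hmem 1), mul_mem (hmem 2) (hmem 1)⟩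

theorem isNSDC_groupG_iff (lam : ℂ) : IsNSDC (groupG lam) ↔ 4 ≤ ‖lam‖ + |lam.re| := by
  rw [groupG, isNSDC_generatedBy_iff trace_matS (trace_matT lam), trace_matS_mul_matT, norm_mul,
    Complex.norm_ofNat]
  simp only [mul_re, re_ofNat, im_ofNat, zero_mul, sub_zero, abs_mul, Nat.abs_ofNat]
  constructor <;> intro h <;> linarith

theorem frontier_setOf_four_le_norm_add_abs_re :
    frontier {lam : ℂ | 4 ≤ ‖lam‖ + |lam.re|} = {lam : ℂ | ‖lam‖ + |lam.re| = 4} := by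
  have hc : Continuous fun lam : ℂ => ‖lam‖ + |lam.re| :=
    continuous_norm.add continuous_re.abs
  refine ((frontier_le_subset_eq continuous_const hc).trans fun lam h => Eq.symm h).antisymm
    fun lam (hlam : _ = _) => ?_
  rw [frontier_eq_closure_inter_closure]
  refine ⟨subset_closure hlam.ge, ?_⟩
  have htend : Tendsto (fun t : ℝ => (t : ℂ) * lam) (nhdsWithin 1 (Set.Ioo 0 1)) (nhds lam) := by
    have hcont : Continuous fun t : ℝ => (t : ℂ) * lam := by fun_prop
    simpa using (hcont.tendsto 1).mono_left nhdsWithin_le_nhds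
  have : (nhdsWithin (1 : ℝ) (Set.Ioo 0 1)).NeBot := right_nhdsWithin_Ioo_neBot zero_lt_one
  refine mem_closure_of_tendsto htend ?_
  filter_upwards [self_mem_nhdsWithin] with t ⟨h0, h1⟩
  rw [Set.mem_compl_iff, Set.mem_ofPred_eq, not_le, re_ofReal_mul, norm_mul, abs_mul,
    Complex.norm_real, Real.norm_eq_abs, ← mul_add, hlam, abs_of_pos h0]
  linarith

theorem frontier_setOf_isNSDC_groupG :
    frontier {lam : ℂ | IsNSDC (groupG lam)} = {lam : ℂ | ‖lam‖ + |lam.re| = 4} := by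
  simp only [isNSDC_groupG_iff, frontier_setOf_four_le_norm_add_abs_re]

theorem norm_mul_one_add_abs_cos {lam : ℂ} {ω : ℝ} (h : lam = (‖lam‖ : ℂ) * exp ((ω : ℂ) * I)) :
    ‖lam‖ * (1 + |Real.cos ω|) = ‖lam‖ + |lam.re| := by
  have hre : lam.re = ‖lam‖ * Real.cos ω := by
    conv_lhs => rw [h, re_ofReal_mul, exp_ofReal_mul_I_re]
  rw [hre, abs_mul, abs_norm]
  ring

theorem norm_add_abs_re_eq_four_iff (lam : ℂ) :
    ‖lam‖ + |lam.re| = 4 ↔ lam.im ^ 2 = 16 - 8 * |lam.re| := by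
  have hsq : |lam.re| ^ 2 + lam.im ^ 2 = ‖lam‖ ^ 2 := by
    rw [sq_abs, ← normSq_eq_norm_sq, normSq_apply]
    ring
  constructor
  · intro h
    rw [eq_sub_of_add_eq h] at hsq
    linarith
  · intro h
    have hnonneg : 0 ≤ 4 - |lam.re| := by linarith [sq_nonneg lam.im]
    have h2 : ‖lam‖ ^ 2 = (4 - |lam.re|) ^ 2 := by
      rw [← hsq, h]
      ring
    rw [sq_eq_sq₀ (norm_nonneg _) hnonneg] at h2
    linarith

end TwoParabolic

end

theorem corollary5p13 :
    -- the criterion in polar coordinates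
    (∀ (lam : ℂ) (ω : ℝ), lam = (‖lam‖ : ℂ) * Complex.exp ((ω : ℂ) * Complex.I) →
      (TwoParabolic.IsNSDC (TwoParabolic.groupG lam) ↔ 4 ≤ ‖lam‖ * (1 + |Real.cos ω|))) ∧
    -- the boundary of the space of such groups, in polar and in Euclidean coordinates
    (frontier {lam : ℂ | TwoParabolic.IsNSDC (TwoParabolic.groupG lam)} =
      {lam : ℂ | ∃ ω : ℝ, lam = (‖lam‖ : ℂ) * Complex.exp ((ω : ℂ) * Complex.I) ∧
        ‖lam‖ * (1 + |Real.cos ω|) = 4}) ∧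
    (frontier {lam : ℂ | TwoParabolic.IsNSDC (TwoParabolic.groupG lam)} =
      {lam : ℂ | lam.im ^ 2 = 16 - 8 * |lam.re|}) ∧
    -- the conjugation invariant form, and the discreteness criterion
    (∀ S T : TwoParabolic.SL2C,
      Matrix.trace (S : Matrix (Fin 2) (Fin 2) ℂ) = 2 →
      Matrix.trace (T : Matrix (Fin 2) (Fin 2) ℂ) = 2 →
      (TwoParabolic.IsNSDC (TwoParabolic.generatedBy S T) ↔
        8 ≤ ‖Matrix.trace ((S * T : TwoParabolic.SL2C) : Matrix (Fin 2) (Fin 2) ℂ) - 2‖ +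
          |(Matrix.trace ((S * T : TwoParabolic.SL2C) : Matrix (Fin 2) (Fin 2) ℂ) - 2).re|) ∧
      (8 ≤ ‖Matrix.trace ((S * T : TwoParabolic.SL2C) : Matrix (Fin 2) (Fin 2) ℂ) - 2‖ +
          |(Matrix.trace ((S * T : TwoParabolic.SL2C) : Matrix (Fin 2) (Fin 2) ℂ) - 2).re| →
        DiscreteTopology (TwoParabolic.generatedBy S T))) := by
  have polar (lam : ℂ) : lam = (‖lam‖ : ℂ) * Complex.exp ((lam.arg : ℂ) * Complex.I) :=
    (Complex.norm_mul_exp_arg_mul_I lam).symm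
  rw [TwoParabolic.frontier_setOf_isNSDC_groupG]
  refine ⟨fun lam ω h => ?_, Set.ext fun lam => ⟨fun h => ?_, fun ⟨ω, hlam, h⟩ => ?_⟩,
    Set.ext TwoParabolic.norm_add_abs_re_eq_four_iff, fun S T hS hT => ⟨?_, fun h => ?_⟩⟩
  · rw [TwoParabolic.isNSDC_groupG_iff, TwoParabolic.norm_mul_one_add_abs_cos h]
  · exact ⟨lam.arg, polar lam, (TwoParabolic.norm_mul_one_add_abs_cos (polar lam)).trans h⟩
  · exact (TwoParabolic.norm_mul_one_add_abs_cos hlam).symm.trans h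
  · exact TwoParabolic.isNSDC_generatedBy_iff hS hT
  · exact TwoParabolic.discreteTopology_of_isNSDC (TwoParabolic.isNSDC_of_eight_le hS hT h)
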